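/- For $\alpha,\lambda>0$ and $\beta\in(0,1)$ let $\mathrm{TS}_+(\alpha,\beta,\lambda)$ be the probability law on $[0,\infty)$ with characteristic function $u\mapsto\exp\left(\int_0^\infty (e^{iuy}-1)\,\alpha\, e^{-\lambda y}y^{-1-\beta}\,dy\right)$, let $\mathrm{TS}_-(\alpha,\beta,\lambda)$ be its image under $y\mapsto -y$, and let $$\mathrm{TS}(\alpha_+,\beta_+,\lambda_+,\alpha_-,\beta_-,\lambda_-)=\mathrm{TS}_+(\alpha_+,\beta_+,\lambda_+)\ast\mathrm{TS}_-(\alpha_-,\beta_-,\lambda_-).$$ Let $\alpha_\pm,\lambda_\pm>0$ and let $\beta_\pm\in(0,1)$ be irrational, such that $m\beta_++n\beta_-\notin\mathbb Z$ for all integers $m,n\ge 1$. Put $a_\pm=-\alpha_\pm\Gamma(-\beta_\pm)$, $\underline\lambda=\lambda_++\lambda_-$ and $\gamma=a_+\lambda_+^{\beta_+}+a_-\lambda_-^{\beta_-}$. Then the law $\mathrm{TS}(\alpha_+,\beta_+,\lambda_+,\alpha_-,\beta_-,\lambda_-)$ has a continuous density $f$ on $\mathbb R$, and for every $x>0$ $$f(x)=e^{\gamma-\lambda_+x}\sum_{(n_1,n_2,n_3)\in\mathbb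 N^3}\frac{(-1)^{n_1+n_2+n_3}a_+^{n_2}a_-^{n_3}}{n_1!\,n_2!\,n_3!}\left(d^{(1)}_{n}(x)+d^{(2)}_{n}(x)\right),$$ where $\mathbb N=\{0,1,2,\dots\}$, $n=(n_1,n_2,n_3)$ and $$d^{(1)}_{n}(x)=\frac{\Gamma(1-n_1+\beta_+n_2+\beta_-n_3)\,\Gamma(n_1-\beta_-n_3)}{\Gamma(1+\beta_+n_2)\,\Gamma(-\beta_+n_2)\,\Gamma(-\beta_-n_3)}\,\underline\lambda^{n_1}x^{-1+n_1-\beta_+n_2-\beta_-n_3},$$ $$d^{(2)}_{n}(x)=\frac{\Gamma(-1-n_1-\beta_+n_2-\beta_-n_3)\,\Gamma(1+n_1+\beta_+n_2)}{\Gamma(-\beta_+n_2)\,\Gamma(1+\beta_+n_2)\,\Gamma(-\beta_-n_3)}\,\underline\lambda^{1+n_1+\beta_+n_2+\beta_-n_3}x^{n_1}.$$ Here the quotient $\Gamma(n_1-\beta_-n_3)/\Gamma(-\beta_-n_3)$ is read as the Pochhammer symbol $(-\beta_-n_3)_{n_1}=\prod_{j=0}^{n_1-1}(j-\beta_-n_3)$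 (so it is $1$ for $n_1=0$), $1/\Gamma(0)=0$, and $d^{(1)}_n=d^{(2)}_n=0$ when $n_2=n_3=0$. The series is summed as follows: for all $n_2,n_3$ the sum over $n_1$ converges absolutely, and then so does the sum of the results over $(n_2,n_3)\in\mathbb N^2$. If moreover there are $c>0$ and $K\in\mathbb R$ with $|m\beta_++n\beta_--k|\ge c\,e^{-K(m+n)}$ for all integers $m,n\ge1$ and $k$, then the triple series converges absolutely over $\mathbb N^3$, to the same sum. For $x<0$ the same holds with $x$ replaced by $-x$ and the parameters $(\alpha_+,\beta_+,\lambda_+)$ and $(\alpha_-,\beta_-,\lambda_-)$ exchanged on the right-hand side. -/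

import Mathlib

open MeasureTheory

noncomputable section

/-- `μ` is the one-sided tempered stable law `TS₊(α, β, l)`: a probability law carried by `[0, ∞)`
whose characteristic function is `exp (∫ (e^{iux} - 1) ν(x) dx)` for the Lévy density
`ν(x) = α e^{-l x} / x^{1+β}` on `(0, ∞)`. -/
structure IsTSPlus (α β l : ℝ) (μ : Measure ℝ) : Prop where
  isProb : IsProbabilityMeasure μ
  support : μ (Set.Iio 0) = 0
  charFun_eq : ∀ u : ℝ, charFun μ u =
    Complex.exp (∫ x in Set.Ioi (0 : ℝ),
      (Complex.exp (Complex.I * u * x) - 1) *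
        ((α * (Real.exp (-l * x) / x ^ (1 + β)) : ℝ) : ℂ))

/-- `TS₋(α, β, l)`: the image of `TS₊(α, β, l)` under `x ↦ -x`. -/
def IsTSMinus (α β l : ℝ) (μ : Measure ℝ) : Prop :=
  ∃ ρ : Measure ℝ, IsTSPlus α β l ρ ∧ μ = ρ.map (fun x => -x)

/-- The double-sided law `TS(αp, βp, lp, αm, βm, lm) = TS₊(αp, βp, lp) ∗ TS₋(αm, βm, lm)`. -/
def IsTS (αp βp lp αm βm lm : ℝ) (μ : Measure ℝ) : Prop :=
  ∃ μp μm : Measure ℝ, IsTSPlus αp βp lp μp ∧ IsTSMinus αm βm lm μm ∧ μ = μp.conv μm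

/-- `f` is the continuous probability density of `μ` (there is at most one). -/
structure IsContinuousDensity (μ : Measure ℝ) (f : ℝ → ℝ) : Prop where
  continuous : Continuous f
  nonneg : ∀ x, 0 ≤ f x
  eq_withDensity : μ = volume.withDensity (fun x => ENNReal.ofReal (f x))

/-- The constant `a = -α Γ(-β)`. -/
def tsA (α β : ℝ) : ℝ := -α * Real.Gamma (-β)

/-- The constant `γ = a₊ lp^βp + a₋ lm^βm`. -/
def tsGamma (αp βp lp αm βm lm : ℝ) : ℝ :=
  tsA αp βp * lp ^ βp + tsA αm βm * lm ^ βm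

/-- The quotient `Γ(z + n) / Γ(z)`, continuously extended to its removable singularities
at `z = 0`: it is `1` for `n = 0`, and `Γ(n) / Γ(0)` is `0` for `n ≥ 1`, in accordance with
the convention `Real.Gamma 0 = 0`, `y / 0 = 0`. -/
def gammaQuot (z : ℝ) (n : ℕ) : ℝ :=
  if n = 0 then 1 else Real.Gamma (z + n) / Real.Gamma z

/-- The coefficient `d⁽¹⁾`, with `L = lp + lm`. The value `1 / Γ(0)` is `0`, and the quotient
`Γ(n₁ - βm n₃) / Γ(-βm n₃)` is read as `gammaQuot (-βm n₃) n₁`. -/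
def tsD1 (βp βm L : ℝ) (n₁ n₂ n₃ : ℕ) (x : ℝ) : ℝ :=
  Real.Gamma (1 - n₁ + βp * n₂ + βm * n₃) * gammaQuot (-(βm * n₃)) n₁ /
      (Real.Gamma (1 + βp * n₂) * Real.Gamma (-(βp * n₂))) *
    L ^ n₁ * x ^ (-1 + n₁ - βp * n₂ - βm * n₃)

/-- The coefficient `d⁽²⁾`, with `L = lp + lm` and `1 / Γ(0) = 0`. -/
def tsD2 (βp βm L : ℝ) (n₁ n₂ n₃ : ℕ) (x : ℝ) : ℝ :=
  Real.Gamma (-1 - n₁ - βp * n₂ - βm * n₃) * Real.Gamma (1 + n₁ + βp * n₂) /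
      (Real.Gamma (-(βp * n₂)) * Real.Gamma (1 + βp * n₂) * Real.Gamma (-(βm * n₃))) *
    L ^ (1 + n₁ + βp * n₂ + βm * n₃) * x ^ n₁

/-- The general term of the triple series. -/
def tsTerm (αp βp lp αm βm lm x : ℝ) (n₁ n₂ n₃ : ℕ) : ℝ :=
  (-1) ^ (n₁ + n₂ + n₃) * tsA αp βp ^ n₂ * tsA αm βm ^ n₃ /
      (n₁.factorial * n₂.factorial * n₃.factorial) *
    (tsD1 βp βm (lp + lm) n₁ n₂ n₃ x + tsD2 βp βm (lp + lm) n₁ n₂ n₃ x)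

/-- `∑_{(n₂, n₃)} (∑_{n₁} t n₁ n₂ n₃) = T`, all the sums being absolutely convergent. -/
def HasIteratedSum (t : ℕ → ℕ → ℕ → ℝ) (T : ℝ) : Prop :=
  ∃ S : ℕ × ℕ → ℝ,
    (∀ n₂ n₃ : ℕ, HasSum (fun n₁ => t n₁ n₂ n₃) (S (n₂, n₃))) ∧ HasSum S T

/-- `∑_{(n₁, n₂, n₃)} t n₁ n₂ n₃ = T`, absolutely convergent as a triple series. -/
def HasTripleSum (t : ℕ → ℕ → ℕ → ℝ) (T : ℝ) : Prop :=
  HasSum (fun n : ℕ × ℕ × ℕ => t n.1 n.2.1 n.2.2) T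

/-- The distance of `m βp + n βm` to the integers decays at most exponentially in `m + n`. -/
def NoSmallDivisors (βp βm : ℝ) : Prop :=
  ∃ c K : ℝ, 0 < c ∧ ∀ m n : ℕ, 1 ≤ m → 1 ≤ n → ∀ k : ℤ,
    c * Real.exp (-K * (m + n)) ≤ |m * βp + n * βm - k|

end

/-!
With `L = λ₊ + λ₋` and `w = λ₊ - iu`, Fourier inversion writes `f x` as `e^{γ - λ₊ x} / (2πi)` times
the integral of `exp (x w - a₊ w^β₊ - a₋ (L - w)^β₋)` over the line `re w = λ₊`. For `x > 0` both
halves of this line are rotated, by Cauchy's theorem, onto the cut `w ≤ 0`. Since the two boundary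
values on the cut are complex conjugate, what remains is the integral over `s = -w > 0` of an
imaginary part, and expanding the exponentials of the two fractional powers turns it into a double
series of the integrals `∫₀^∞ e^{-xs} s^{β₊ n₂} (L + s)^{β₋ n₃} ds`, weighted by `sin (π β₊ n₂)`.

Each of these integrals is a Tricomi confluent hypergeometric function, and its expansion at `0`
consists of the two Kummer series whose terms are `d⁽¹⁾` and `d⁽²⁾`. To prove this expansion, let
`D b c` be the difference of its two sides. Then `D b c` and `D b (c - 1)` solve a linear system
of two first order differential equations that is singular at `0`, and they vanish at `0` fast
enough to vanish identically.

For the triple series only the Gamma factors at negative arguments have to be controlled. By the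
reflection formula they cost one inverse power of the distance of `β₊ n₂ + β₋ n₃` to the integers,
which is at most exponential in `n₂ + n₃` and therefore harmless next to `n₂! n₃!`.
-/

namespace TemperedStable

open Set Filter Topology ProbabilityTheory

/-! ### Beta and Laplace integrals -/

/-- `c` is not an integer. -/
def NotInt (c : ℝ) : Prop := ∀ k : ℤ, c ≠ k

namespace NotInt

variable {c : ℝ}

theorem add_intCast (h : NotInt c) (k : ℤ) : NotInt (c + k) := fun m hm =>
  h (m - k) (by push_cast; linarith)

theorem add_one (h : NotInt c) : NotInt (c + 1) := mod_cast h.add_intCast 1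

theorem sub_one (h : NotInt c) : NotInt (c - 1) := by
  simpa [sub_eq_add_neg] using h.add_intCast (-1)

theorem neg (h : NotInt c) : NotInt (-c) := fun m hm => h (-m) (by push_cast; linarith)

theorem ne_zero (h : NotInt c) : c ≠ 0 := by simpa using h 0

theorem add_intCast_ne_zero (h : NotInt c) (k : ℤ) : c + k ≠ 0 := (h.add_intCast k).ne_zero

end NotInt

section RealIntegrals

variable {b c : ℝ}

theorem exists_rpow_add_le_exp (c : ℝ) {z ε : ℝ} (hz : 0 < z) (hε : 0 < ε) :
    ∃ C, ∀ s, 0 < s → (z + s) ^ c ≤ C * Real.exp (ε * s) := by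
  rcases le_or_gt c 0 with hc | hc
  · refine ⟨z ^ c, fun s hs => ?_⟩
    calc (z + s) ^ c ≤ z ^ c := Real.rpow_le_rpow_of_nonpos hz (by linarith) hc
      _ ≤ z ^ c * Real.exp (ε * s) :=
        le_mul_of_one_le_right (by positivity) (Real.one_le_exp (by positivity))
  · refine ⟨(c / ε) ^ c * Real.exp (ε * z), fun s hs => ?_⟩
    have hle : ε / c * (z + s) ≤ Real.exp (ε / c * (z + s)) := by
      linarith [Real.add_one_le_exp (ε / c * (z + s))]
    calc (z + s) ^ c = (c / ε * (ε / c * (z + s))) ^ c := by congr 1; field_simp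
      _ ≤ (c / ε * Real.exp (ε / c * (z + s))) ^ c := by gcongr
      _ = (c / ε) ^ c * Real.exp (ε / c * (z + s) * c) := by
        rw [Real.mul_rpow (by positivity) (by positivity), ← Real.exp_mul]
      _ = (c / ε) ^ c * Real.exp (ε * z) * Real.exp (ε * s) := by
        rw [mul_assoc ((c / ε) ^ c), ← Real.exp_add]
        congr 2
        field_simp

theorem integrableOn_exp_mul_rpow {r : ℝ} (hb : -1 < b) (hr : 0 < r) :
    IntegrableOn (fun s : ℝ => Real.exp (-(r * s)) * s ^ b) (Ioi 0) := by
  simpa [mul_comm] using integrableOn_rpow_mul_exp_neg_mul_rpow (p := 1) hb one_pos hr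

theorem integrableOn_exp_mul_rpow_mul_add_rpow (hb : -1 < b) (c : ℝ) {z r : ℝ} (hz : 0 < z)
    (hr : 0 < r) :
    IntegrableOn (fun s : ℝ => Real.exp (-(r * s)) * s ^ b * (z + s) ^ c) (Ioi 0) := by
  obtain ⟨C, hC⟩ := exists_rpow_add_le_exp c hz (half_pos hr)
  refine Integrable.mono' ((integrableOn_exp_mul_rpow hb (half_pos hr)).const_mul C)
    (by fun_prop) (ae_restrict_of_forall_mem measurableSet_Ioi fun s (hs : 0 < s) => ?_)
  rw [Real.norm_of_nonneg (by positivity)]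
  calc Real.exp (-(r * s)) * s ^ b * (z + s) ^ c
      ≤ Real.exp (-(r * s)) * s ^ b * (C * Real.exp (r / 2 * s)) := by gcongr; exact hC s hs
    _ = C * (Real.exp (-(r * s) + r / 2 * s) * s ^ b) := by rw [Real.exp_add]; ring
    _ = C * (Real.exp (-(r / 2 * s)) * s ^ b) := by ring_nf

theorem rpow_le_add_rpow {u v w : ℝ} (c : ℝ) (hu : 0 < u) (huv : u ≤ v) (hvw : v ≤ w) :
    v ^ c ≤ u ^ c + w ^ c := by
  have hv : 0 < v := hu.trans_le huv
  have hw : 0 < w := hv.trans_le hvw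
  rcases le_or_gt c 0 with hc | hc
  · exact (Real.rpow_le_rpow_of_nonpos hu huv hc).trans (le_add_of_nonneg_right (by positivity))
  · exact (Real.rpow_le_rpow hv.le hvw hc.le).trans (le_add_of_nonneg_left (by positivity))

theorem tendsto_const_mul_rpow_zero (C : ℝ) {q : ℝ} (hq : 0 < q) :
    Tendsto (fun z : ℝ => C * z ^ q) (𝓝[>] 0) (𝓝 0) := by
  have h : ContinuousAt (fun z : ℝ => C * z ^ q) 0 :=
    (Real.continuousAt_rpow_const _ _ (Or.inr hq.le)).const_mul C
  simpa [hq.ne'] using h.tendsto.mono_left nhdsWithin_le_nhds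

theorem integrableOn_rpow_mul_one_add_rpow (hb : -1 < b) (hbc : b + c < -1) :
    IntegrableOn (fun t : ℝ => t ^ b * (1 + t) ^ c) (Ioi 0) := by
  have hc : c ≤ 0 := by linarith
  rw [← Ioc_union_Ioi_eq_Ioi (zero_le_one' ℝ)]
  refine IntegrableOn.union ?_ ?_
  · have h : IntegrableOn (fun t : ℝ => t ^ b) (Ioc 0 1) :=
      (intervalIntegrable_iff_integrableOn_Ioc_of_le zero_le_one).1
        (intervalIntegral.intervalIntegrable_rpow' hb)
    refine Integrable.mono' h (by fun_prop)
      (ae_restrict_of_forall_mem measurableSet_Ioc fun t ht => ?_)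
    have ht0 : 0 < t := ht.1
    rw [Real.norm_of_nonneg (by positivity)]
    exact mul_le_of_le_one_right (by positivity)
      (Real.rpow_le_one_of_one_le_of_nonpos (by linarith) hc)
  · refine Integrable.mono' (integrableOn_Ioi_rpow_of_lt hbc one_pos) (by fun_prop)
      (ae_restrict_of_forall_mem measurableSet_Ioi fun t (ht : 1 < t) => ?_)
    have ht0 : 0 < t := one_pos.trans ht
    rw [Real.norm_of_nonneg (by positivity), Real.rpow_add ht0]
    exact mul_le_mul_of_nonneg_left
      (Real.rpow_le_rpow_of_nonpos ht0 (by linarith) hc) (by positivity)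

section Beta

-- With `1 / Γ(-c) ∫ u^{-c-1} e^{-(1+t)u} du = (1 + t)^c`, the Beta integral becomes a double
-- integral in which the integration over `t` can be carried out first.

theorem integral_rpow_mul_exp_eq_one_add_rpow (b : ℝ) (hc : c < 0) {t : ℝ} (ht : 0 < t) :
    ∫ u in Ioi (0 : ℝ), t ^ b * (u ^ (-c - 1) * Real.exp (-((1 + t) * u))) =
      t ^ b * (1 + t) ^ c * Real.Gamma (-c) := by
  rw [integral_const_mul, Real.integral_rpow_mul_exp_neg_mul_Ioi (neg_pos.2 hc) (by linarith),
    one_div, Real.inv_rpow (by linarith), Real.rpow_neg (by linarith), inv_inv, mul_assoc]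

theorem integral_rpow_mul_exp_eq_Gamma (hb : -1 < b) (c : ℝ) {u : ℝ} (hu : 0 < u) :
    ∫ t in Ioi (0 : ℝ), t ^ b * (u ^ (-c - 1) * Real.exp (-((1 + t) * u))) =
      Real.Gamma (1 + b) * (Real.exp (-u) * u ^ (-1 - b - c - 1)) := by
  have hsplit (t : ℝ) : t ^ b * (u ^ (-c - 1) * Real.exp (-((1 + t) * u))) =
      (u ^ (-c - 1) * Real.exp (-u)) * (t ^ (1 + b - 1) * Real.exp (-(u * t))) := by
    rw [show -((1 + t) * u) = -u + -(u * t) by ring, Real.exp_add, add_sub_cancel_left]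
    ring
  simp_rw [hsplit]
  rw [integral_const_mul, Real.integral_rpow_mul_exp_neg_mul_Ioi (by linarith) hu, one_div,
    Real.inv_rpow hu.le, ← Real.rpow_neg hu.le,
    show -1 - b - c - 1 = (-c - 1) + -(1 + b) by ring, Real.rpow_add hu]
  ring

theorem integrable_prod_rpow_mul_exp (hb : -1 < b) (hbc : b + c < -1) :
    Integrable (Function.uncurry fun t u : ℝ =>
      t ^ b * (u ^ (-c - 1) * Real.exp (-((1 + t) * u))))
      ((volume.restrict (Ioi 0)).prod (volume.restrict (Ioi 0))) := by
  have hmeas : Measurable (Function.uncurry fun t u : ℝ =>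
      t ^ b * (u ^ (-c - 1) * Real.exp (-((1 + t) * u)))) := by
    unfold Function.uncurry; fun_prop
  refine (integrable_prod_iff hmeas.aestronglyMeasurable).2 ⟨?_, ?_⟩
  · refine ae_restrict_of_forall_mem measurableSet_Ioi fun t (ht : 0 < t) => ?_
    refine Integrable.const_mul ?_ (t ^ b)
    simpa only [mul_comm, IntegrableOn] using
      integrableOn_exp_mul_rpow (b := -c - 1) (r := 1 + t) (by linarith) (by linarith)
  · refine IntegrableOn.congr_fun
      ((integrableOn_rpow_mul_one_add_rpow hb hbc).mul_const (Real.Gamma (-c)))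
      (fun t (ht : 0 < t) => ?_) measurableSet_Ioi
    rw [← integral_rpow_mul_exp_eq_one_add_rpow b (by linarith) ht]
    refine setIntegral_congr_fun measurableSet_Ioi fun u (hu : 0 < u) => ?_
    simp only [Function.uncurry]
    rw [Real.norm_of_nonneg (by positivity)]

theorem integral_rpow_mul_one_add_rpow (hb : -1 < b) (hbc : b + c < -1) :
    ∫ t in Ioi (0 : ℝ), t ^ b * (1 + t) ^ c =
      Real.Gamma (1 + b) * Real.Gamma (-1 - b - c) / Real.Gamma (-c) := by
  have hc : c < 0 := by linarith
  rw [eq_div_iff (Real.Gamma_pos_of_pos (neg_pos.2 hc)).ne', ← integral_mul_const]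
  calc ∫ t in Ioi (0 : ℝ), t ^ b * (1 + t) ^ c * Real.Gamma (-c)
      = ∫ t in Ioi (0 : ℝ), ∫ u in Ioi (0 : ℝ),
          t ^ b * (u ^ (-c - 1) * Real.exp (-((1 + t) * u))) :=
        setIntegral_congr_fun measurableSet_Ioi fun t ht =>
          (integral_rpow_mul_exp_eq_one_add_rpow b hc ht).symm
    _ = ∫ u in Ioi (0 : ℝ), ∫ t in Ioi (0 : ℝ),
          t ^ b * (u ^ (-c - 1) * Real.exp (-((1 + t) * u))) :=
        integral_integral_swap (integrable_prod_rpow_mul_exp hb hbc)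
    _ = ∫ u in Ioi (0 : ℝ), Real.Gamma (1 + b) * (Real.exp (-u) * u ^ (-1 - b - c - 1)) :=
        setIntegral_congr_fun measurableSet_Ioi fun u hu =>
          integral_rpow_mul_exp_eq_Gamma hb c hu
    _ = Real.Gamma (1 + b) * Real.Gamma (-1 - b - c) := by
        rw [integral_const_mul, ← Real.Gamma_eq_integral (by linarith)]

end Beta

end RealIntegrals

section TricomiIntegral

variable {b c z : ℝ}

/-- The integral `∫₀^∞ e^{-s} s^b (z + s)^c ds`. It equals
`Γ(1 + b) z^{1 + b + c} U(1 + b, 2 + b + c, z)`, where `U` is Tricomi's confluent hypergeometric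
function. -/
noncomputable def tricomiInt (b c z : ℝ) : ℝ :=
  ∫ s in Ioi (0 : ℝ), Real.exp (-s) * s ^ b * (z + s) ^ c

/-- The Laplace transform at `x` of `s ↦ s^b (z + s)^c`. -/
noncomputable def laplaceInt (b c z x : ℝ) : ℝ :=
  ∫ s in Ioi (0 : ℝ), Real.exp (-(x * s)) * s ^ b * (z + s) ^ c

theorem laplaceInt_eq_tricomiInt (b c : ℝ) (hz : 0 < z) {x : ℝ} (hx : 0 < x) :
    laplaceInt b c z x = x ^ (-(1 + b + c)) * tricomiInt b c (x * z) := by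
  have hsub := integral_comp_mul_left_Ioi
    (fun s : ℝ => Real.exp (-s) * s ^ b * (x * z + s) ^ c) 0 hx
  rw [mul_zero, smul_eq_mul, inv_mul_eq_div, eq_div_iff hx.ne'] at hsub
  rw [laplaceInt, tricomiInt, ← hsub, ← integral_mul_const, ← integral_const_mul]
  refine setIntegral_congr_fun measurableSet_Ioi fun s (hs : 0 < s) => ?_
  have hone : x ^ (-(1 + b + c)) * (x ^ (1 : ℝ) * x ^ b * x ^ c) = 1 := by
    simp only [← Real.rpow_add hx, neg_add_cancel, Real.rpow_zero]
  rw [Real.rpow_one] at hone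
  rw [← mul_add, Real.mul_rpow hx.le hs.le, Real.mul_rpow hx.le (by positivity)]
  linear_combination -(Real.exp (-(x * s)) * s ^ b * (z + s) ^ c) * hone

theorem integrableOn_tricomiInt (hb : -1 < b) (c : ℝ) (hz : 0 < z) :
    IntegrableOn (fun s : ℝ => Real.exp (-s) * s ^ b * (z + s) ^ c) (Ioi 0) := by
  simpa only [one_mul] using integrableOn_exp_mul_rpow_mul_add_rpow hb c hz one_pos

theorem hasDerivAt_tricomiInt (hb : -1 < b) (c : ℝ) (hz : 0 < z) :
    HasDerivAt (tricomiInt b c) (c * tricomiInt b (c - 1) z) z := by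
  have key := hasDerivAt_integral_of_dominated_loc_of_deriv_le (μ := volume.restrict (Ioi (0 : ℝ)))
    (F := fun z s : ℝ => Real.exp (-s) * s ^ b * (z + s) ^ c)
    (F' := fun z s : ℝ => c * (Real.exp (-s) * s ^ b * (z + s) ^ (c - 1))) (x₀ := z)
    (s := Ioo (z / 2) (2 * z))
    (bound := fun s => |c| * (Real.exp (-s) * s ^ b * (z / 2 + s) ^ (c - 1)
      + Real.exp (-s) * s ^ b * (2 * z + s) ^ (c - 1)))
    (Ioo_mem_nhds (by linarith) (by linarith)) (.of_forall fun _ => by fun_prop)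
    (integrableOn_tricomiInt hb c hz) (by fun_prop)
    (ae_restrict_of_forall_mem measurableSet_Ioi fun s (hs : 0 < s) y hy => ?_)
    (((integrableOn_tricomiInt hb (c - 1) (by linarith)).add
      (integrableOn_tricomiInt hb (c - 1) (by linarith))).const_mul _)
    (ae_restrict_of_forall_mem measurableSet_Ioi fun s (hs : 0 < s) y hy => ?_)
  · rw [tricomiInt, ← integral_const_mul]
    exact key.2
  · have hy0 : 0 < y := (half_pos hz).trans hy.1
    rw [norm_mul, Real.norm_eq_abs, Real.norm_of_nonneg (by positivity), ← mul_add]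
    gcongr
    exact rpow_le_add_rpow _ (by linarith) (by linarith [hy.1]) (by linarith [hy.2])
  · have hy0 : 0 < y := (half_pos hz).trans hy.1
    have hpow := ((hasDerivAt_id' y).add_const s).rpow_const (p := c) (Or.inl (by positivity))
    exact (hpow.const_mul _).congr_deriv (by ring)

theorem tricomiInt_add_one (hb : -1 < b) (c : ℝ) (hz : 0 < z) :
    tricomiInt b (c + 1) z = z * tricomiInt b c z + tricomiInt (b + 1) c z := by
  rw [tricomiInt, tricomiInt, tricomiInt, ← integral_const_mul, ← integral_add
    ((integrableOn_tricomiInt hb c hz).const_mul z) (integrableOn_tricomiInt (by linarith) c hz)]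
  refine setIntegral_congr_fun measurableSet_Ioi fun s (hs : 0 < s) => ?_
  rw [Real.rpow_add_one (by positivity), Real.rpow_add_one (by positivity)]
  ring

theorem tendsto_exp_neg_mul_rpow_mul_add_rpow_atTop (b c : ℝ) (hz : 0 < z) :
    Tendsto (fun s : ℝ => Real.exp (-s) * s ^ b * (z + s) ^ c) atTop (𝓝 0) := by
  obtain ⟨C, hC⟩ := exists_rpow_add_le_exp c hz one_half_pos
  have hlim := (tendsto_rpow_mul_exp_neg_mul_atTop_nhds_zero b (1 / 2) one_half_pos).const_mul C
  rw [mul_zero] at hlim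
  refine squeeze_zero' ?_ ?_ hlim
  · filter_upwards [eventually_gt_atTop 0] with s hs
    positivity
  · filter_upwards [eventually_gt_atTop 0] with s hs
    calc Real.exp (-s) * s ^ b * (z + s) ^ c
        ≤ Real.exp (-s) * s ^ b * (C * Real.exp (1 / 2 * s)) := by gcongr; exact hC s hs
      _ = C * (s ^ b * Real.exp (-s + 1 / 2 * s)) := by rw [Real.exp_add]; ring
      _ = C * (s ^ b * Real.exp (-(1 / 2) * s)) := by ring_nf

theorem hasDerivAt_exp_neg_mul_rpow_mul_add_rpow (b c : ℝ) {s : ℝ} (hs : s ≠ 0)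
    (hzs : z + s ≠ 0) :
    HasDerivAt (fun s => Real.exp (-s) * s ^ (b + 1) * (z + s) ^ c)
      ((b + 1) * (Real.exp (-s) * s ^ b * (z + s) ^ c)
        + c * (Real.exp (-s) * s ^ (b + 1) * (z + s) ^ (c - 1))
        - Real.exp (-s) * s ^ (b + 1) * (z + s) ^ c) s := by
  have dexp := (hasDerivAt_neg s).exp
  have dpow := Real.hasDerivAt_rpow_const (p := b + 1) (Or.inl hs)
  have dadd := ((hasDerivAt_id' s).const_add z).rpow_const (p := c) (Or.inl hzs)
  refine ((dexp.mul dpow).mul dadd).congr_deriv ?_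
  rw [Pi.mul_apply, add_sub_cancel_right]
  ring

theorem tricomiInt_add_one_left (hb : -1 < b) (c : ℝ) (hz : 0 < z) :
    tricomiInt (b + 1) c z = (b + 1) * tricomiInt b c z + c * tricomiInt (b + 1) (c - 1) z := by
  have hb' : -1 < b + 1 := by linarith
  have i1 := (integrableOn_tricomiInt hb c hz).const_mul (b + 1)
  have i2 := (integrableOn_tricomiInt hb' (c - 1) hz).const_mul c
  have i3 := integrableOn_tricomiInt hb' c hz
  have hcont : ContinuousWithinAt (fun s => Real.exp (-s) * s ^ (b + 1) * (z + s) ^ c)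
      (Ici 0) 0 := by
    have hpow := Real.continuousAt_rpow_const 0 (b + 1) (Or.inr (by linarith))
    have hadd : ContinuousAt (fun s : ℝ => (z + s) ^ c) 0 :=
      ContinuousAt.rpow_const (by fun_prop) (Or.inl (by simpa using hz.ne'))
    have hexp : ContinuousAt (fun s : ℝ => Real.exp (-s)) 0 := by fun_prop
    exact ((hexp.mul hpow).mul hadd).continuousWithinAt
  have key := integral_Ioi_of_hasDerivAt_of_tendsto hcont
    (fun s (hs : 0 < s) => hasDerivAt_exp_neg_mul_rpow_mul_add_rpow b c hs.ne' (by positivity))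
    ((i1.add i2).sub i3) (tendsto_exp_neg_mul_rpow_mul_add_rpow_atTop (b + 1) c hz)
  have hsub := integral_sub (i1.add i2) i3
  simp only [Pi.add_apply] at hsub
  rw [hsub, integral_add i1 i2, integral_const_mul, integral_const_mul,
    Real.zero_rpow (by linarith), mul_zero, zero_mul, sub_zero] at key
  unfold tricomiInt
  linarith

/-- The contiguity relation that is equivalent to Kummer's equation. -/
theorem tricomiInt_contiguous (hb : -1 < b) (c : ℝ) (hz : 0 < z) :
    z * (c * tricomiInt b (c - 1) z) =
      (b + 1 + c) * tricomiInt b c z - tricomiInt b (c + 1) z + z * tricomiInt b c z := by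
  have hc := tricomiInt_add_one hb c hz
  have hc' := tricomiInt_add_one hb (c - 1) hz
  have hparts := tricomiInt_add_one_left hb c hz
  rw [sub_add_cancel] at hc'
  linear_combination hparts + hc - c * hc'

theorem tendsto_tricomiInt_zero (hb : -1 < b) (hbc : -1 < b + c) :
    Tendsto (tricomiInt b c) (𝓝[>] 0) (𝓝 (Real.Gamma (1 + b + c))) := by
  have hpow : EqOn (fun s : ℝ => Real.exp (-s) * s ^ (b + c))
      (fun s => Real.exp (-s) * s ^ b * s ^ c) (Ioi 0) := fun s (hs : 0 < s) => by
    simp only [Real.rpow_add hs, mul_assoc]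
  have hΓ : Real.Gamma (1 + b + c) = ∫ s in Ioi (0 : ℝ), Real.exp (-s) * s ^ b * s ^ c := by
    rw [Real.Gamma_eq_integral (by linarith), ← setIntegral_congr_fun measurableSet_Ioi hpow]
    simp only [add_assoc, add_sub_cancel_left]
  rw [hΓ]
  refine tendsto_integral_filter_of_dominated_convergence
    (fun s => Real.exp (-s) * s ^ b * s ^ c + Real.exp (-s) * s ^ b * (1 + s) ^ c)
    (.of_forall fun _ => by fun_prop) ?_
    (Integrable.add ?_ (integrableOn_tricomiInt hb c one_pos))
    (ae_restrict_of_forall_mem measurableSet_Ioi fun s (hs : 0 < s) => ?_)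
  · filter_upwards [Ioo_mem_nhdsGT (zero_lt_one' ℝ)] with z hz
    refine ae_restrict_of_forall_mem measurableSet_Ioi fun s (hs : 0 < s) => ?_
    have hz0 := hz.1
    rw [Real.norm_of_nonneg (by positivity), ← mul_add]
    gcongr
    exact rpow_le_add_rpow c hs (by linarith) (by linarith [hz.2])
  · refine IntegrableOn.congr_fun ?_ hpow measurableSet_Ioi
    simpa only [one_mul] using integrableOn_exp_mul_rpow hbc one_pos
  · have hcont : ContinuousAt (fun z : ℝ => (z + s) ^ c) 0 :=
      ContinuousAt.rpow_const (by fun_prop) (Or.inl (by simpa using hs.ne'))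
    simpa using (hcont.tendsto.mono_left nhdsWithin_le_nhds).const_mul (Real.exp (-s) * s ^ b)

theorem tendsto_laplaceInt_one_zero (hb : -1 < b) (hbc : b + c < -1) :
    Tendsto (laplaceInt b c 1) (𝓝[>] 0)
      (𝓝 (Real.Gamma (1 + b) * Real.Gamma (-1 - b - c) / Real.Gamma (-c))) := by
  rw [← integral_rpow_mul_one_add_rpow hb hbc]
  refine tendsto_integral_filter_of_dominated_convergence (fun t => t ^ b * (1 + t) ^ c)
    (.of_forall fun _ => by fun_prop) ?_ (integrableOn_rpow_mul_one_add_rpow hb hbc)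
    (.of_forall fun t => tendsto_nhdsWithin_of_tendsto_nhds ?_)
  · filter_upwards [self_mem_nhdsWithin] with z (hz : 0 < z)
    refine ae_restrict_of_forall_mem measurableSet_Ioi fun t (ht : 0 < t) => ?_
    rw [Real.norm_of_nonneg (by positivity), mul_assoc]
    refine mul_le_of_le_one_left (by positivity) (Real.exp_le_one_iff.2 ?_)
    linarith [mul_pos hz ht]
  · have hcont : ContinuousAt (fun z : ℝ => Real.exp (-(z * t)) * t ^ b * (1 + t) ^ c) 0 := by
      fun_prop
    simpa using hcont.tendsto

theorem tendsto_rpow_mul_tricomiInt_zero (hb : -1 < b) (hbc : b + c < -1) :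
    Tendsto (fun z => z ^ (-(1 + b + c)) * tricomiInt b c z) (𝓝[>] 0)
      (𝓝 (Real.Gamma (1 + b) * Real.Gamma (-1 - b - c) / Real.Gamma (-c))) := by
  refine (tendsto_laplaceInt_one_zero hb hbc).congr' ?_
  filter_upwards [self_mem_nhdsWithin] with z hz
  rw [laplaceInt_eq_tricomiInt b c one_pos hz, mul_one]

end TricomiIntegral

/-! ### The connection formula -/

section PowerSeries

variable {a : ℕ → ℝ}

theorem norm_succ_mul_pow_le (a r : ℝ) (n : ℕ) {R : ℝ} (hR : 1 ≤ R) (hr : |r| ≤ R) :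
    ‖(n + 1 : ℝ) * a * r ^ n‖ ≤ ‖a * (2 * R) ^ (n + 1)‖ := by
  have hpow : |r| ^ n ≤ R ^ (n + 1) :=
    (pow_le_pow_left₀ (abs_nonneg r) hr _).trans (pow_le_pow_right₀ hR n.le_succ)
  have hn : (n : ℝ) + 1 ≤ 2 ^ (n + 1) := mod_cast Nat.lt_two_pow_self.le
  calc ‖(n + 1 : ℝ) * a * r ^ n‖ = |a| * ((n + 1 : ℝ) * |r| ^ n) := by
        rw [Real.norm_eq_abs, abs_mul, abs_mul, abs_pow, abs_of_nonneg (by positivity)]; ring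
    _ ≤ |a| * (2 ^ (n + 1) * R ^ (n + 1)) := by gcongr
    _ = ‖a * (2 * R) ^ (n + 1)‖ := by
        rw [Real.norm_eq_abs, abs_mul, ← mul_pow, abs_of_nonneg (a := (2 * R) ^ _) (by positivity)]

theorem summable_succ_mul_pow (ha : ∀ r : ℝ, Summable fun n => a n * r ^ n) (r : ℝ) :
    Summable fun n : ℕ => (n + 1 : ℝ) * a (n + 1) * r ^ n :=
  .of_norm_bounded ((summable_nat_add_iff 1).2 (ha (2 * max 1 |r|)).norm) fun n =>
    norm_succ_mul_pow_le _ r n (le_max_left _ _) (le_max_right _ _)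

theorem summable_natCast_mul_pow (ha : ∀ r : ℝ, Summable fun n => a n * r ^ n) (r : ℝ) :
    Summable fun n : ℕ => (n : ℝ) * a n * r ^ n := by
  rw [← summable_nat_add_iff 1]
  refine ((summable_succ_mul_pow ha r).mul_left r).congr fun n => ?_
  push_cast
  ring

theorem mul_tsum_succ_mul_pow (ha : ∀ r : ℝ, Summable fun n => a n * r ^ n) (r : ℝ) :
    r * ∑' n : ℕ, (n + 1 : ℝ) * a (n + 1) * r ^ n = ∑' n : ℕ, (n : ℝ) * a n * r ^ n := by
  rw [(summable_natCast_mul_pow ha r).tsum_eq_zero_add, ← tsum_mul_left, Nat.cast_zero, zero_mul,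
    zero_mul, zero_add]
  refine tsum_congr fun n => ?_
  push_cast
  ring

theorem hasDerivAt_tsum_mul_pow (ha : ∀ r : ℝ, Summable fun n => a n * r ^ n) (z : ℝ) :
    HasDerivAt (fun z => ∑' n, a n * z ^ n) (∑' n : ℕ, (n + 1 : ℝ) * a (n + 1) * z ^ n) z := by
  set r := |z| + 1 with hr
  have hr0 : 1 ≤ r := by linarith [abs_nonneg z]
  have hzr : z ∈ Metric.ball 0 r := by simp [hr]
  have key := hasDerivAt_tsum_of_isPreconnected (g := fun n z => a (n + 1) * z ^ (n + 1))
    (g' := fun n z => (n + 1 : ℝ) * a (n + 1) * z ^ n)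
    ((summable_nat_add_iff 1).2 (ha (2 * r)).norm) Metric.isOpen_ball
    (convex_ball (0 : ℝ) r).isPreconnected
    (fun n y _ => ((hasDerivAt_pow (n + 1) y).const_mul _).congr_deriv (by push_cast; ring))
    (fun n y hy => norm_succ_mul_pow_le _ _ _ hr0 (mem_ball_zero_iff.1 hy).le)
    hzr ((summable_nat_add_iff 1).2 (ha z)) hzr
  refine (key.const_add (a 0)).congr_of_eventuallyEq (.of_forall fun y => ?_)
  simpa using (ha y).tsum_eq_zero_add

theorem tendsto_tsum_mul_pow_zero (ha : ∀ r : ℝ, Summable fun n => a n * r ^ n) :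
    Tendsto (fun z => ∑' n, a n * z ^ n) (𝓝[>] 0) (𝓝 (a 0)) := by
  have hzero : ∑' n, a n * (0 : ℝ) ^ n = a 0 := by
    rw [tsum_eq_single 0 (fun n hn => by simp [hn]), pow_zero, mul_one]
  rw [← hzero]
  exact (hasDerivAt_tsum_mul_pow ha 0).continuousAt.tendsto.mono_left nhdsWithin_le_nhds

theorem summable_mul_pow_of_tendsto_ratio {ρ : ℕ → ℝ} (ha : ∀ n, a (n + 1) = a n * ρ n)
    (hρ : Tendsto ρ atTop (𝓝 0)) (r : ℝ) : Summable fun n => a n * r ^ n := by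
  have hlim : Tendsto (fun n => ‖ρ n * r‖) atTop (𝓝 0) := by simpa using (hρ.mul_const r).norm
  refine summable_of_ratio_norm_eventually_le one_half_lt_one ?_
  filter_upwards [hlim.eventually_le_const one_half_pos] with n hn
  calc ‖a (n + 1) * r ^ (n + 1)‖ = ‖ρ n * r‖ * ‖a n * r ^ n‖ := by
        rw [ha, ← norm_mul]; congr 1; ring
    _ ≤ 1 / 2 * ‖a n * r ^ n‖ := by gcongr

theorem tendsto_add_div_succ_mul_add_zero (p q : ℝ) :
    Tendsto (fun n : ℕ => (p + n) / ((n + 1) * (q + n))) atTop (𝓝 0) := by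
  have h := (tendsto_one_div_add_atTop_nhds_zero_nat (𝕜 := ℝ)).mul
    (tendsto_add_mul_div_add_mul_atTop_nhds p q 1 (one_ne_zero (α := ℝ)))
  rw [zero_mul] at h
  exact h.congr fun n => by rw [div_mul_div_comm, one_mul, one_mul]

end PowerSeries

section Coefficients

variable {b c : ℝ}

theorem succ_mul_choose_succ (r : ℝ) (n : ℕ) :
    (n + 1 : ℝ) * Ring.choose r (n + 1) = (r - n) * Ring.choose r n := by
  have h := Ring.choose_smul_choose r n.le_succ
  rw [Nat.succ_eq_add_one, Nat.choose_succ_self_right, add_tsub_cancel_left, Ring.choose_one_right,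
    nsmul_eq_mul] at h
  push_cast at h
  rw [h, mul_comm]

theorem succ_mul_choose_succ_eq_mul_choose_sub_one (r : ℝ) (n : ℕ) :
    (n + 1 : ℝ) * Ring.choose r (n + 1) = r * Ring.choose (r - 1) n := by
  have h := Ring.choose_smul_choose r (Nat.le_add_left 1 n)
  rw [Nat.choose_one_right, Ring.choose_one_right, add_tsub_cancel_right, nsmul_eq_mul] at h
  exact_mod_cast h

theorem inv_Gamma (s : ℝ) : (Real.Gamma s)⁻¹ = s * (Real.Gamma (s + 1))⁻¹ := by
  rcases eq_or_ne s 0 with rfl | hs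
  · simp
  · rw [Real.Gamma_add_one hs, mul_inv, mul_inv_cancel_left₀ hs]

theorem NotInt.sub_natCast_ne_zero (h : NotInt c) (n : ℕ) : c - n ≠ 0 := by
  simpa [sub_eq_add_neg] using h.add_intCast_ne_zero (-n)

theorem Gamma_one_add_sub_natCast (hc : NotInt c) (n : ℕ) :
    Real.Gamma (1 + c - n) = (c - n) * Real.Gamma (c - n) := by
  rw [← Real.Gamma_add_one (hc.sub_natCast_ne_zero n)]
  ring_nf

theorem Gamma_neg_one_sub_natCast_sub (hc : NotInt c) (n : ℕ) :
    Real.Gamma (-1 - n - c) = (-2 - n - c) * Real.Gamma (-2 - n - c) := by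
  rw [← Real.Gamma_add_one]
  · ring_nf
  · have h := hc.add_intCast_ne_zero (n + 2)
    push_cast at h
    exact fun h0 => h (by linarith)

/-- Power series coefficients of the part of `tricomiInt b c` that is regular at `0`. -/
noncomputable def tricomiRegCoeff (b c : ℝ) (n : ℕ) : ℝ :=
  Ring.choose c n * Real.Gamma (1 + (b + c) - n)

/-- Power series coefficients of the part of `tricomiInt b c` that is singular at `0`, divided by
`z ^ (1 + b + c)`. They vanish when `c` is a natural number, as `1 / Γ(-c) = 0` then. -/
noncomputable def tricomiSingCoeff (b c : ℝ) (n : ℕ) : ℝ :=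
  (-1) ^ n * Real.Gamma (-1 - n - (b + c)) * Real.Gamma (1 + n + b) / n.factorial *
    (Real.Gamma (-c))⁻¹

theorem tricomiRegCoeff_zero (b c : ℝ) : tricomiRegCoeff b c 0 = Real.Gamma (1 + (b + c)) := by
  simp [tricomiRegCoeff]

theorem tricomiSingCoeff_zero (b c : ℝ) :
    tricomiSingCoeff b c 0 =
      Real.Gamma (1 + b) * Real.Gamma (-1 - (b + c)) / Real.Gamma (-c) := by
  simp [tricomiSingCoeff, div_eq_mul_inv, mul_comm]

theorem succ_mul_tricomiRegCoeff (b c : ℝ) (n : ℕ) :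
    (n + 1 : ℝ) * tricomiRegCoeff b c (n + 1) = c * tricomiRegCoeff b (c - 1) n := by
  rw [tricomiRegCoeff, tricomiRegCoeff, ← mul_assoc, ← mul_assoc,
    succ_mul_choose_succ_eq_mul_choose_sub_one]
  push_cast
  ring_nf

theorem tricomiRegCoeff_succ (hbc : NotInt (b + c)) (n : ℕ) :
    tricomiRegCoeff b c (n + 1) =
      tricomiRegCoeff b c n * ((-c + n) / ((n + 1) * (-(b + c) + n))) := by
  have hn := hbc.sub_natCast_ne_zero n
  have hn' : -(b + c) + (n : ℝ) ≠ 0 := fun h => hn (by linarith)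
  rw [tricomiRegCoeff, tricomiRegCoeff, Gamma_one_add_sub_natCast hbc n, ← mul_div_assoc,
    eq_div_iff (by positivity)]
  push_cast
  rw [show 1 + (b + c) - (n + 1 : ℝ) = b + c - n by ring]
  linear_combination (-(b + c) + n) * Real.Gamma (b + c - n) * succ_mul_choose_succ c n

theorem tricomiRegCoeff_contiguous_zero (hbc : NotInt (b + c)) :
    (1 + b + c) * tricomiRegCoeff b c 0 = tricomiRegCoeff b (c + 1) 0 := by
  have h := hbc.add_intCast_ne_zero 1
  push_cast at h
  rw [tricomiRegCoeff_zero, tricomiRegCoeff_zero, show 1 + (b + (c + 1)) = b + c + 1 + 1 by ring,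
    Real.Gamma_add_one h]
  ring_nf

theorem tricomiRegCoeff_contiguous_succ (hbc : NotInt (b + c)) (n : ℕ) :
    (n + 1 : ℝ) * tricomiRegCoeff b c (n + 1) - (1 + b + c) * tricomiRegCoeff b c (n + 1)
      + tricomiRegCoeff b (c + 1) (n + 1) = tricomiRegCoeff b c n := by
  simp only [tricomiRegCoeff, Ring.choose_succ_succ]
  push_cast
  rw [show 1 + (b + (c + 1)) - (n + 1 : ℝ) = 1 + (b + c) - n by ring,
    show 1 + (b + c) - (n + 1 : ℝ) = b + c - n by ring, Gamma_one_add_sub_natCast hbc]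
  ring

theorem summable_tricomiRegCoeff (hbc : NotInt (b + c)) (r : ℝ) :
    Summable fun n => tricomiRegCoeff b c n * r ^ n :=
  summable_mul_pow_of_tendsto_ratio (tricomiRegCoeff_succ hbc)
    (tendsto_add_div_succ_mul_add_zero _ _) r

theorem add_mul_tricomiSingCoeff (hbc : NotInt (b + c)) (n : ℕ) :
    (1 + b + c + n) * tricomiSingCoeff b c n = c * tricomiSingCoeff b (c - 1) n := by
  have hbc' : NotInt (b + (c - 1)) := add_sub_assoc b c 1 ▸ hbc.sub_one
  rw [tricomiSingCoeff, tricomiSingCoeff, Gamma_neg_one_sub_natCast_sub hbc', inv_Gamma (-c)]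
  ring_nf

theorem tricomiSingCoeff_succ (hb : -1 < b) (hbc : NotInt (b + c)) (n : ℕ) :
    tricomiSingCoeff b c (n + 1) =
      tricomiSingCoeff b c n * ((1 + b + n) / ((n + 1) * (2 + b + c + n))) := by
  have hn : 2 + b + c + (n : ℝ) ≠ 0 := by
    have h := hbc.add_intCast_ne_zero (n + 2)
    push_cast at h
    exact fun h0 => h (by linarith)
  have hb' : 1 + (n : ℝ) + b ≠ 0 := by
    have := n.cast_nonneg (α := ℝ)
    linarith
  have hΓ : Real.Gamma (1 + (n + 1) + b) = (1 + n + b) * Real.Gamma (1 + n + b) := by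
    rw [← Real.Gamma_add_one hb']
    ring_nf
  simp only [tricomiSingCoeff, Nat.factorial_succ]
  push_cast
  rw [hΓ, Gamma_neg_one_sub_natCast_sub hbc,
    show -1 - (n + 1 : ℝ) - (b + c) = -2 - n - (b + c) by ring]
  field_simp
  ring

theorem succ_mul_tricomiSingCoeff (hb : -1 < b) (hbc : NotInt (b + c)) (n : ℕ) :
    (n + 1 : ℝ) * tricomiSingCoeff b c (n + 1) =
      tricomiSingCoeff b c n - tricomiSingCoeff b (c + 1) n := by
  have hn : 2 + b + c + (n : ℝ) ≠ 0 := by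
    have h := hbc.add_intCast_ne_zero (n + 2)
    push_cast at h
    exact fun h0 => h (by linarith)
  rw [tricomiSingCoeff_succ hb hbc]
  simp only [tricomiSingCoeff]
  rw [inv_Gamma (-(c + 1)), show -(c + 1) + 1 = -c by ring,
    show -1 - (n : ℝ) - (b + (c + 1)) = -2 - n - (b + c) by ring,
    Gamma_neg_one_sub_natCast_sub hbc]
  field_simp
  ring

theorem summable_tricomiSingCoeff (hb : -1 < b) (hbc : NotInt (b + c)) (r : ℝ) :
    Summable fun n => tricomiSingCoeff b c n * r ^ n :=
  summable_mul_pow_of_tendsto_ratio (tricomiSingCoeff_succ hb hbc)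
    (tendsto_add_div_succ_mul_add_zero _ _) r

end Coefficients

section SeriesParts

variable {b c : ℝ}

/-- The part of `tricomiInt b c` that is an entire function of `z`. -/
noncomputable def tricomiReg (b c z : ℝ) : ℝ := ∑' n, tricomiRegCoeff b c n * z ^ n

/-- The entire factor of `z ^ (1 + b + c)` in `tricomiInt b c z`. -/
noncomputable def tricomiSing (b c z : ℝ) : ℝ := ∑' n, tricomiSingCoeff b c n * z ^ n

theorem hasDerivAt_tricomiReg (hbc : NotInt (b + c)) (z : ℝ) :
    HasDerivAt (tricomiReg b c) (c * tricomiReg b (c - 1) z) z := by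
  refine (hasDerivAt_tsum_mul_pow (summable_tricomiRegCoeff hbc) z).congr_deriv ?_
  simp only [tricomiReg, ← tsum_mul_left, succ_mul_tricomiRegCoeff, mul_assoc]

theorem tricomiReg_contiguous (hbc : NotInt (b + c)) (z : ℝ) :
    z * (c * tricomiReg b (c - 1) z) =
      (1 + b + c) * tricomiReg b c z - tricomiReg b (c + 1) z + z * tricomiReg b c z := by
  have hs := summable_tricomiRegCoeff hbc
  have hs' : Summable fun n => tricomiRegCoeff b (c + 1) n * z ^ n :=
    summable_tricomiRegCoeff (add_assoc b c 1 ▸ hbc.add_one) z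
  have hderiv : z * (c * tricomiReg b (c - 1) z) =
      ∑' n : ℕ, (n : ℝ) * tricomiRegCoeff b c n * z ^ n := by
    rw [← mul_tsum_succ_mul_pow hs]
    simp only [tricomiReg, ← tsum_mul_left, succ_mul_tricomiRegCoeff, mul_assoc]
  have hdiff := (summable_natCast_mul_pow hs z).sub ((hs z).mul_left (1 + b + c))
  have hshift := (hdiff.add hs').tsum_eq_zero_add
  rw [hdiff.tsum_add hs', (summable_natCast_mul_pow hs z).tsum_sub ((hs z).mul_left _),
    tsum_mul_left, ← hderiv] at hshift
  have htail : ∑' n : ℕ, (((n + 1 : ℕ) : ℝ) * tricomiRegCoeff b c (n + 1) * z ^ (n + 1)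
      - (1 + b + c) * (tricomiRegCoeff b c (n + 1) * z ^ (n + 1))
      + tricomiRegCoeff b (c + 1) (n + 1) * z ^ (n + 1)) = z * tricomiReg b c z := by
    rw [tricomiReg, ← tsum_mul_left]
    refine tsum_congr fun n => ?_
    rw [← tricomiRegCoeff_contiguous_succ hbc n]
    push_cast
    ring
  rw [htail, Nat.cast_zero, zero_mul, zero_mul, pow_zero, mul_one, mul_one, zero_sub,
    tricomiRegCoeff_contiguous_zero hbc] at hshift
  unfold tricomiReg at *
  linarith

theorem tsum_succ_mul_tricomiSingCoeff (hb : -1 < b) (hbc : NotInt (b + c)) (z : ℝ) :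
    ∑' n : ℕ, (n + 1 : ℝ) * tricomiSingCoeff b c (n + 1) * z ^ n =
      tricomiSing b c z - tricomiSing b (c + 1) z := by
  have hs' : Summable fun n => tricomiSingCoeff b (c + 1) n * z ^ n :=
    summable_tricomiSingCoeff hb (add_assoc b c 1 ▸ hbc.add_one) z
  rw [tricomiSing, tricomiSing, ← (summable_tricomiSingCoeff hb hbc z).tsum_sub hs']
  simp only [succ_mul_tricomiSingCoeff hb hbc, sub_mul]

theorem hasDerivAt_tricomiSing (hb : -1 < b) (hbc : NotInt (b + c)) (z : ℝ) :
    HasDerivAt (tricomiSing b c) (tricomiSing b c z - tricomiSing b (c + 1) z) z :=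
  (hasDerivAt_tsum_mul_pow (summable_tricomiSingCoeff hb hbc) z).congr_deriv
    (tsum_succ_mul_tricomiSingCoeff hb hbc z)

theorem mul_tricomiSing_sub_one (hb : -1 < b) (hbc : NotInt (b + c)) (z : ℝ) :
    c * tricomiSing b (c - 1) z =
      (1 + b + c) * tricomiSing b c z + z * (tricomiSing b c z - tricomiSing b (c + 1) z) := by
  have hs := summable_tricomiSingCoeff hb hbc
  rw [← tsum_succ_mul_tricomiSingCoeff hb hbc, mul_tsum_succ_mul_pow hs, tricomiSing, tricomiSing,
    ← tsum_mul_left, ← tsum_mul_left,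
    ← ((hs z).mul_left _).tsum_add (summable_natCast_mul_pow hs z)]
  refine tsum_congr fun n => ?_
  linear_combination -z ^ n * add_mul_tricomiSingCoeff hbc n

end SeriesParts

section SingularSystem

theorem nonneg_of_hasDerivAt_nonneg {R z : ℝ} {g g' : ℝ → ℝ}
    (hg : ∀ z ∈ Ioo 0 R, HasDerivAt g (g' z) z) (hg' : ∀ z ∈ Ioo 0 R, 0 ≤ g' z)
    (hg0 : Tendsto g (𝓝[>] 0) (𝓝 0)) (hz : z ∈ Ioo 0 R) : 0 ≤ g z := by
  have hmono : MonotoneOn g (Ioo 0 R) := by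
    refine monotoneOn_of_deriv_nonneg (convex_Ioo 0 R) (HasDerivAt.continuousOn hg) ?_ ?_ <;>
      rw [interior_Ioo]
    · exact fun y hy => (hg y hy).differentiableAt.differentiableWithinAt
    · exact fun y hy => (hg y hy).deriv ▸ hg' y hy
  refine le_of_tendsto hg0 ?_
  filter_upwards [Ioo_mem_nhdsGT hz.1] with y hy
  exact hmono ⟨hy.1, hy.2.trans hz.2⟩ hz hy.2.le

theorem abs_le_of_abs_hasDerivAt_le {R z : ℝ} {f f' h h' : ℝ → ℝ}
    (hf : ∀ z ∈ Ioo 0 R, HasDerivAt f (f' z) z) (hh : ∀ z ∈ Ioo 0 R, HasDerivAt h (h' z) z)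
    (hle : ∀ z ∈ Ioo 0 R, |f' z| ≤ h' z) (hf0 : Tendsto f (𝓝[>] 0) (𝓝 0))
    (hh0 : Tendsto h (𝓝[>] 0) (𝓝 0)) (hz : z ∈ Ioo 0 R) : |f z| ≤ h z := by
  have hadd := nonneg_of_hasDerivAt_nonneg (g := fun z => h z + f z)
    (fun z hz => (hh z hz).add (hf z hz))
    (fun z hz => by linarith [(abs_le.1 (hle z hz)).1]) (by simpa using hh0.add hf0) hz
  have hsub := nonneg_of_hasDerivAt_nonneg (g := fun z => h z - f z)
    (fun z hz => (hh z hz).sub (hf z hz))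
    (fun z hz => by linarith [(abs_le.1 (hle z hz)).2]) (by simpa using hh0.sub hf0) hz
  exact abs_le.2 ⟨by linarith, by linarith⟩

theorem exists_abs_le_of_tendsto_zero {F : ℝ → ℝ} (hF : ∀ z, 0 < z → ContinuousAt F z)
    (hF0 : Tendsto F (𝓝[>] 0) (𝓝 0)) (R : ℝ) : ∃ M, 0 ≤ M ∧ ∀ z ∈ Ioo 0 R, |F z| ≤ M := by
  have hnear : ∀ᶠ z in 𝓝[>] (0 : ℝ), |F z| < 1 :=
    hF0.abs.eventually_lt_const (by simp)
  obtain ⟨ε, hε : 0 < ε, hsub⟩ := mem_nhdsGT_iff_exists_Ioo_subset.1 hnear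
  have hcont : ContinuousOn F (Icc (ε / 2) R) := fun z hz =>
    (hF z (by linarith [hz.1])).continuousWithinAt
  obtain ⟨C, hC⟩ := isCompact_Icc.exists_bound_of_continuousOn hcont
  refine ⟨max 1 C, by positivity, fun z hz => ?_⟩
  rcases lt_or_ge z ε with h | h
  · exact (hsub ⟨hz.1, h⟩ : |F z| < 1).le.trans (le_max_left _ _)
  · exact (hC z ⟨by linarith, hz.2.le⟩).trans (le_max_right _ _)

variable {p k R : ℝ} {F G : ℝ → ℝ}

theorem abs_right_le_of_abs_left_le {C : ℝ} {n : ℕ} (hp : p < 1)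
    (hG : ∀ z ∈ Ioo 0 R, HasDerivAt G (k * (z ^ (-p) * F z)) z)
    (hG0 : Tendsto G (𝓝[>] 0) (𝓝 0)) (hFC : ∀ y ∈ Ioo 0 R, |F y| ≤ C * y ^ n) :
    ∀ y ∈ Ioo 0 R, |G y| ≤ |k| * C / (n + 1 - p) * y ^ (n + 1 - p) := by
  have hq : 0 < (n : ℝ) + 1 - p := by linarith [n.cast_nonneg (α := ℝ)]
  refine fun y hy => abs_le_of_abs_hasDerivAt_le (h' := fun y => |k| * (y ^ (-p) * (C * y ^ n)))
    hG (fun y hy => ?_) (fun y hy => ?_) hG0 (tendsto_const_mul_rpow_zero _ hq) hy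
  · refine ((Real.hasDerivAt_rpow_const (Or.inl hy.1.ne')).const_mul _).congr_deriv ?_
    rw [show (n : ℝ) + 1 - p - 1 = -p + n by ring, Real.rpow_add hy.1, Real.rpow_natCast]
    field_simp
  · have hpow := Real.rpow_pos_of_pos hy.1 (-p)
    rw [abs_mul, abs_mul, abs_of_pos hpow]
    gcongr
    exact hFC y hy

theorem abs_left_le_of_abs_right_le {C : ℝ} {n : ℕ} (hp : p < 1) (hC : 0 ≤ C)
    (hF : ∀ z ∈ Ioo 0 R, HasDerivAt F (F z - z ^ (p - 1) * G z) z)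
    (hF0 : Tendsto F (𝓝[>] 0) (𝓝 0)) (hFC : ∀ y ∈ Ioo 0 R, |F y| ≤ C * y ^ n)
    (hGC : ∀ y ∈ Ioo 0 R, |G y| ≤ |k| * C / (n + 1 - p) * y ^ (n + 1 - p)) :
    ∀ y ∈ Ioo 0 R, |F y| ≤ C * (1 + |k| / (1 - p)) / (n + 1) * y ^ (n + 1) := by
  have hlim := tendsto_const_mul_rpow_zero (C * (1 + |k| / (1 - p)) / (n + 1))
    (q := ((n + 1 : ℕ) : ℝ)) (by positivity)
  simp only [Real.rpow_natCast] at hlim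
  refine fun y hy => abs_le_of_abs_hasDerivAt_le (h' := fun y => C * (1 + |k| / (1 - p)) * y ^ n)
    hF (fun y _ => ?_) (fun y hy => ?_) hF0 hlim hy
  · refine ((hasDerivAt_pow (n + 1) y).const_mul _).congr_deriv ?_
    push_cast
    field_simp
  · have hpow : 0 < y ^ (p - 1) := Real.rpow_pos_of_pos hy.1 _
    have hyn : 0 < y ^ n := pow_pos hy.1 n
    have hcancel : y ^ (p - 1) * y ^ ((n : ℝ) + 1 - p) = y ^ n := by
      rw [← Real.rpow_add hy.1, ← Real.rpow_natCast]
      ring_nf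
    calc |F y - y ^ (p - 1) * G y| ≤ |F y| + y ^ (p - 1) * |G y| := by
          simpa only [abs_mul, abs_of_pos hpow] using abs_sub (F y) (y ^ (p - 1) * G y)
      _ ≤ C * y ^ n + y ^ (p - 1) * (|k| * C / (n + 1 - p) * y ^ ((n : ℝ) + 1 - p)) := by
          gcongr
          exacts [hFC y hy, hGC y hy]
      _ = C * y ^ n + |k| * C / (n + 1 - p) * y ^ n := by rw [← hcancel]; ring
      _ ≤ C * y ^ n + |k| * C / (1 - p) * y ^ n := by
          gcongr
          linarith [n.cast_nonneg (α := ℝ)]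
      _ = C * (1 + |k| / (1 - p)) * y ^ n := by ring

theorem abs_le_pow_div_factorial_of_singular_system {M : ℝ} (hM : 0 ≤ M) (hp : p < 1)
    (hF : ∀ z ∈ Ioo 0 R, HasDerivAt F (F z - z ^ (p - 1) * G z) z)
    (hG : ∀ z ∈ Ioo 0 R, HasDerivAt G (k * (z ^ (-p) * F z)) z)
    (hF0 : Tendsto F (𝓝[>] 0) (𝓝 0)) (hG0 : Tendsto G (𝓝[>] 0) (𝓝 0))
    (hFM : ∀ y ∈ Ioo 0 R, |F y| ≤ M) (n : ℕ) :
    ∀ y ∈ Ioo 0 R, |F y| ≤ M * (1 + |k| / (1 - p)) ^ n / n.factorial * y ^ n := by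
  have : 0 < 1 - p := by linarith
  induction n with
  | zero => simpa using hFM
  | succ n ih =>
    have step := abs_left_le_of_abs_right_le hp (by positivity) hF hF0 ih
      (abs_right_le_of_abs_left_le hp hG hG0 ih)
    refine fun y hy => (step y hy).trans_eq ?_
    rw [Nat.factorial_succ]
    generalize 1 + |k| / (1 - p) = K
    push_cast
    field_simp
    ring

theorem eq_zero_of_singular_system (hp : p < 1)
    (hF : ∀ z, 0 < z → HasDerivAt F (F z - z ^ (p - 1) * G z) z)
    (hG : ∀ z, 0 < z → HasDerivAt G (k * (z ^ (-p) * F z)) z)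
    (hF0 : Tendsto F (𝓝[>] 0) (𝓝 0)) (hG0 : Tendsto G (𝓝[>] 0) (𝓝 0)) {z : ℝ} (hz : 0 < z) :
    F z = 0 := by
  obtain ⟨M, hM, hFM⟩ := exists_abs_le_of_tendsto_zero
    (fun z hz => (hF z hz).continuousAt) hF0 (z + 1)
  have hlim := (FloorSemiring.tendsto_pow_div_factorial_atTop ((1 + |k| / (1 - p)) * z)).const_mul M
  rw [mul_zero] at hlim
  refine abs_nonpos_iff.1 (ge_of_tendsto' hlim fun n => ?_)
  refine (abs_le_pow_div_factorial_of_singular_system hM hp (fun y hy => hF y hy.1)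
    (fun y hy => hG y hy.1) hF0 hG0 hFM n z ⟨hz, by linarith⟩).trans_eq ?_
  rw [mul_pow]
  ring

end SingularSystem

section ConnectionFormula

variable {b c z : ℝ}

/-- The difference of the two sides of the connection formula `tricomiInt_eq_reg_add_sing`. -/
noncomputable def tricomiDefect (b c z : ℝ) : ℝ :=
  tricomiInt b c z - tricomiReg b c z - z ^ (1 + b + c) * tricomiSing b c z

theorem hasDerivAt_tricomiDefect (hb : -1 < b) (hbc : NotInt (b + c)) (hz : 0 < z) :
    HasDerivAt (tricomiDefect b c) (c * tricomiDefect b (c - 1) z) z := by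
  have hsing := (Real.hasDerivAt_rpow_const (p := 1 + b + c) (Or.inl hz.ne')).mul
    (hasDerivAt_tricomiSing hb hbc z)
  refine (((hasDerivAt_tricomiInt hb c hz).sub
    (hasDerivAt_tricomiReg hbc z)).sub hsing).congr_deriv ?_
  have hpow : z ^ (1 + b + c) = z ^ (1 + b + c - 1) * z := by
    rw [← Real.rpow_add_one hz.ne', sub_add_cancel]
  rw [tricomiDefect, ← add_sub_assoc, hpow]
  linear_combination z ^ (1 + b + c - 1) * mul_tricomiSing_sub_one hb hbc z

theorem tricomiDefect_contiguous (hb : -1 < b) (hbc : NotInt (b + c)) (hz : 0 < z) :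
    z * (c * tricomiDefect b (c - 1) z) = (1 + b + c) * tricomiDefect b c z
      - tricomiDefect b (c + 1) z + z * tricomiDefect b c z := by
  have hpow : z ^ (1 + b + c) = z ^ (1 + b + c - 1) * z := by
    rw [← Real.rpow_add_one hz.ne', sub_add_cancel]
  have hpow' : z ^ (1 + b + (c + 1)) = z ^ (1 + b + c - 1) * z * z := by
    rw [← hpow, ← Real.rpow_add_one hz.ne', add_assoc (1 + b)]
  simp only [tricomiDefect]
  rw [← add_sub_assoc, hpow, hpow']
  linear_combination tricomiInt_contiguous hb c hz - tricomiReg_contiguous hbc z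
    - z ^ (1 + b + c - 1) * z * mul_tricomiSing_sub_one hb hbc z

theorem tendsto_tricomiDefect_zero (hb : -1 < b) (hbc : NotInt (b + c)) (hpos : -1 < b + c) :
    Tendsto (tricomiDefect b c) (𝓝[>] 0) (𝓝 0) := by
  have hreg := tendsto_tsum_mul_pow_zero (summable_tricomiRegCoeff hbc)
  have hsing := (tendsto_const_mul_rpow_zero 1 (q := 1 + b + c) (by linarith)).mul
    (tendsto_tsum_mul_pow_zero (summable_tricomiSingCoeff hb hbc))
  have h := ((tendsto_tricomiInt_zero hb hpos).sub hreg).sub hsing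
  simp only [tricomiRegCoeff_zero, ← add_assoc, sub_self, zero_mul, one_mul] at h
  exact h

theorem tendsto_rpow_mul_tricomiDefect_zero (hb : -1 < b) (hbc : NotInt (b + c))
    (hneg : b + c < -1) :
    Tendsto (fun z => z ^ (-(1 + b + c)) * tricomiDefect b c z) (𝓝[>] 0) (𝓝 0) := by
  have hreg := (tendsto_const_mul_rpow_zero 1 (q := -(1 + b + c)) (by linarith)).mul
    (tendsto_tsum_mul_pow_zero (summable_tricomiRegCoeff hbc))
  have hsing := tendsto_tsum_mul_pow_zero (summable_tricomiSingCoeff hb hbc)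
  have h := ((tendsto_rpow_mul_tricomiInt_zero hb hneg).sub hreg).sub hsing
  rw [tricomiSingCoeff_zero, zero_mul, sub_zero, sub_sub, sub_self] at h
  refine h.congr' ?_
  filter_upwards [self_mem_nhdsWithin] with z (hz : 0 < z)
  have hone : z ^ (-(1 + b + c)) * z ^ (1 + b + c) = 1 := by
    rw [← Real.rpow_add hz, neg_add_cancel, Real.rpow_zero]
  rw [tricomiDefect, tricomiReg, tricomiSing]
  linear_combination (∑' n, tricomiSingCoeff b c n * z ^ n) * hone

theorem tricomiDefect_eq_zero_of_mem_Ioo (hb : -1 < b) (hbc : NotInt (b + c))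
    (h : b + c ∈ Ioo (-2 : ℝ) (-1)) (hz : 0 < z) : tricomiDefect b c z = 0 := by
  have hbc' : NotInt (b + (c + 1)) := add_assoc b c 1 ▸ hbc.add_one
  have hF := eq_zero_of_singular_system (p := -(1 + b + c)) (k := c + 1) (by linarith [h.1])
    (F := fun z => z ^ (-(1 + b + c)) * tricomiDefect b c z) (G := tricomiDefect b (c + 1))
    (fun z hz => ?_) (fun z hz => ?_) (tendsto_rpow_mul_tricomiDefect_zero hb hbc h.2)
    (tendsto_tricomiDefect_zero hb hbc' (by linarith [h.1])) hz
  · exact (mul_eq_zero.1 hF).resolve_left (Real.rpow_pos_of_pos hz _).ne'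
  · refine ((Real.hasDerivAt_rpow_const (p := -(1 + b + c)) (Or.inl hz.ne')).mul
      (hasDerivAt_tricomiDefect hb hbc hz)).congr_deriv ?_
    have hpow : z ^ (-(1 + b + c)) = z ^ (-(1 + b + c) - 1) * z := by
      rw [← Real.rpow_add_one hz.ne', sub_add_cancel]
    rw [hpow]
    linear_combination z ^ (-(1 + b + c) - 1) * tricomiDefect_contiguous hb hbc hz
  · refine (hasDerivAt_tricomiDefect hb hbc' hz).congr_deriv ?_
    rw [← mul_assoc (z ^ _), ← Real.rpow_add hz, neg_add_cancel, Real.rpow_zero, one_mul,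
      add_sub_cancel_right]

theorem tricomiDefect_eq_zero_of_sub_one (hb : -1 < b) (hbc : NotInt (b + c)) (h : -1 < b + c)
    (h0 : ∀ z, 0 < z → tricomiDefect b (c - 1) z = 0) (hz : 0 < z) :
    tricomiDefect b c z = 0 :=
  abs_nonpos_iff.1 <| abs_le_of_abs_hasDerivAt_le (R := z + 1)
    (fun y hy => hasDerivAt_tricomiDefect hb hbc hy.1) (fun y _ => hasDerivAt_const y 0)
    (fun y hy => by simp [h0 y hy.1]) (tendsto_tricomiDefect_zero hb hbc h) tendsto_const_nhds
    ⟨hz, by linarith⟩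

theorem tricomiDefect_eq_zero (hb : -1 < b) (hbc : NotInt (b + c)) (h : -2 < b + c)
    (hz : 0 < z) : tricomiDefect b c z = 0 := by
  obtain ⟨n, hn⟩ := exists_nat_gt (b + c + 1)
  induction n generalizing c z with
  | zero => exact tricomiDefect_eq_zero_of_mem_Ioo hb hbc ⟨h, by push_cast at hn; linarith⟩ hz
  | succ n ih =>
    rcases lt_or_ge (b + c) (-1) with h1 | h1
    · exact tricomiDefect_eq_zero_of_mem_Ioo hb hbc ⟨h, h1⟩ hz
    · have hne : b + c ≠ -1 := by simpa using hbc (-1)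
      have hgt : -1 < b + c := lt_of_le_of_ne h1 hne.symm
      push_cast at hn
      exact tricomiDefect_eq_zero_of_sub_one hb hbc hgt
        (fun z hz => ih (add_sub_assoc b c 1 ▸ hbc.sub_one) (by linarith) hz (by linarith)) hz

theorem tricomiInt_eq_reg_add_sing (hb : -1 < b) (hbc : NotInt (b + c)) (h : -2 < b + c)
    (hz : 0 < z) :
    tricomiInt b c z = tricomiReg b c z + z ^ (1 + b + c) * tricomiSing b c z := by
  have := tricomiDefect_eq_zero hb hbc h hz
  rw [tricomiDefect] at this
  linarith

theorem hasSum_laplaceInt (hb : -1 < b) (hbc : NotInt (b + c)) (h : -2 < b + c) (hz : 0 < z)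
    {x : ℝ} (hx : 0 < x) :
    HasSum (fun n => x ^ (-(1 + b + c)) * (tricomiRegCoeff b c n * (x * z) ^ n) +
      z ^ (1 + b + c) * (tricomiSingCoeff b c n * (x * z) ^ n)) (laplaceInt b c z x) := by
  have hreg := (summable_tricomiRegCoeff hbc (x * z)).hasSum
  have hsing := (summable_tricomiSingCoeff hb hbc (x * z)).hasSum
  have hone : x ^ (-(1 + b + c)) * x ^ (1 + b + c) = 1 := by
    rw [← Real.rpow_add hx, neg_add_cancel, Real.rpow_zero]
  have hconnection : laplaceInt b c z x = x ^ (-(1 + b + c)) * tricomiReg b c (x * z) +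
      z ^ (1 + b + c) * tricomiSing b c (x * z) := by
    rw [laplaceInt_eq_tricomiInt b c hz hx, tricomiInt_eq_reg_add_sing hb hbc h (mul_pos hx hz),
      Real.mul_rpow hx.le hz.le]
    linear_combination z ^ (1 + b + c) * tricomiSing b c (x * z) * hone
  exact hconnection ▸ (hreg.mul_left _).add (hsing.mul_left _)

end ConnectionFormula

/-! ### Fourier inversion -/

section SmoothTestFunctions

open scoped ContDiff

variable {E : Type*} [NormedAddCommGroup E] [NormedSpace ℝ E] [FiniteDimensional ℝ E]
  [MeasurableSpace E]

theorem locallyIntegrable_toReal_rnDeriv_of_le {μ ν : Measure E} [IsLocallyFiniteMeasure ν]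
    (h : μ ≤ ν) : LocallyIntegrable (fun x => (μ.rnDeriv ν x).toReal) ν := by
  have : ProperSpace E := FiniteDimensional.proper ℝ E
  refine (locallyIntegrable_const (1 : ℝ)).mono
    (Measure.measurable_rnDeriv μ ν).ennreal_toReal.aestronglyMeasurable ?_
  filter_upwards [Measure.rnDeriv_le_one_of_le h] with x hx
  rw [Real.norm_of_nonneg ENNReal.toReal_nonneg, norm_one]
  exact ENNReal.toReal_le_of_le_ofReal zero_le_one (by simpa using hx)

variable [BorelSpace E]

theorem measure_ext_of_integral_contDiff_eq {μ ν : Measure E} [IsFiniteMeasure μ]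
    [IsLocallyFiniteMeasure ν]
    (h : ∀ g : E → ℝ, ContDiff ℝ ∞ g → HasCompactSupport g → ∫ x, g x ∂μ = ∫ x, g x ∂ν) :
    μ = ν := by
  have : ProperSpace E := FiniteDimensional.proper ℝ E
  have : IsLocallyFiniteMeasure (μ + ν) := ⟨fun x => by
    obtain ⟨s, hs, hμs⟩ := μ.finiteAt_nhds x
    obtain ⟨t, ht, hνt⟩ := ν.finiteAt_nhds x
    exact ⟨s ∩ t, inter_mem hs ht, ENNReal.add_lt_top.2
      ⟨(measure_mono inter_subset_left).trans_lt hμs,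
        (measure_mono inter_subset_right).trans_lt hνt⟩⟩⟩
  have hμ : μ ≤ μ + ν := Measure.le_add_right le_rfl
  have hν : ν ≤ μ + ν := Measure.le_add_left le_rfl
  have hae := ae_eq_of_integral_contDiff_smul_eq (locallyIntegrable_toReal_rnDeriv_of_le hμ)
    (locallyIntegrable_toReal_rnDeriv_of_le hν) fun g hg hgc => by
      simpa only [smul_eq_mul, mul_comm (g _),
        integral_toReal_rnDeriv_mul hμ.absolutelyContinuous,
        integral_toReal_rnDeriv_mul hν.absolutelyContinuous] using h g hg hgc
  have hdensity : μ.rnDeriv (μ + ν) =ᵐ[μ + ν] ν.rnDeriv (μ + ν) := by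
    filter_upwards [hae, Measure.rnDeriv_lt_top μ (μ + ν), Measure.rnDeriv_lt_top ν (μ + ν)]
      with x hx hμx hνx
    exact (ENNReal.toReal_eq_toReal_iff' hμx.ne hνx.ne).1 hx
  calc μ = (μ + ν).withDensity (μ.rnDeriv (μ + ν)) :=
        (Measure.withDensity_rnDeriv_eq μ _ hμ.absolutelyContinuous).symm
    _ = (μ + ν).withDensity (ν.rnDeriv (μ + ν)) := withDensity_congr_ae hdensity
    _ = ν := Measure.withDensity_rnDeriv_eq ν _ hν.absolutelyContinuous

theorem nonneg_of_integral_contDiff_mul_nonneg {f : E → ℝ} (μ : Measure E)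
    [IsFiniteMeasureOnCompacts μ] [μ.IsOpenPosMeasure] (hf : Continuous f)
    (h : ∀ g : E → ℝ, ContDiff ℝ ∞ g → HasCompactSupport g → 0 ≤ g → 0 ≤ ∫ x, g x * f x ∂μ)
    (x : E) : 0 ≤ f x := by
  by_contra! hx
  obtain ⟨g, hsupp, hgc, hg, hrange, hgx⟩ := exists_contDiff_tsupport_subset (n := ⊤)
    ((isOpen_Iio.preimage hf).mem_nhds (show x ∈ f ⁻¹' Iio 0 from hx))
  have hg0 : 0 ≤ g := fun y => (hrange (mem_range_self y)).1
  have hprod : 0 ≤ fun y => -(g y * f y) := fun y => by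
    by_cases hy : y ∈ tsupport g
    · exact neg_nonneg.2 (mul_nonpos_of_nonneg_of_nonpos (hg0 y) (hsupp hy).le)
    · simp [image_eq_zero_of_notMem_tsupport hy]
  have hpos := (hg.continuous.mul hf).neg.integral_pos_of_hasCompactSupport_nonneg_nonzero
    (μ := μ) hgc.mul_right.neg hprod (x := x) (by simp [hgx, hx.ne])
  have hneg : ∫ y, (-(g * f)) y ∂μ = -∫ y, g y * f y ∂μ := integral_neg _
  rw [hneg] at hpos
  linarith [h g hg hgc hg0]

end SmoothTestFunctions

section FourierInversion

open scoped ContDiff FourierTransform SchwartzMap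

variable (μ : Measure ℝ)

/-- The complex-valued function `x ↦ (2π)⁻¹ ∫ e^{-iux} φ(u) du`, where `φ` is the characteristic
function of `μ`; it is the density of `μ` if `φ` is integrable. -/
noncomputable def fourierDensity (x : ℝ) : ℂ :=
  (2 * Real.pi : ℂ)⁻¹ * ∫ u : ℝ, Complex.exp (-(Complex.I * u * x)) * charFun μ u

theorem fourier_charFun_two_pi_mul (x : ℝ) :
    𝓕 (fun w : ℝ => charFun μ (2 * Real.pi * w)) x = fourierDensity μ x := by
  have hscale := Measure.integral_comp_mul_left
    (fun u : ℝ => Complex.exp (-(Complex.I * u * x)) * charFun μ u) (2 * Real.pi)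
  rw [abs_of_pos (by positivity), Complex.real_smul] at hscale
  rw [fourierDensity, Real.fourier_real_eq_integral_exp_smul]
  push_cast at hscale
  rw [← hscale]
  refine integral_congr_ae (ae_of_all _ fun w => ?_)
  simp only [smul_eq_mul]
  congr 2
  push_cast
  ring

theorem continuous_fourierDensity (hφ : Integrable (charFun μ)) :
    Continuous (fourierDensity μ) := by
  refine continuous_const.mul (continuous_of_dominated (bound := fun u => ‖charFun μ u‖)
    (fun x => (Continuous.aestronglyMeasurable (by fun_prop)).mul hφ.1)
    (fun x => ae_of_all _ fun u => ?_) hφ.norm (ae_of_all _ fun u => by fun_prop))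
  simp [Complex.norm_exp]

theorem conj_fourierDensity (x : ℝ) :
    (starRingEnd ℂ) (fourierDensity μ x) = fourierDensity μ x := by
  rw [fourierDensity, map_mul, ← integral_conj]
  congr 1
  · simp [Complex.conj_ofNat]
  · rw [← integral_neg_eq_self]
    refine integral_congr_ae (ae_of_all _ fun u => ?_)
    simp [charFun_neg, ← Complex.exp_conj]

theorem ofReal_re_fourierDensity (x : ℝ) :
    ((fourierDensity μ x).re : ℂ) = fourierDensity μ x :=
  Complex.conj_eq_iff_re.1 (conj_fourierDensity μ x)

variable [IsFiniteMeasure μ]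

theorem integral_schwartzMap_eq_integral_charFun (h : 𝓢(ℝ, ℂ)) :
    ∫ y, h y ∂μ = ∫ w : ℝ, charFun μ (2 * Real.pi * w) * 𝓕 h w := by
  have hflip := VectorFourier.integral_fourierIntegral_smul_eq_flip (μ := μ) (ν := volume)
    (L := innerₗ ℝ) (f := 1) (g := (𝓕⁻ h : 𝓢(ℝ, ℂ))) Real.continuous_fourierChar continuous_inner
    (integrable_const 1) (𝓕⁻ h : 𝓢(ℝ, ℂ)).integrable
  have hinv (y : ℝ) : VectorFourier.fourierIntegral Real.fourierChar volume (innerₗ ℝ).flip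
      (𝓕⁻ h : 𝓢(ℝ, ℂ)) y = h y := by
    rw [flip_innerₗ]
    exact DFunLike.congr_fun (FourierTransform.fourier_fourierInv_eq (F := 𝓢(ℝ, ℂ)) h) y
  rw [← integral_neg_eq_self _ volume]
  simp only [hinv, Pi.one_apply, one_smul] at hflip
  rw [← hflip]
  refine integral_congr_ae (ae_of_all _ fun w => ?_)
  simp only [charFun_eq_fourierIntegral', smul_eq_mul]
  congr 1
  congr 1
  field_simp

theorem integral_schwartzMap_eq (hφ : Integrable (charFun μ)) (h : 𝓢(ℝ, ℂ)) :
    ∫ y, h y ∂μ = ∫ x, h x * fourierDensity μ x := by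
  have hflip := VectorFourier.integral_fourierIntegral_smul_eq_flip (μ := volume) (ν := volume)
    (L := innerₗ ℝ) (f := fun w : ℝ => charFun μ (2 * Real.pi * w)) (g := h)
    Real.continuous_fourierChar continuous_inner
    (hφ.comp_mul_left' (by positivity)) h.integrable
  rw [integral_schwartzMap_eq_integral_charFun]
  simp only [flip_innerₗ, smul_eq_mul] at hflip
  refine hflip.symm.trans (integral_congr_ae (ae_of_all _ fun x => ?_))
  exact (mul_comm _ _).trans (congrArg _ (fourier_charFun_two_pi_mul μ x))

theorem integral_contDiff_eq (hφ : Integrable (charFun μ)) {g : ℝ → ℝ} (hg : ContDiff ℝ ∞ g)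
    (hgc : HasCompactSupport g) : ∫ y, g y ∂μ = ∫ x, g x * (fourierDensity μ x).re := by
  have hcomplex : ∫ y, (g y : ℂ) ∂μ = ∫ x, (g x : ℂ) * fourierDensity μ x :=
    integral_schwartzMap_eq μ hφ ((hgc.comp_left Complex.ofReal_zero).toSchwartzMap
      (Complex.ofRealCLM.contDiff.comp hg))
  apply Complex.ofReal_injective
  rw [← integral_complex_ofReal, ← integral_complex_ofReal]
  simpa only [Complex.ofReal_mul, ofReal_re_fourierDensity] using hcomplex

theorem exists_isContinuousDensity (hφ : Integrable (charFun μ)) :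
    ∃ f : ℝ → ℝ, IsContinuousDensity μ f ∧ ∀ x : ℝ, (f x : ℂ) = fourierDensity μ x := by
  have hcont : Continuous fun x => (fourierDensity μ x).re :=
    Complex.continuous_re.comp (continuous_fourierDensity μ hφ)
  have hnonneg : ∀ x, 0 ≤ (fourierDensity μ x).re :=
    nonneg_of_integral_contDiff_mul_nonneg volume hcont fun g hg hgc hg0 =>
      integral_contDiff_eq μ hφ hg hgc ▸ integral_nonneg hg0
  refine ⟨_, ⟨hcont, hnonneg, ?_⟩, ofReal_re_fourierDensity μ⟩
  have := IsLocallyFiniteMeasure.withDensity_ofReal (μ := (volume : Measure ℝ)) hcont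
  refine measure_ext_of_integral_contDiff_eq fun g hg hgc => ?_
  rw [integral_contDiff_eq μ hφ hg hgc, integral_withDensity_eq_integral_toReal_smul
    hcont.measurable.ennreal_ofReal (ae_of_all _ fun _ => ENNReal.ofReal_lt_top)]
  refine integral_congr_ae (ae_of_all _ fun x => ?_)
  simp only [ENNReal.toReal_ofReal (hnonneg x), smul_eq_mul, mul_comm]

end FourierInversion

/-! ### The Lévy exponent -/

section CharacteristicIntegrals

variable {ν : Measure ℝ} {k : ℝ → ℂ}

theorem integrable_exp_I_mul (hk : Integrable k ν) (u : ℝ) :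
    Integrable (fun x : ℝ => Complex.exp (Complex.I * u * x) * k x) ν := by
  refine hk.mono ((Continuous.aestronglyMeasurable (by fun_prop)).mul hk.1)
    (ae_of_all _ fun x => ?_)
  simp [Complex.norm_exp]

theorem integrable_exp_I_mul_sub_one_mul (hk : AEStronglyMeasurable k ν)
    (hxk : Integrable (fun x : ℝ => (x : ℂ) * k x) ν) (u : ℝ) :
    Integrable (fun x : ℝ => (Complex.exp (Complex.I * u * x) - 1) * k x) ν := by
  refine (hxk.norm.const_mul |u|).mono' ((Continuous.aestronglyMeasurable (by fun_prop)).mul hk)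
    (ae_of_all _ fun x => ?_)
  have hexp := Real.norm_exp_I_mul_ofReal_sub_one_le (x := u * x)
  rw [Complex.ofReal_mul, ← mul_assoc, norm_mul, Real.norm_eq_abs] at hexp
  rw [norm_mul, norm_mul, Complex.norm_real, ← mul_assoc]
  exact mul_le_mul_of_nonneg_right hexp (norm_nonneg _)

theorem hasDerivAt_integral_exp_I_mul_sub_one_mul (hk : AEStronglyMeasurable k ν)
    (hxk : Integrable (fun x : ℝ => (x : ℂ) * k x) ν) (u : ℝ) :
    HasDerivAt (fun v : ℝ => ∫ x, (Complex.exp (Complex.I * v * x) - 1) * k x ∂ν)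
      (Complex.I * ∫ x, Complex.exp (Complex.I * u * x) * (x * k x) ∂ν) u := by
  rw [← integral_const_mul]
  refine (hasDerivAt_integral_of_dominated_loc_of_deriv_le
    (F := fun v x : ℝ => (Complex.exp (Complex.I * v * x) - 1) * k x)
    (F' := fun v x : ℝ => Complex.I * (Complex.exp (Complex.I * v * x) * (x * k x))) univ_mem
    (Eventually.of_forall fun v => (integrable_exp_I_mul_sub_one_mul hk hxk v).1)
    (integrable_exp_I_mul_sub_one_mul hk hxk u)
    ((integrable_exp_I_mul hxk u).const_mul _).1 (ae_of_all _ fun x v _ => ?_) hxk.norm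
    (ae_of_all _ fun x v _ => ?_)).2
  · simp [Complex.norm_exp]
  · have hlin : HasDerivAt (fun v : ℝ => Complex.I * v * x) (Complex.I * x) v := by
      simpa using ((Complex.ofRealCLM.hasDerivAt (x := v)).const_mul Complex.I).mul_const (x : ℂ)
    exact ((hlin.cexp.sub_const 1).mul_const (k x)).congr_deriv (by ring)

theorem hasDerivAt_integral_exp_I_mul (hk : Integrable k ν)
    (hxk : Integrable (fun x : ℝ => (x : ℂ) * k x) ν) (u : ℝ) :
    HasDerivAt (fun v : ℝ => ∫ x, Complex.exp (Complex.I * v * x) * k x ∂ν)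
      (Complex.I * ∫ x, Complex.exp (Complex.I * u * x) * (x * k x) ∂ν) u := by
  refine ((hasDerivAt_integral_exp_I_mul_sub_one_mul hk.1 hxk u).add_const
    (∫ x, k x ∂ν)).congr_of_eventuallyEq (Eventually.of_forall fun v => ?_)
  beta_reduce
  rw [← integral_add (integrable_exp_I_mul_sub_one_mul hk.1 hxk v) hk]
  exact integral_congr_ae (ae_of_all _ fun x => by ring)

end CharacteristicIntegrals

section GammaIntegral

variable {l s : ℝ}

theorem sub_I_mul_mem_slitPlane (hl : 0 < l) (u : ℝ) :
    (l - Complex.I * u : ℂ) ∈ Complex.slitPlane :=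
  Or.inl (by simpa using hl)

theorem hasDerivAt_sub_I_mul_cpow (hl : 0 < l) (a : ℂ) (u : ℝ) :
    HasDerivAt (fun v : ℝ => (l - Complex.I * v : ℂ) ^ a)
      (a * (l - Complex.I * u) ^ (a - 1) * -Complex.I) u := by
  have hlin : HasDerivAt (fun z : ℂ => l - Complex.I * z) (-Complex.I) (u : ℂ) := by
    simpa using ((hasDerivAt_id (u : ℂ)).const_mul Complex.I).const_sub (l : ℂ)
  exact (hlin.cpow_const (sub_I_mul_mem_slitPlane hl u)).comp_ofReal

theorem integrable_ofReal_exp_mul_rpow (hs : 0 < s) (hl : 0 < l) :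
    IntegrableOn (fun t : ℝ => ((Real.exp (-(l * t)) * t ^ (s - 1) : ℝ) : ℂ)) (Ioi 0) :=
  (integrableOn_exp_mul_rpow (by linarith) hl).ofReal

theorem ofReal_mul_exp_mul_rpow (s l : ℝ) {t : ℝ} (ht : 0 < t) :
    (t : ℂ) * ((Real.exp (-(l * t)) * t ^ (s - 1) : ℝ) : ℂ) =
      ((Real.exp (-(l * t)) * t ^ (s + 1 - 1) : ℝ) : ℂ) := by
  have hpow : t ^ (s + 1 - 1) = t * t ^ (s - 1) := by
    rw [add_sub_right_comm, Real.rpow_add_one ht.ne', mul_comm]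
  rw [hpow]
  push_cast
  ring

/-- The integral `∫ e^{iut} e^{-lt} t^{s-1} dt` over the positive half-line, that is Euler's
integral for the Gamma function at the complex rate `l - iu`. -/
noncomputable def gammaCharIntegral (l s u : ℝ) : ℂ :=
  ∫ t in Ioi (0 : ℝ), Complex.exp (Complex.I * u * t) *
    ((Real.exp (-(l * t)) * t ^ (s - 1) : ℝ) : ℂ)

theorem hasDerivAt_gammaCharIntegral (hs : 0 < s) (hl : 0 < l) (u : ℝ) :
    HasDerivAt (gammaCharIntegral l s) (Complex.I * gammaCharIntegral l (s + 1) u) u := by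
  have hxk : EqOn (fun t : ℝ => (t : ℂ) * ((Real.exp (-(l * t)) * t ^ (s - 1) : ℝ) : ℂ))
      (fun t => ((Real.exp (-(l * t)) * t ^ (s + 1 - 1) : ℝ) : ℂ)) (Ioi 0) :=
    fun t => ofReal_mul_exp_mul_rpow s l
  refine (hasDerivAt_integral_exp_I_mul (integrable_ofReal_exp_mul_rpow hs hl)
    ((integrable_ofReal_exp_mul_rpow (by linarith) hl).congr_fun hxk.symm measurableSet_Ioi)
    u).congr_deriv (congrArg _ ?_)
  exact setIntegral_congr_fun measurableSet_Ioi fun t ht => congrArg _ (hxk ht)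

theorem hasDerivAt_exp_I_mul_mul_exp_mul_rpow (l s u : ℝ) {t : ℝ} (ht : 0 < t) :
    HasDerivAt
      (fun t : ℝ => Complex.exp (Complex.I * u * t) * ((Real.exp (-(l * t)) * t ^ s : ℝ) : ℂ))
      (s * (Complex.exp (Complex.I * u * t) * ((Real.exp (-(l * t)) * t ^ (s - 1) : ℝ) : ℂ)) -
        (l - Complex.I * u) * (Complex.exp (Complex.I * u * t) *
          ((Real.exp (-(l * t)) * t ^ (s + 1 - 1) : ℝ) : ℂ))) t := by
  have hcexp : HasDerivAt (fun t : ℝ => Complex.exp (Complex.I * u * t))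
      (Complex.exp (Complex.I * u * t) * (Complex.I * u)) t := by
    simpa using ((Complex.ofRealCLM.hasDerivAt (x := t)).const_mul (Complex.I * u : ℂ)).cexp
  have hreal : HasDerivAt (fun t => Real.exp (-(l * t)) * t ^ s)
      (Real.exp (-(l * t)) * -(l * 1) * t ^ s + Real.exp (-(l * t)) * (s * t ^ (s - 1))) t :=
    (((hasDerivAt_id t).const_mul l).neg.exp).mul (Real.hasDerivAt_rpow_const (Or.inl ht.ne'))
  refine (hcexp.mul hreal.ofReal_comp).congr_deriv ?_
  rw [add_sub_cancel_right]
  push_cast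
  ring

theorem sub_I_mul_mul_gammaCharIntegral_add_one (hs : 0 < s) (hl : 0 < l) (u : ℝ) :
    (l - Complex.I * u) * gammaCharIntegral l (s + 1) u = s * gammaCharIntegral l s u := by
  have hint {r : ℝ} (hr : 0 < r) := integrable_exp_I_mul (integrable_ofReal_exp_mul_rpow hr hl) u
  have hzero : ContinuousWithinAt
      (fun t : ℝ => Complex.exp (Complex.I * u * t) * ((Real.exp (-(l * t)) * t ^ s : ℝ) : ℂ))
      (Ici 0) 0 := by
    have := Real.continuous_rpow_const hs.le
    exact Continuous.continuousWithinAt (by fun_prop)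
  have htop : Tendsto
      (fun t : ℝ => Complex.exp (Complex.I * u * t) * ((Real.exp (-(l * t)) * t ^ s : ℝ) : ℂ))
      atTop (𝓝 0) := by
    rw [tendsto_zero_iff_norm_tendsto_zero]
    refine (tendsto_rpow_mul_exp_neg_mul_atTop_nhds_zero s l hl).congr' ?_
    filter_upwards [eventually_gt_atTop 0] with t ht
    simp [Complex.norm_exp, abs_of_nonneg (Real.rpow_nonneg ht.le s), mul_comm]
  have hparts := integral_Ioi_of_hasDerivAt_of_tendsto hzero
    (fun t ht => hasDerivAt_exp_I_mul_mul_exp_mul_rpow l s u ht)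
    (((hint hs).const_mul _).sub ((hint (by linarith)).const_mul _)) htop
  rw [integral_sub ((hint hs).const_mul _) ((hint (by linarith)).const_mul _),
    integral_const_mul, integral_const_mul, Real.zero_rpow hs.ne', mul_zero, Complex.ofReal_zero,
    mul_zero, sub_zero] at hparts
  exact (sub_eq_zero.1 hparts).symm

theorem gammaCharIntegral_zero (hs : 0 < s) (hl : 0 < l) :
    gammaCharIntegral l s 0 = Real.Gamma s * (l : ℂ) ^ (-s : ℂ) := by
  have hreal := Real.integral_rpow_mul_exp_neg_mul_Ioi hs hl
  rw [one_div, Real.inv_rpow hl.le, ← Real.rpow_neg hl.le, mul_comm] at hreal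
  rw [← Complex.ofReal_neg, ← Complex.ofReal_cpow hl.le, ← Complex.ofReal_mul, ← hreal,
    ← integral_complex_ofReal, gammaCharIntegral]
  simp only [Complex.ofReal_zero, mul_zero, Complex.exp_zero, one_mul, mul_comm]

theorem gammaCharIntegral_eq (hs : 0 < s) (hl : 0 < l) (u : ℝ) :
    gammaCharIntegral l s u = Real.Gamma s * (l - Complex.I * u) ^ (-s : ℂ) := by
  have hderiv (v : ℝ) :
      HasDerivAt (fun v : ℝ => gammaCharIntegral l s v * (l - Complex.I * v) ^ (s : ℂ)) 0 v := by
    refine ((hasDerivAt_gammaCharIntegral hs hl v).mul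
      (hasDerivAt_sub_I_mul_cpow hl s v)).congr_deriv ?_
    have hne := Complex.slitPlane_ne_zero (sub_I_mul_mem_slitPlane hl v)
    rw [Complex.cpow_sub _ _ hne, Complex.cpow_one]
    field_simp
    linear_combination (l - Complex.I * v : ℂ) ^ (s : ℂ) * Complex.I *
      sub_I_mul_mul_gammaCharIntegral_add_one hs hl v
  have hconst := is_const_of_deriv_eq_zero (fun v => (hderiv v).differentiableAt)
    (fun v => (hderiv v).deriv) u 0
  have hl0 : (l : ℂ) ≠ 0 := Complex.ofReal_ne_zero.2 hl.ne'
  have hne := Complex.slitPlane_ne_zero (sub_I_mul_mem_slitPlane hl u)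
  simp only [gammaCharIntegral_zero hs hl, Complex.ofReal_zero, mul_zero, sub_zero, mul_assoc,
    ← Complex.cpow_add _ _ hl0, neg_add_cancel, Complex.cpow_zero, mul_one] at hconst
  rw [Complex.cpow_neg, ← hconst, mul_inv_cancel_right₀ ((Complex.cpow_ne_zero_iff.2 (Or.inl hne)))]

end GammaIntegral

section LevyExponent

variable {α β l : ℝ}

theorem ofReal_mul_levyDensity (α β l : ℝ) {x : ℝ} (hx : 0 < x) :
    (x : ℂ) * ((α * (Real.exp (-l * x) / x ^ (1 + β)) : ℝ) : ℂ) =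
      α * ((Real.exp (-(l * x)) * x ^ (1 - β - 1) : ℝ) : ℂ) := by
  have hpow : x * (x ^ (1 + β))⁻¹ = x ^ (1 - β - 1) := by
    rw [Real.rpow_add hx, Real.rpow_one, mul_inv, mul_inv_cancel_left₀ hx.ne',
      ← Real.rpow_neg hx.le]
    congr 1
    ring
  rw [← hpow, div_eq_mul_inv, neg_mul]
  push_cast
  ring

theorem hasDerivAt_integral_levyDensity (hβ : β < 1) (hl : 0 < l) (u : ℝ) :
    HasDerivAt (fun u : ℝ => ∫ x in Ioi (0 : ℝ), (Complex.exp (Complex.I * u * x) - 1) *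
        ((α * (Real.exp (-l * x) / x ^ (1 + β)) : ℝ) : ℂ))
      (Complex.I * (α * gammaCharIntegral l (1 - β) u)) u := by
  have hxk : EqOn _ _ (Ioi (0 : ℝ)) := fun x => ofReal_mul_levyDensity α β l
  refine (hasDerivAt_integral_exp_I_mul_sub_one_mul
    (Measurable.aestronglyMeasurable (by fun_prop))
    (IntegrableOn.congr_fun ((integrable_ofReal_exp_mul_rpow (sub_pos.2 hβ) hl).const_mul (α : ℂ))
      hxk.symm measurableSet_Ioi) u).congr_deriv (congrArg _ ?_)
  rw [gammaCharIntegral, ← integral_const_mul]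
  refine setIntegral_congr_fun measurableSet_Ioi fun x hx => ?_
  simp only [hxk hx]
  ring

theorem Gamma_one_sub (hβ : β ≠ 0) : Real.Gamma (1 - β) = -β * Real.Gamma (-β) := by
  rw [← Real.Gamma_add_one (neg_ne_zero.2 hβ), neg_add_eq_sub]

theorem integral_exp_I_mul_sub_one_mul_levyDensity (hβ : β ∈ Ioo (0 : ℝ) 1) (hl : 0 < l) (u : ℝ) :
    ∫ x in Ioi (0 : ℝ), (Complex.exp (Complex.I * u * x) - 1) *
        ((α * (Real.exp (-l * x) / x ^ (1 + β)) : ℝ) : ℂ) =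
      -(tsA α β : ℂ) * ((l - Complex.I * u) ^ (β : ℂ) - (l : ℂ) ^ (β : ℂ)) := by
  have hderiv (v : ℝ) : HasDerivAt (fun v : ℝ => (∫ x in Ioi (0 : ℝ),
      (Complex.exp (Complex.I * v * x) - 1) *
        ((α * (Real.exp (-l * x) / x ^ (1 + β)) : ℝ) : ℂ)) +
      tsA α β * (l - Complex.I * v) ^ (β : ℂ)) 0 v := by
    refine ((hasDerivAt_integral_levyDensity hβ.2 hl v).add
      ((hasDerivAt_sub_I_mul_cpow hl β v).const_mul _)).congr_deriv ?_
    rw [gammaCharIntegral_eq (sub_pos.2 hβ.2) hl, Gamma_one_sub hβ.1.ne', tsA]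
    push_cast
    rw [neg_sub]
    ring
  have hconst := is_const_of_deriv_eq_zero (fun v => (hderiv v).differentiableAt)
    (fun v => (hderiv v).deriv) u 0
  simp only [Complex.ofReal_zero, mul_zero, zero_mul, Complex.exp_zero, sub_self, integral_zero,
    zero_add, sub_zero] at hconst
  linear_combination hconst

end LevyExponent

/-! ### Rotation of contours -/

section RayIntegral

variable {F F' : ℂ → ℂ} {p : ℂ} {θ θ₀ r M κ : ℝ}

/-- The point at distance `r` from `p` on the ray with angle `θ`. -/
noncomputable def rayPt (p : ℂ) (θ r : ℝ) : ℂ := p + r * Complex.exp (θ * Complex.I)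

/-- The contour integral of `F` along the ray from `p` with angle `θ`. -/
noncomputable def rayIntegral (F : ℂ → ℂ) (p : ℂ) (θ : ℝ) : ℂ :=
  ∫ r in Ioi (0 : ℝ), F (rayPt p θ r) * Complex.exp (θ * Complex.I)

/-- The radial derivative of `r e^{iθ} F(p + r e^{iθ})`, where `F'` stands for the derivative
of `F`. -/
noncomputable def radialDeriv (F F' : ℂ → ℂ) (p : ℂ) (θ r : ℝ) : ℂ :=
  Complex.exp (θ * Complex.I) *
    (F (rayPt p θ r) + r * Complex.exp (θ * Complex.I) * F' (rayPt p θ r))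

theorem hasDerivAt_exp_ofReal_mul_I (θ : ℝ) :
    HasDerivAt (fun θ : ℝ => Complex.exp (θ * Complex.I))
      (Complex.exp (θ * Complex.I) * Complex.I) θ := by
  simpa using ((hasDerivAt_id θ).ofReal_comp.mul_const Complex.I).cexp

theorem hasDerivAt_rayPt_angle (p : ℂ) (θ r : ℝ) :
    HasDerivAt (fun θ : ℝ => rayPt p θ r) (r * (Complex.exp (θ * Complex.I) * Complex.I)) θ :=
  ((hasDerivAt_exp_ofReal_mul_I θ).const_mul _).const_add _

theorem hasDerivAt_rayPt_radius (p : ℂ) (θ r : ℝ) :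
    HasDerivAt (fun r : ℝ => rayPt p θ r) (Complex.exp (θ * Complex.I)) r := by
  simpa [rayPt] using
    ((hasDerivAt_id r).ofReal_comp.mul_const (Complex.exp (θ * Complex.I))).const_add p

theorem measurable_rayPt (p : ℂ) (θ : ℝ) : Measurable (rayPt p θ) := by
  unfold rayPt
  fun_prop

theorem measurable_radialDeriv (hF : Measurable F) (hF' : Measurable F') :
    Measurable (radialDeriv F F' p θ) := by
  have hray := measurable_rayPt p θ
  unfold radialDeriv
  fun_prop

theorem aestronglyMeasurable_comp_rayPt_mul_exp (hF : Measurable F) {μ : Measure ℝ} :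
    AEStronglyMeasurable (fun r => F (rayPt p θ r) * Complex.exp (θ * Complex.I)) μ :=
  ((hF.comp (measurable_rayPt p θ)).mul measurable_const).aestronglyMeasurable

theorem norm_comp_rayPt_mul_exp (F : ℂ → ℂ) (p : ℂ) (θ r : ℝ) :
    ‖F (rayPt p θ r) * Complex.exp (θ * Complex.I)‖ = ‖F (rayPt p θ r)‖ := by
  rw [norm_mul, Complex.norm_exp_ofReal_mul_I, mul_one]

theorem norm_radialDeriv_le (hr : 0 ≤ r) (hF : ‖F (rayPt p θ r)‖ ≤ M)
    (hF' : ‖F' (rayPt p θ r)‖ ≤ M) : ‖radialDeriv F F' p θ r‖ ≤ M + r * M := by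
  rw [radialDeriv, norm_mul, Complex.norm_exp_ofReal_mul_I, one_mul]
  refine (norm_add_le _ _).trans (add_le_add hF ?_)
  rw [norm_mul, norm_mul, Complex.norm_exp_ofReal_mul_I, mul_one, Complex.norm_of_nonneg hr]
  gcongr

theorem hasDerivAt_comp_rayPt_mul_exp
    (hF : HasDerivAt F (F' (rayPt p θ r)) (rayPt p θ r)) :
    HasDerivAt (fun θ : ℝ => F (rayPt p θ r) * Complex.exp (θ * Complex.I))
      (Complex.I * radialDeriv F F' p θ r) θ := by
  refine ((hF.scomp θ (hasDerivAt_rayPt_angle p θ r)).mul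
    (hasDerivAt_exp_ofReal_mul_I θ)).congr_deriv ?_
  simp only [radialDeriv, smul_eq_mul]
  ring

theorem hasDerivAt_radius_mul_exp_mul_comp_rayPt
    (hF : HasDerivAt F (F' (rayPt p θ r)) (rayPt p θ r)) :
    HasDerivAt (fun r : ℝ => (r : ℂ) * Complex.exp (θ * Complex.I) * F (rayPt p θ r))
      (radialDeriv F F' p θ r) r := by
  refine (((hasDerivAt_id r).ofReal_comp.mul_const (Complex.exp (θ * Complex.I))).mul
    (hF.scomp r (hasDerivAt_rayPt_radius p θ r))).congr_deriv ?_
  simp only [radialDeriv, smul_eq_mul, Function.comp_apply, id, Complex.ofReal_one]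
  ring

theorem integrableOn_exp_add_mul_exp (M : ℝ) (hκ : 0 < κ) :
    IntegrableOn (fun r => M * Real.exp (-κ * r) + r * (M * Real.exp (-κ * r))) (Ioi 0) := by
  refine ((exp_neg_integrableOn_Ioi 0 hκ).const_mul M).add
    (IntegrableOn.congr_fun ((integrableOn_exp_mul_rpow (b := 1) (by norm_num) hκ).const_mul M)
      (fun r _ => ?_) measurableSet_Ioi)
  rw [Real.rpow_one, neg_mul]
  ring

theorem integrableOn_radialDeriv (hκ : 0 < κ) (hFm : Measurable F) (hF'm : Measurable F')
    (hFb : ∀ r, 0 < r → ‖F (rayPt p θ r)‖ ≤ M * Real.exp (-κ * r))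
    (hF'b : ∀ r, 0 < r → ‖F' (rayPt p θ r)‖ ≤ M * Real.exp (-κ * r)) :
    IntegrableOn (radialDeriv F F' p θ) (Ioi 0) :=
  Integrable.mono' (integrableOn_exp_add_mul_exp M hκ)
    (measurable_radialDeriv hFm hF'm).aestronglyMeasurable
    (ae_restrict_of_forall_mem measurableSet_Ioi fun r (hr : 0 < r) =>
      norm_radialDeriv_le hr.le (hFb r hr) (hF'b r hr))

theorem norm_radius_mul_exp_mul_comp_rayPt_le
    (hFb : ∀ r, 0 < r → ‖F (rayPt p θ r)‖ ≤ M * Real.exp (-κ * r)) (hr : 0 ≤ r) :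
    ‖(r : ℂ) * Complex.exp (θ * Complex.I) * F (rayPt p θ r)‖ ≤
      M * (r ^ (1 : ℝ) * Real.exp (-κ * r)) := by
  rw [norm_mul, norm_mul, Complex.norm_exp_ofReal_mul_I, mul_one, Complex.norm_of_nonneg hr,
    Real.rpow_one, mul_left_comm]
  rcases hr.eq_or_lt with rfl | hr
  · simp
  · exact mul_le_mul_of_nonneg_left (hFb r hr) hr.le

theorem integral_radialDeriv_eq_zero (hκ : 0 < κ) (hFm : Measurable F) (hF'm : Measurable F')
    (hF : ∀ r, 0 < r → HasDerivAt F (F' (rayPt p θ r)) (rayPt p θ r))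
    (hFb : ∀ r, 0 < r → ‖F (rayPt p θ r)‖ ≤ M * Real.exp (-κ * r))
    (hF'b : ∀ r, 0 < r → ‖F' (rayPt p θ r)‖ ≤ M * Real.exp (-κ * r)) :
    ∫ r in Ioi (0 : ℝ), radialDeriv F F' p θ r = 0 := by
  have hbound (r : ℝ) := norm_radius_mul_exp_mul_comp_rayPt_le (r := r) hFb
  have hzero : ContinuousWithinAt
      (fun r : ℝ => (r : ℂ) * Complex.exp (θ * Complex.I) * F (rayPt p θ r)) (Ici 0) 0 := by
    have hcont : ContinuousAt (fun r : ℝ => M * (r ^ (1 : ℝ) * Real.exp (-κ * r))) 0 := by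
      simp only [Real.rpow_one]
      fun_prop
    rw [ContinuousWithinAt, Complex.ofReal_zero, zero_mul, zero_mul]
    refine squeeze_zero_norm' (eventually_mem_nhdsWithin.mono hbound) ?_
    simpa using hcont.continuousWithinAt (s := Ici 0) |>.tendsto
  have hinfty := (tendsto_rpow_mul_exp_neg_mul_atTop_nhds_zero 1 κ hκ).const_mul M
  rw [mul_zero] at hinfty
  rw [integral_Ioi_of_hasDerivAt_of_tendsto hzero
    (fun r hr => hasDerivAt_radius_mul_exp_mul_comp_rayPt (hF r hr))
    (integrableOn_radialDeriv hκ hFm hF'm hFb hF'b)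
    (squeeze_zero_norm' ((eventually_ge_atTop 0).mono hbound) hinfty)]
  simp

-- Cauchy's theorem: the angular derivative of the integrand is `i` times a radial derivative.
theorem hasDerivAt_rayIntegral {s : Set ℝ} (hs : s ∈ 𝓝 θ₀)
    (hκ : 0 < κ) (hFm : Measurable F) (hF'm : Measurable F')
    (hF : ∀ θ ∈ s, ∀ r, 0 < r → HasDerivAt F (F' (rayPt p θ r)) (rayPt p θ r))
    (hFb : ∀ θ ∈ s, ∀ r, 0 < r → ‖F (rayPt p θ r)‖ ≤ M * Real.exp (-κ * r))
    (hF'b : ∀ θ ∈ s, ∀ r, 0 < r → ‖F' (rayPt p θ r)‖ ≤ M * Real.exp (-κ * r)) :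
    HasDerivAt (rayIntegral F p) 0 θ₀ := by
  have hθ₀ : θ₀ ∈ s := mem_of_mem_nhds hs
  have hint : IntegrableOn (fun r => F (rayPt p θ₀ r) * Complex.exp (θ₀ * Complex.I)) (Ioi 0) :=
    Integrable.mono' ((exp_neg_integrableOn_Ioi 0 hκ).const_mul M)
      (aestronglyMeasurable_comp_rayPt_mul_exp hFm)
      (ae_restrict_of_forall_mem measurableSet_Ioi fun r hr =>
        (norm_comp_rayPt_mul_exp F p θ₀ r).trans_le (hFb θ₀ hθ₀ r hr))
  have hderiv := (hasDerivAt_integral_of_dominated_loc_of_deriv_le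
    (F := fun θ r => F (rayPt p θ r) * Complex.exp (θ * Complex.I))
    (F' := fun θ r => Complex.I * radialDeriv F F' p θ r) hs
    (Eventually.of_forall fun θ => aestronglyMeasurable_comp_rayPt_mul_exp hFm) hint
    ((measurable_radialDeriv hFm hF'm).const_mul Complex.I).aestronglyMeasurable
    (ae_restrict_of_forall_mem measurableSet_Ioi fun r (hr : 0 < r) θ hθ => by
      rw [norm_mul, Complex.norm_I, one_mul]
      exact norm_radialDeriv_le hr.le (hFb θ hθ r hr) (hF'b θ hθ r hr))
    (integrableOn_exp_add_mul_exp M hκ)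
    (ae_restrict_of_forall_mem measurableSet_Ioi fun r hr θ hθ =>
      hasDerivAt_comp_rayPt_mul_exp (hF θ hθ r hr))).2
  refine hderiv.congr_deriv ?_
  rw [integral_const_mul, integral_radialDeriv_eq_zero hκ hFm hF'm (hF θ₀ hθ₀) (hFb θ₀ hθ₀)
    (hF'b θ₀ hθ₀), mul_zero]

theorem eq_of_hasDerivAt_zero_of_tendsto {E : Type*} [NormedAddCommGroup E] [NormedSpace ℝ E]
    {f : ℝ → E} {a b : ℝ} {y z : E} (hab : a < b) (hf : ∀ t ∈ Ioo a b, HasDerivAt f 0 t)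
    (ha : Tendsto f (𝓝[>] a) (𝓝 y)) (hb : Tendsto f (𝓝[<] b) (𝓝 z)) : y = z := by
  obtain ⟨c, hc⟩ := isOpen_Ioo.exists_is_const_of_deriv_eq_zero isPreconnected_Ioo
    (fun t ht => (hf t ht).differentiableAt.differentiableWithinAt) (fun t ht => (hf t ht).deriv)
  have hya : c = y := tendsto_nhds_unique_of_eventuallyEq tendsto_const_nhds ha
    (eventually_of_mem (Ioo_mem_nhdsGT hab) fun t ht => (hc t ht).symm)
  have hzb : c = z := tendsto_nhds_unique_of_eventuallyEq tendsto_const_nhds hb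
    (eventually_of_mem (Ioo_mem_nhdsLT hab) fun t ht => (hc t ht).symm)
  rw [← hya, hzb]

end RayIntegral

section RealRays

variable {l r θ : ℝ}

theorem norm_rayPt (p : ℂ) (θ r : ℝ) :
    ‖rayPt p θ r‖ = ‖p * Complex.exp ((-θ : ℝ) * Complex.I) + r‖ := by
  have hexp : Complex.exp ((-θ : ℝ) * Complex.I) * Complex.exp (θ * Complex.I) = 1 := by
    rw [← Complex.exp_add, Complex.ofReal_neg, neg_mul, neg_add_cancel, Complex.exp_zero]
  calc ‖rayPt p θ r‖
      = ‖rayPt p θ r‖ * ‖Complex.exp ((-θ : ℝ) * Complex.I)‖ := by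
        rw [Complex.norm_exp_ofReal_mul_I, mul_one]
    _ = ‖p * Complex.exp ((-θ : ℝ) * Complex.I) + r‖ := by
        rw [← norm_mul, rayPt]
        congr 1
        linear_combination (r : ℂ) * hexp

theorem rayPt_re (l θ r : ℝ) : (rayPt l θ r).re = l + r * Real.cos θ := by
  simp [rayPt, Complex.exp_ofReal_mul_I_re]

theorem rayPt_im (l θ r : ℝ) : (rayPt l θ r).im = r * Real.sin θ := by
  simp [rayPt, Complex.exp_ofReal_mul_I_im]

theorem rayPt_pi_div_two (p : ℂ) (r : ℝ) : rayPt p (Real.pi / 2 : ℝ) r = p + Complex.I * r := by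
  rw [rayPt, Complex.ofReal_div, Complex.ofReal_ofNat, Complex.exp_pi_div_two_mul_I, mul_comm]

theorem rayPt_pi (p : ℂ) (r : ℝ) : rayPt p Real.pi r = p - r := by
  rw [rayPt, Complex.exp_pi_mul_I, mul_neg_one, sub_eq_add_neg]

theorem ofReal_add_sub_rayPt (l m θ r : ℝ) : ((l + m : ℝ) : ℂ) - rayPt l θ r = rayPt m θ (-r) := by
  simp only [rayPt]
  push_cast
  ring

theorem norm_rayPt_le (hl : 0 ≤ l) (hr : 0 ≤ r) (θ : ℝ) : ‖rayPt l θ r‖ ≤ l + r := by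
  refine (norm_add_le _ _).trans_eq ?_
  rw [norm_mul, Complex.norm_exp_ofReal_mul_I, mul_one, Complex.norm_of_nonneg hl,
    Complex.norm_of_nonneg hr]

theorem abs_mul_cos_add_le_norm_rayPt (l θ r : ℝ) : |l * Real.cos θ + r| ≤ ‖rayPt l θ r‖ := by
  have hre := Complex.abs_re_le_norm (l * Complex.exp ((-θ : ℝ) * Complex.I) + r)
  rwa [Complex.add_re, Complex.re_ofReal_mul, Complex.exp_ofReal_mul_I_re, Real.cos_neg,
    Complex.ofReal_re, ← norm_rayPt] at hre

theorem mul_sin_le_norm_rayPt (l θ r : ℝ) : l * Real.sin θ ≤ ‖rayPt l θ r‖ := by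
  have him := Complex.abs_im_le_norm (l * Complex.exp ((-θ : ℝ) * Complex.I) + r)
  rw [Complex.add_im, Complex.im_ofReal_mul, Complex.exp_ofReal_mul_I_im, Real.sin_neg,
    Complex.ofReal_im, add_zero, mul_neg, abs_neg, ← norm_rayPt] at him
  exact (le_abs_self _).trans him

theorem le_re_rayPt_neg (l : ℝ) (hr : 0 ≤ r) (hθ : Real.cos θ ≤ 0) :
    l ≤ (rayPt l θ (-r)).re := by
  rw [rayPt_re]
  nlinarith

theorem le_norm_rayPt_neg (hl : 0 ≤ l) (r : ℝ) (hθ : Real.cos θ ≤ 0) :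
    r ≤ ‖rayPt l θ (-r)‖ :=
  calc r ≤ -(l * Real.cos θ + -r) := by nlinarith
    _ ≤ |l * Real.cos θ + -r| := neg_le_abs _
    _ ≤ ‖rayPt l θ (-r)‖ := abs_mul_cos_add_le_norm_rayPt l θ (-r)

theorem rayPt_neg_mem_slitPlane (hl : 0 < l) (hr : 0 ≤ r) (hθ : Real.cos θ ≤ 0) :
    rayPt l θ (-r) ∈ Complex.slitPlane :=
  Or.inl (hl.trans_le (le_re_rayPt_neg l hr hθ))

theorem arg_rayPt_le (hl : 0 ≤ l) (r : ℝ) (hθ : θ ∈ Ioc 0 Real.pi) : (rayPt l θ r).arg ≤ θ := by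
  set w := rayPt l θ r
  by_contra! hlt
  have hw : w ≠ 0 := fun h0 => by
    rw [h0, Complex.arg_zero] at hlt
    exact hlt.not_gt hθ.1
  have hre : ‖w‖ * Real.cos w.arg = l + r * Real.cos θ :=
    (Complex.norm_mul_cos_arg w).trans (rayPt_re l θ r)
  have him : ‖w‖ * Real.sin w.arg = r * Real.sin θ :=
    (Complex.norm_mul_sin_arg w).trans (rayPt_im l θ r)
  have hsub : ‖w‖ * Real.sin (w.arg - θ) = -(l * Real.sin θ) := by
    rw [Real.sin_sub]
    linear_combination Real.cos θ * him - Real.sin θ * hre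
  have hpos : 0 < ‖w‖ * Real.sin (w.arg - θ) :=
    mul_pos (norm_pos_iff.2 hw) (Real.sin_pos_of_pos_of_lt_pi (by linarith)
      (by linarith [Complex.arg_le_pi w, hθ.1]))
  have hnonneg : 0 ≤ l * Real.sin θ :=
    mul_nonneg hl (Real.sin_nonneg_of_nonneg_of_le_pi hθ.1.le hθ.2)
  linarith

end RealRays

section Kernel

variable {ap βp am βm L lp lm x β θ r : ℝ} {w : ℂ}

/-- The analytic continuation of the Fourier inversion integrand of `TS`, up to a constant factor:
the frequency `u` corresponds to `w = lp - i u`, and `L = lp + lm`. It is cut along the real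
half-lines `w ≤ 0` and `L ≤ w`. -/
noncomputable def tsKernel (ap βp am βm L x : ℝ) (w : ℂ) : ℂ :=
  Complex.exp (x * w - ap * w ^ (βp : ℂ) - am * (L - w) ^ (βm : ℂ))

/-- The derivative of `tsKernel` off its branch cuts. -/
noncomputable def tsKernelDeriv (ap βp am βm L x : ℝ) (w : ℂ) : ℂ :=
  tsKernel ap βp am βm L x w *
    (x - ap * (βp * w ^ ((βp - 1 : ℝ) : ℂ)) + am * (βm * (L - w) ^ ((βm - 1 : ℝ) : ℂ)))

theorem measurable_tsKernel (ap βp am βm L x : ℝ) : Measurable (tsKernel ap βp am βm L x) := by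
  unfold tsKernel
  fun_prop

theorem measurable_tsKernelDeriv (ap βp am βm L x : ℝ) :
    Measurable (tsKernelDeriv ap βp am βm L x) := by
  have hkernel := measurable_tsKernel ap βp am βm L x
  unfold tsKernelDeriv
  fun_prop

theorem hasDerivAt_tsKernel (hw : w ∈ Complex.slitPlane) (hLw : (L : ℂ) - w ∈ Complex.slitPlane) :
    HasDerivAt (tsKernel ap βp am βm L x) (tsKernelDeriv ap βp am βm L x w) w := by
  refine ((((hasDerivAt_id w).const_mul (x : ℂ)).sub
    (((hasDerivAt_id w).cpow_const (c := (βp : ℂ)) hw).const_mul (ap : ℂ))).sub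
    ((((hasDerivAt_id w).const_sub (L : ℂ)).cpow_const (c := (βm : ℂ)) hLw).const_mul
      (am : ℂ))).cexp.congr_deriv ?_
  simp only [tsKernelDeriv, tsKernel, Pi.sub_apply, id]
  push_cast
  ring

theorem tsKernel_conj (hw : w ∈ Complex.slitPlane) (hLw : (L : ℂ) - w ∈ Complex.slitPlane) :
    tsKernel ap βp am βm L x ((starRingEnd ℂ) w) =
      (starRingEnd ℂ) (tsKernel ap βp am βm L x w) := by
  have hpow {z : ℂ} (hz : z ∈ Complex.slitPlane) (b : ℝ) :
      (starRingEnd ℂ) (z ^ (b : ℂ)) = (starRingEnd ℂ) z ^ (b : ℂ) := by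
    simpa only [Complex.conj_ofReal] using
      (Complex.conj_cpow z b (Complex.mem_slitPlane_iff_arg.1 hz).1).symm
  simp only [tsKernel, ← Complex.exp_conj, map_sub, map_mul, hpow hw, hpow hLw,
    Complex.conj_ofReal]

theorem norm_tsKernel (ap βp am βm L x : ℝ) (w : ℂ) : ‖tsKernel ap βp am βm L x w‖ =
    Real.exp (x * w.re - ap * (w ^ (βp : ℂ)).re - am * ((L - w) ^ (βm : ℂ)).re) := by
  rw [tsKernel, Complex.norm_exp]
  simp

theorem norm_tsKernelDeriv_le {K δ ε : ℝ} (hx : 0 ≤ x) (hap : 0 ≤ ap) (ham : 0 ≤ am)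
    (hβp : βp ∈ Icc 0 1) (hβm : βm ∈ Icc 0 1) (hδ : 0 < δ) (hε : 0 < ε)
    (hK : ‖tsKernel ap βp am βm L x w‖ ≤ K) (hw : δ ≤ ‖w‖) (hLw : ε ≤ ‖(L : ℂ) - w‖) :
    ‖tsKernelDeriv ap βp am βm L x w‖ ≤
      K * (x + ap * (βp * δ ^ (βp - 1)) + am * (βm * ε ^ (βm - 1))) := by
  have hpow {z : ℂ} {a b d : ℝ} (ha : 0 ≤ a) (hb : b ∈ Icc (0 : ℝ) 1) (hd : 0 < d) (hz : d ≤ ‖z‖) :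
      ‖(a : ℂ) * (b * z ^ ((b - 1 : ℝ) : ℂ))‖ ≤ a * (b * d ^ (b - 1)) := by
    rw [norm_mul, norm_mul, Complex.norm_of_nonneg ha, Complex.norm_of_nonneg hb.1,
      Complex.norm_cpow_real]
    exact mul_le_mul_of_nonneg_left (mul_le_mul_of_nonneg_left
      (Real.rpow_le_rpow_of_nonpos hd hz (sub_nonpos.2 hb.2)) hb.1) ha
  rw [tsKernelDeriv, norm_mul]
  refine mul_le_mul hK ?_ (norm_nonneg _) ((norm_nonneg _).trans hK)
  exact (norm_add_le _ _).trans (add_le_add ((norm_sub_le _ _).trans (add_le_add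
    (Complex.norm_of_nonneg hx).le (hpow hap hβp hδ hw))) (hpow ham hβm hε hLw))

theorem cos_mul_norm_rpow_le_re_cpow (hw : 0 ≤ w.re) (hβ : β ∈ Icc 0 1) :
    Real.cos (Real.pi / 2 * β) * ‖w‖ ^ β ≤ (w ^ (β : ℂ)).re := by
  rw [Complex.cpow_ofReal_re, mul_comm, ← Real.cos_abs (w.arg * β), abs_mul, abs_of_nonneg hβ.1]
  have harg : |w.arg| * β ≤ Real.pi / 2 * β :=
    mul_le_mul_of_nonneg_right (Complex.abs_arg_le_pi_div_two_iff.2 hw) hβ.1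
  have hpi : Real.pi / 2 * β ≤ Real.pi := by nlinarith [Real.pi_pos, hβ.2]
  exact mul_le_mul_of_nonneg_left
    (Real.cos_le_cos_of_nonneg_of_le_pi (mul_nonneg (abs_nonneg _) hβ.1) hpi harg) (by positivity)

theorem cos_pi_div_two_mul_pos (hβ : β ∈ Ioo 0 1) : 0 < Real.cos (Real.pi / 2 * β) :=
  Real.cos_pos_of_mem_Ioo ⟨by nlinarith [Real.pi_pos, hβ.1], by nlinarith [Real.pi_pos, hβ.2]⟩

theorem norm_tsKernel_rayPt_le (ham : 0 ≤ am) (hβm : βm ∈ Ioo 0 1) (hlm : 0 ≤ lm)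
    (hθ : Real.cos θ ≤ 0) (hr : 0 ≤ r) :
    ‖tsKernel ap βp am βm (lp + lm : ℝ) x (rayPt lp θ r)‖ ≤
      Real.exp (x * (lp + r * Real.cos θ) - ap * (rayPt lp θ r ^ (βp : ℂ)).re -
        am * (Real.cos (Real.pi / 2 * βm) * r ^ βm)) := by
  rw [norm_tsKernel, ofReal_add_sub_rayPt, rayPt_re, Real.exp_le_exp]
  have hpow : r ^ βm ≤ ‖rayPt lm θ (-r)‖ ^ βm :=
    Real.rpow_le_rpow hr (le_norm_rayPt_neg hlm r hθ) hβm.1.le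
  have hre := cos_mul_norm_rpow_le_re_cpow (hlm.trans (le_re_rayPt_neg lm hr hθ))
    (Ioo_subset_Icc_self hβm)
  have hcos := cos_pi_div_two_mul_pos hβm
  gcongr
  exact (mul_le_mul_of_nonneg_left hpow hcos.le).trans hre

-- On rays close to the vertical, `re w^βp ≥ 0` because `arg w ≤ θ`.
theorem norm_tsKernel_rayPt_le_of_mul_le (hx : 0 ≤ x) (hap : 0 ≤ ap) (ham : 0 ≤ am)
    (hβp : 0 ≤ βp) (hβm : βm ∈ Ioo 0 1) (hlp : 0 ≤ lp) (hlm : 0 ≤ lm)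
    (hθ : θ ∈ Icc (Real.pi / 2) Real.pi) (hθβ : θ * βp ≤ Real.pi / 2) (hr : 0 ≤ r) :
    ‖tsKernel ap βp am βm (lp + lm : ℝ) x (rayPt lp θ r)‖ ≤
      Real.exp (x * lp) * Real.exp (-(am * Real.cos (Real.pi / 2 * βm)) * r ^ βm) := by
  have hpi := Real.pi_pos
  have hθ0 : 0 < θ := by linarith [hθ.1]
  have hcos : Real.cos θ ≤ 0 := Real.cos_nonpos_of_pi_div_two_le_of_le hθ.1 (by linarith [hθ.2])
  have hxcos : x * (r * Real.cos θ) ≤ 0 :=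
    mul_nonpos_of_nonneg_of_nonpos hx (mul_nonpos_of_nonneg_of_nonpos hr hcos)
  have harg : 0 ≤ (rayPt lp θ r).arg := Complex.arg_nonneg_iff.2 <| by
    rw [rayPt_im]
    exact mul_nonneg hr (Real.sin_nonneg_of_nonneg_of_le_pi hθ0.le hθ.2)
  have hargβ : (rayPt lp θ r).arg * βp ≤ Real.pi / 2 :=
    (mul_le_mul_of_nonneg_right (arg_rayPt_le hlp r ⟨hθ0, hθ.2⟩) hβp).trans hθβ
  have hre : 0 ≤ (rayPt lp θ r ^ (βp : ℂ)).re := by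
    rw [Complex.cpow_ofReal_re]
    refine mul_nonneg (by positivity) (Real.cos_nonneg_of_neg_pi_div_two_le_of_le ?_ hargβ)
    linarith [mul_nonneg harg hβp]
  refine (norm_tsKernel_rayPt_le ham hβm hlm hcos hr).trans ?_
  rw [← Real.exp_add, Real.exp_le_exp]
  linarith [mul_nonneg hap hre]

theorem exists_mul_rpow_le_mul_add {A ε : ℝ} (hβ : β ∈ Ioo 0 1) (hA : 0 ≤ A) (hε : 0 < ε) :
    ∃ C, ∀ s, 0 ≤ s → A * s ^ β ≤ ε * s + C := by
  have hlim := (tendsto_rpow_neg_atTop (sub_pos.2 hβ.2)).const_mul A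
  rw [mul_zero] at hlim
  obtain ⟨T, hTε, hT⟩ := ((hlim.eventually_le_const hε).and (eventually_gt_atTop 0)).exists
  refine ⟨A * T ^ β, fun s hs => ?_⟩
  have hmax : s ^ β ≤ T ^ (-(1 - β)) * s + T ^ β := by
    rcases le_total s T with hsT | hTs
    · have := Real.rpow_le_rpow hs hsT hβ.1.le
      have : 0 ≤ T ^ (-(1 - β)) * s := by positivity
      linarith
    · have hs0 := hT.trans_le hTs
      have hpow : s ^ β = s ^ (-(1 - β)) * s := by
        rw [← Real.rpow_add_one hs0.ne']
        ring_nf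
      have := Real.rpow_le_rpow_of_nonpos hT hTs (show -(1 - β) ≤ 0 by linarith [hβ.2])
      have : 0 ≤ T ^ β := by positivity
      nlinarith
  calc A * s ^ β ≤ A * (T ^ (-(1 - β)) * s + T ^ β) := by gcongr
    _ = A * T ^ (-(1 - β)) * s + A * T ^ β := by ring
    _ ≤ ε * s + A * T ^ β := by gcongr

theorem exists_norm_tsKernel_rayPt_le {k : ℝ} (hx : 0 < x) (hap : 0 ≤ ap) (ham : 0 ≤ am)
    (hβp : βp ∈ Ioo 0 1) (hβm : βm ∈ Ioo 0 1) (hlp : 0 ≤ lp) (hlm : 0 ≤ lm) (hk : 0 < k) :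
    ∃ M, 0 ≤ M ∧ ∀ θ r, Real.cos θ ≤ -k → 0 ≤ r →
      ‖tsKernel ap βp am βm (lp + lm : ℝ) x (rayPt lp θ r)‖ ≤
        M * Real.exp (-(x * k / 2) * r) := by
  obtain ⟨C, hC⟩ := exists_mul_rpow_le_mul_add hβp hap (half_pos (mul_pos hx hk))
  refine ⟨Real.exp (x * lp + (x * k / 2 * lp + C)), by positivity, fun θ r hcos hr => ?_⟩
  have hre : -(rayPt lp θ r ^ (βp : ℂ)).re ≤ (lp + r) ^ βp :=
    calc -(rayPt lp θ r ^ (βp : ℂ)).re ≤ ‖rayPt lp θ r ^ (βp : ℂ)‖ :=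
          (neg_le_abs _).trans (Complex.abs_re_le_norm _)
      _ = ‖rayPt lp θ r‖ ^ βp := Complex.norm_cpow_real _ _
      _ ≤ (lp + r) ^ βp :=
          Real.rpow_le_rpow (norm_nonneg _) (norm_rayPt_le hlp hr θ) hβp.1.le
  have hpow := hC (lp + r) (by positivity)
  have hapre := mul_le_mul_of_nonneg_left hre hap
  have hxcos := mul_le_mul_of_nonneg_left hcos (mul_nonneg hx.le hr)
  have hcosβ := cos_pi_div_two_mul_pos hβm
  have ham_pow : 0 ≤ am * (Real.cos (Real.pi / 2 * βm) * r ^ βm) := by positivity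
  refine (norm_tsKernel_rayPt_le ham hβm hlm (hcos.trans (neg_nonpos.2 hk.le)) hr).trans ?_
  rw [← Real.exp_add, Real.exp_le_exp]
  linarith

end Kernel

section ContourRotation

variable {ap βp am βm L lp lm x θ r : ℝ} {w : ℂ}

theorem hasDerivAt_rayIntegral_tsKernel (hx : 0 < x) (hap : 0 ≤ ap) (ham : 0 ≤ am)
    (hβp : βp ∈ Ioo 0 1) (hβm : βm ∈ Ioo 0 1) (hlp : 0 < lp) (hlm : 0 < lm)
    (hθ : θ ∈ Ioo (Real.pi / 2) Real.pi) :
    HasDerivAt (rayIntegral (tsKernel ap βp am βm (lp + lm : ℝ) x) lp) 0 θ := by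
  have hcos : Real.cos θ < 0 :=
    Real.cos_neg_of_pi_div_two_lt_of_lt hθ.1 (by linarith [hθ.2, Real.pi_pos])
  have hsin : 0 < Real.sin θ :=
    Real.sin_pos_of_pos_of_lt_pi (by linarith [hθ.1, Real.pi_pos]) hθ.2
  obtain ⟨M, hM, hbound⟩ := exists_norm_tsKernel_rayPt_le hx hap ham hβp hβm hlp.le hlm.le
    (k := -Real.cos θ / 2) (by linarith)
  set K := x + ap * (βp * (lp * (Real.sin θ / 2)) ^ (βp - 1)) + am * (βm * lm ^ (βm - 1))
  have hK : 0 ≤ K := by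
    have := hβp.1
    have := hβm.1
    positivity
  have hnhds : {φ | Real.cos φ < Real.cos θ / 2 ∧ Real.sin θ / 2 < Real.sin φ} ∈ 𝓝 θ :=
    (Real.continuous_cos.continuousAt.eventually_lt continuousAt_const (by linarith)).and
      (continuousAt_const.eventually_lt Real.continuous_sin.continuousAt (by linarith))
  refine hasDerivAt_rayIntegral (M := M * (1 + K)) hnhds
    (show 0 < x * (-Real.cos θ / 2) / 2 by nlinarith) (measurable_tsKernel _ _ _ _ _ _)
    (measurable_tsKernelDeriv _ _ _ _ _ _) (fun φ hφ s hs => hasDerivAt_tsKernel ?_ ?_)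
    (fun φ hφ s hs => ?_) (fun φ hφ s hs => ?_)
  · refine Or.inr ((rayPt_im lp φ s).trans_ne (mul_pos hs ?_).ne')
    linarith [hφ.2]
  · rw [ofReal_add_sub_rayPt]
    exact rayPt_neg_mem_slitPlane hlm hs.le (by linarith [hφ.1])
  · refine (hbound φ s (by linarith [hφ.1]) hs.le).trans ?_
    gcongr
    exact le_mul_of_one_le_right hM (by linarith)
  · have hcosφ : Real.cos φ ≤ 0 := by linarith [hφ.1]
    refine (norm_tsKernelDeriv_le hx.le hap ham (Ioo_subset_Icc_self hβp)
      (Ioo_subset_Icc_self hβm) (δ := lp * (Real.sin θ / 2)) (by positivity) hlm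
      (hbound φ s (by linarith [hφ.1]) hs.le) ?_ ?_).trans ?_
    · exact (mul_le_mul_of_nonneg_left hφ.2.le hlp.le).trans (mul_sin_le_norm_rayPt lp φ s)
    · rw [ofReal_add_sub_rayPt]
      exact (le_re_rayPt_neg lm hs.le hcosφ).trans (Complex.re_le_norm _)
    · rw [mul_right_comm]
      exact mul_le_mul_of_nonneg_right
        (mul_le_mul_of_nonneg_left (le_add_of_nonneg_left zero_le_one) hM) (Real.exp_pos _).le

theorem continuousWithinAt_cpow_upperHalfPlane (hw : w ≠ 0) (b : ℂ) :
    ContinuousWithinAt (fun w : ℂ => w ^ b) {w | 0 ≤ w.im} w := by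
  by_cases hslit : w ∈ Complex.slitPlane
  · exact (continuousAt_id.cpow continuousAt_const hslit).continuousWithinAt
  rw [Complex.mem_slitPlane_iff, not_or, not_lt, not_not] at hslit
  have hre : w.re < 0 := hslit.1.lt_of_ne fun h => hw (Complex.ext h hslit.2)
  have hlog := Complex.continuousWithinAt_log_of_re_neg_of_im_zero hre hslit.2
  refine (hlog.mul (continuousWithinAt_const (b := b))).cexp.congr_of_eventuallyEq ?_
    (Complex.cpow_def_of_ne_zero hw b)
  filter_upwards [mem_nhdsWithin_of_mem_nhds (isOpen_ne.mem_nhds hw)] with z hz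
  exact Complex.cpow_def_of_ne_zero hz b

theorem continuousWithinAt_tsKernel (hw : w ≠ 0) (hLw : (L : ℂ) - w ∈ Complex.slitPlane) :
    ContinuousWithinAt (tsKernel ap βp am βm L x) {w | 0 ≤ w.im} w := by
  have hp := continuousWithinAt_cpow_upperHalfPlane hw βp
  have hm : ContinuousWithinAt (fun w : ℂ => ((L : ℂ) - w) ^ (βm : ℂ)) {w | 0 ≤ w.im} w :=
    ((continuousAt_const.sub continuousAt_id).cpow continuousAt_const hLw).continuousWithinAt
  unfold tsKernel
  fun_prop

theorem tendsto_tsKernel_rayPt_mul_exp (hlm : 0 < lm) (hr : 0 ≤ r)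
    (hθ : θ ∈ Icc (Real.pi / 2) Real.pi) (hne : rayPt lp θ r ≠ 0) :
    Tendsto (fun θ => tsKernel ap βp am βm (lp + lm : ℝ) x (rayPt lp θ r) *
      Complex.exp (θ * Complex.I)) (𝓝[Icc (Real.pi / 2) Real.pi] θ)
      (𝓝 (tsKernel ap βp am βm (lp + lm : ℝ) x (rayPt lp θ r) * Complex.exp (θ * Complex.I))) := by
  have hpi := Real.pi_pos
  have hcos : Real.cos θ ≤ 0 :=
    Real.cos_nonpos_of_pi_div_two_le_of_le hθ.1 (by linarith [hθ.2])
  have hslit : ((lp + lm : ℝ) : ℂ) - rayPt lp θ r ∈ Complex.slitPlane :=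
    ofReal_add_sub_rayPt lp lm θ r ▸ rayPt_neg_mem_slitPlane hlm hr hcos
  have hkernel : ContinuousWithinAt
      (tsKernel ap βp am βm (lp + lm : ℝ) x ∘ fun θ => rayPt lp θ r)
      (Icc (Real.pi / 2) Real.pi) θ := by
    refine ContinuousWithinAt.comp (f := fun θ => rayPt lp θ r)
      (continuousWithinAt_tsKernel hne hslit)
      (hasDerivAt_rayPt_angle lp θ r).continuousAt.continuousWithinAt fun φ hφ => ?_
    rw [mem_ofPred_eq, rayPt_im]
    exact mul_nonneg hr (Real.sin_nonneg_of_nonneg_of_le_pi (by linarith [hφ.1]) hφ.2)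
  exact hkernel.mul (hasDerivAt_exp_ofReal_mul_I θ).continuousAt.continuousWithinAt

theorem integrableOn_const_mul_exp_neg_mul_rpow {k b : ℝ} (C : ℝ) (hk : 0 < k) (hb : 0 < b) :
    IntegrableOn (fun r : ℝ => C * Real.exp (-k * r ^ b)) (Ioi 0) := by
  simpa [IntegrableOn] using
    (integrableOn_rpow_mul_exp_neg_mul_rpow (p := b) (s := 0) (by norm_num) hb hk).const_mul C

theorem tendsto_rayIntegral_tsKernel_pi_div_two (hx : 0 ≤ x) (hap : 0 ≤ ap) (ham : 0 < am)
    (hβp : βp ∈ Ioo 0 1) (hβm : βm ∈ Ioo 0 1) (hlp : 0 < lp) (hlm : 0 < lm) :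
    Tendsto (rayIntegral (tsKernel ap βp am βm (lp + lm : ℝ) x) lp) (𝓝[>] (Real.pi / 2))
      (𝓝 (rayIntegral (tsKernel ap βp am βm (lp + lm : ℝ) x) lp (Real.pi / 2 : ℝ))) := by
  have hpi := Real.pi_pos
  have hlt : Real.pi / 2 < min Real.pi (Real.pi / 2 / βp) :=
    lt_min (by linarith) (by rw [lt_div_iff₀ hβp.1]; nlinarith [hβp.2])
  refine tendsto_integral_filter_of_dominated_convergence
    (fun r => Real.exp (x * lp) * Real.exp (-(am * Real.cos (Real.pi / 2 * βm)) * r ^ βm))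
    (Eventually.of_forall fun θ =>
      aestronglyMeasurable_comp_rayPt_mul_exp (measurable_tsKernel _ _ _ _ _ _)) ?_
    (integrableOn_const_mul_exp_neg_mul_rpow _ (mul_pos ham (cos_pi_div_two_mul_pos hβm)) hβm.1)
    (ae_restrict_of_forall_mem measurableSet_Ioi fun r (hr : 0 < r) => ?_)
  · filter_upwards [Ioo_mem_nhdsGT hlt] with θ hθ
    refine ae_restrict_of_forall_mem measurableSet_Ioi fun r (hr : 0 < r) => ?_
    rw [norm_comp_rayPt_mul_exp]
    exact norm_tsKernel_rayPt_le_of_mul_le hx hap ham.le hβp.1.le hβm hlp.le hlm.le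
      ⟨hθ.1.le, hθ.2.le.trans (min_le_left _ _)⟩
      ((le_div_iff₀ hβp.1).1 (hθ.2.le.trans (min_le_right _ _))) hr.le
  · have hne : rayPt lp (Real.pi / 2 : ℝ) r ≠ 0 := fun h0 => hlp.ne' <| by
      simpa [rayPt_re] using congrArg Complex.re h0
    exact (tendsto_tsKernel_rayPt_mul_exp hlm hr.le ⟨le_rfl, by linarith⟩ hne).mono_left
      (nhdsWithin_le_of_mem (Icc_mem_nhdsGT (by linarith)))

theorem tendsto_rayIntegral_tsKernel_pi (hx : 0 < x) (hap : 0 ≤ ap) (ham : 0 ≤ am)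
    (hβp : βp ∈ Ioo 0 1) (hβm : βm ∈ Ioo 0 1) (hlp : 0 ≤ lp) (hlm : 0 < lm) :
    Tendsto (rayIntegral (tsKernel ap βp am βm (lp + lm : ℝ) x) lp) (𝓝[<] Real.pi)
      (𝓝 (rayIntegral (tsKernel ap βp am βm (lp + lm : ℝ) x) lp Real.pi)) := by
  have hpi := Real.pi_pos
  obtain ⟨M, -, hM⟩ := exists_norm_tsKernel_rayPt_le hx hap ham hβp hβm hlp hlm.le one_half_pos
  have hcos : ∀ᶠ θ in 𝓝 Real.pi, Real.cos θ < -(1 / 2) :=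
    Real.continuous_cos.continuousAt.eventually_lt continuousAt_const
      (by rw [Real.cos_pi]; norm_num)
  refine tendsto_integral_filter_of_dominated_convergence
    (fun r => M * Real.exp (-(x * (1 / 2) / 2) * r))
    (Eventually.of_forall fun θ =>
      aestronglyMeasurable_comp_rayPt_mul_exp (measurable_tsKernel _ _ _ _ _ _)) ?_
    ((exp_neg_integrableOn_Ioi 0 (by positivity)).const_mul M)
    ((ae_restrict_iff' measurableSet_Ioi).2
      ((Measure.ae_ne volume lp).mono fun r hne (hr : 0 < r) => ?_))
  · filter_upwards [nhdsWithin_le_nhds hcos] with θ hθ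
    refine ae_restrict_of_forall_mem measurableSet_Ioi fun r (hr : 0 < r) => ?_
    rw [norm_comp_rayPt_mul_exp]
    exact hM θ r hθ.le hr.le
  · have hne0 : rayPt lp Real.pi r ≠ 0 := fun h0 => hne <| by
      rw [rayPt_pi, sub_eq_zero] at h0
      exact_mod_cast h0.symm
    exact (tendsto_tsKernel_rayPt_mul_exp hlm hr.le ⟨by linarith, le_rfl⟩ hne0).mono_left
      (nhdsWithin_le_of_mem (Icc_mem_nhdsLT (by linarith)))

theorem rayIntegral_tsKernel_pi_div_two_eq (hx : 0 < x) (hap : 0 ≤ ap) (ham : 0 < am)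
    (hβp : βp ∈ Ioo 0 1) (hβm : βm ∈ Ioo 0 1) (hlp : 0 < lp) (hlm : 0 < lm) :
    rayIntegral (tsKernel ap βp am βm (lp + lm : ℝ) x) lp (Real.pi / 2 : ℝ) =
      rayIntegral (tsKernel ap βp am βm (lp + lm : ℝ) x) lp Real.pi :=
  eq_of_hasDerivAt_zero_of_tendsto (by linarith [Real.pi_pos])
    (fun _ hθ => hasDerivAt_rayIntegral_tsKernel hx hap ham.le hβp hβm hlp hlm hθ)
    (tendsto_rayIntegral_tsKernel_pi_div_two hx.le hap ham hβp hβm hlp hlm)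
    (tendsto_rayIntegral_tsKernel_pi hx hap ham.le hβp hβm hlp.le hlm)

end ContourRotation

section VerticalIntegral

theorem integrable_of_integrableOn_Ioi_of_conj {f : ℝ → ℂ}
    (hconj : ∀ u, f (-u) = (starRingEnd ℂ) (f u)) (hf : IntegrableOn f (Ioi 0)) :
    Integrable f := by
  have hneg : IntegrableOn f (Iio 0) := by
    have hreflect : IntegrableOn (fun u => f (-u)) (Iio 0) :=
      IntegrableOn.comp_neg_Iio (by rwa [neg_zero])
    simpa only [hconj, IntegrableOn, Complex.conjLIE_apply, Complex.conj_conj] using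
      Complex.conjLIE.integrable_comp_iff.2 hreflect
  rw [← integrableOn_univ, ← Iic_union_Ioi (a := (0 : ℝ))]
  exact ((integrableOn_Iic_iff_integrableOn_Iio (by simp)).2 hneg).union hf

theorem integral_eq_two_mul_re_of_conj {f : ℝ → ℂ}
    (hconj : ∀ u, f (-u) = (starRingEnd ℂ) (f u)) (hf : Integrable f) :
    ∫ u, f u = ((2 * (∫ u in Ioi 0, f u).re : ℝ) : ℂ) := by
  have hneg : ∫ u in Iic 0, f u = (starRingEnd ℂ) (∫ u in Ioi 0, f u) := by
    have hreflect := integral_comp_neg_Iic 0 fun u => f (-u)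
    simp only [neg_neg, neg_zero, hconj] at hreflect
    rw [hreflect, integral_conj]
  rw [← intervalIntegral.integral_Iic_add_Ioi (b := 0) hf.integrableOn hf.integrableOn, hneg,
    add_comm, Complex.add_conj]

theorem integral_Ioi_comp_sub_left {E : Type*} [NormedAddCommGroup E] [NormedSpace ℝ E]
    {g : ℝ → E} {l : ℝ} (hl : 0 ≤ l) (hg : ∀ t ∈ Ico 0 l, g t = 0) :
    ∫ r in Ioi 0, g (l - r) = ∫ t in Iio 0, g t :=
  calc ∫ r in Ioi 0, g (l - r)
      = ∫ r in Ioi l, g (l - r) :=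
        setIntegral_eq_of_subset_of_forall_sdiff_eq_zero measurableSet_Ioi (Ioi_subset_Ioi hl)
          fun r ⟨(hr : 0 < r), (hlr : ¬ l < r)⟩ => hg _ ⟨by linarith, by linarith⟩
    _ = ∫ r, (Iio 0).indicator g (l - r) := by
        rw [← integral_indicator measurableSet_Ioi]
        congr 1 with r
        simp only [indicator, mem_Ioi, mem_Iio, sub_neg]
    _ = ∫ t in Iio 0, g t := by
        rw [integral_sub_left_eq_self, integral_indicator measurableSet_Iio]

variable {ap βp am βm L lp lm x : ℝ}

theorem tsKernel_vertical_neg (hlp : 0 < lp) (hlm : 0 < lm) (u : ℝ) :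
    tsKernel ap βp am βm (lp + lm : ℝ) x (lp + Complex.I * (-u : ℝ)) =
      (starRingEnd ℂ) (tsKernel ap βp am βm (lp + lm : ℝ) x (lp + Complex.I * u)) := by
  rw [← tsKernel_conj (Or.inl (by simpa using hlp)) (Or.inl (by simpa using hlm))]
  simp

theorem integrable_tsKernel_vertical (hx : 0 ≤ x) (hap : 0 ≤ ap) (ham : 0 < am)
    (hβp : βp ∈ Ioo 0 1) (hβm : βm ∈ Ioo 0 1) (hlp : 0 < lp) (hlm : 0 < lm) :
    Integrable fun u : ℝ => tsKernel ap βp am βm (lp + lm : ℝ) x (lp + Complex.I * u) := by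
  have hpi := Real.pi_pos
  refine integrable_of_integrableOn_Ioi_of_conj (tsKernel_vertical_neg hlp hlm) <|
    Integrable.mono' (integrableOn_const_mul_exp_neg_mul_rpow (Real.exp (x * lp))
      (mul_pos ham (cos_pi_div_two_mul_pos hβm)) hβm.1)
      ((measurable_tsKernel _ _ _ _ _ _).comp (by fun_prop)).aestronglyMeasurable
      (ae_restrict_of_forall_mem measurableSet_Ioi fun u (hu : 0 < u) => ?_)
  rw [← rayPt_pi_div_two]
  exact norm_tsKernel_rayPt_le_of_mul_le hx hap ham.le hβp.1.le hβm hlp.le hlm.le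
    ⟨le_rfl, by linarith⟩ (by nlinarith [hβp.2]) hu.le

theorem rayIntegral_pi_div_two (F : ℂ → ℂ) (p : ℂ) :
    rayIntegral F p (Real.pi / 2 : ℝ) = Complex.I * ∫ u in Ioi (0 : ℝ), F (p + Complex.I * u) := by
  simp only [rayIntegral, rayPt_pi_div_two]
  rw [integral_mul_const, Complex.ofReal_div, Complex.ofReal_ofNat, Complex.exp_pi_div_two_mul_I,
    mul_comm]

theorem rayIntegral_pi (F : ℂ → ℂ) (p : ℂ) :
    rayIntegral F p Real.pi = -∫ r in Ioi (0 : ℝ), F (p - r) := by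
  simp only [rayIntegral, rayPt_pi]
  rw [integral_mul_const, Complex.exp_pi_mul_I, mul_neg_one]

theorem im_tsKernel_ofReal {t : ℝ} (ht : t ∈ Icc 0 L) :
    (tsKernel ap βp am βm L x t).im = 0 := by
  rw [tsKernel, ← Complex.ofReal_sub, ← Complex.ofReal_cpow ht.1,
    ← Complex.ofReal_cpow (sub_nonneg.2 ht.2)]
  norm_cast

theorem im_tsKernel_neg (hL : 0 ≤ L) {s : ℝ} (hs : 0 ≤ s) :
    (tsKernel ap βp am βm L x (-s : ℝ)).im =
      Real.exp (-(x * s)) * Real.exp (-(am * (L + s) ^ βm)) *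
        (Complex.exp (-(ap * s ^ βp : ℝ) * Complex.exp (βp * Real.pi * Complex.I))).im := by
  have hp : ((-s : ℝ) : ℂ) ^ (βp : ℂ) =
      (s ^ βp : ℝ) * Complex.exp (βp * Real.pi * Complex.I) := by
    rw [Complex.ofReal_cpow_of_nonpos (neg_nonpos.2 hs), Complex.ofReal_neg, neg_neg,
      Complex.ofReal_cpow hs]
    ring_nf
  have hm : ((L : ℂ) - (-s : ℝ)) ^ (βm : ℂ) = ((L + s) ^ βm : ℝ) := by
    rw [← Complex.ofReal_sub, sub_neg_eq_add, ← Complex.ofReal_cpow (add_nonneg hL hs)]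
  have hexponent : (x : ℂ) * (-s : ℝ) - ap * ((s ^ βp : ℝ) * Complex.exp (βp * Real.pi * Complex.I))
      - am * ((L + s) ^ βm : ℝ) = ((-(x * s) + -(am * (L + s) ^ βm) : ℝ) : ℂ) +
        (-(ap * s ^ βp : ℝ) * Complex.exp (βp * Real.pi * Complex.I)) := by
    push_cast
    ring
  rw [tsKernel, hp, hm, hexponent, Complex.exp_add, ← Complex.ofReal_exp, Complex.im_ofReal_mul,
    Real.exp_add]

theorem integrableOn_tsKernel_sub (hx : 0 < x) (hap : 0 ≤ ap) (ham : 0 ≤ am)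
    (hβp : βp ∈ Ioo 0 1) (hβm : βm ∈ Ioo 0 1) (hlp : 0 ≤ lp) (hlm : 0 ≤ lm) :
    IntegrableOn (fun r : ℝ => tsKernel ap βp am βm (lp + lm : ℝ) x (lp - r)) (Ioi 0) := by
  obtain ⟨M, -, hM⟩ := exists_norm_tsKernel_rayPt_le hx hap ham hβp hβm hlp hlm one_pos
  refine Integrable.mono'
    ((exp_neg_integrableOn_Ioi 0 (b := x * 1 / 2) (by positivity)).const_mul M)
    ((measurable_tsKernel _ _ _ _ _ _).comp (by fun_prop)).aestronglyMeasurable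
    (ae_restrict_of_forall_mem measurableSet_Ioi fun r (hr : 0 < r) => ?_)
  rw [← rayPt_pi]
  exact hM Real.pi r Real.cos_pi.le hr.le

theorem im_integral_tsKernel_sub (hx : 0 < x) (hap : 0 ≤ ap) (ham : 0 ≤ am)
    (hβp : βp ∈ Ioo 0 1) (hβm : βm ∈ Ioo 0 1) (hlp : 0 ≤ lp) (hlm : 0 ≤ lm) :
    (∫ r in Ioi (0 : ℝ), tsKernel ap βp am βm (lp + lm : ℝ) x (lp - r)).im =
      ∫ s in Ioi (0 : ℝ), (tsKernel ap βp am βm (lp + lm : ℝ) x (-s : ℝ)).im := by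
  set g : ℝ → ℝ := fun t => (tsKernel ap βp am βm (lp + lm : ℝ) x t).im
  have hg : ∀ t ∈ Ico 0 lp, g t = 0 := fun t ht =>
    im_tsKernel_ofReal ⟨ht.1, by linarith [ht.2]⟩
  calc (∫ r in Ioi (0 : ℝ), tsKernel ap βp am βm (lp + lm : ℝ) x (lp - r)).im
      = ∫ r in Ioi 0, g (lp - r) := by
        simp only [g, Complex.ofReal_sub]
        exact (integral_im (integrableOn_tsKernel_sub hx hap ham hβp hβm hlp hlm)).symm
    _ = ∫ r in Ioi 0, g (0 - r) := by
        rw [integral_Ioi_comp_sub_left hlp hg, integral_Ioi_comp_sub_left le_rfl (by simp)]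
    _ = ∫ s in Ioi (0 : ℝ), (tsKernel ap βp am βm (lp + lm : ℝ) x (-s : ℝ)).im := by
        simp only [g, zero_sub]

theorem integral_tsKernel_vertical (hx : 0 < x) (hap : 0 ≤ ap) (ham : 0 < am)
    (hβp : βp ∈ Ioo 0 1) (hβm : βm ∈ Ioo 0 1) (hlp : 0 < lp) (hlm : 0 < lm) :
    ∫ u : ℝ, tsKernel ap βp am βm (lp + lm : ℝ) x (lp + Complex.I * u) =
      ((-2 * ∫ s in Ioi (0 : ℝ), (tsKernel ap βp am βm (lp + lm : ℝ) x (-s : ℝ)).im : ℝ) : ℂ) := by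
  have hrotate := congrArg Complex.im
    (rayIntegral_tsKernel_pi_div_two_eq hx hap ham hβp hβm hlp hlm)
  rw [rayIntegral_pi_div_two, rayIntegral_pi, Complex.neg_im, Complex.I_mul_im,
    im_integral_tsKernel_sub hx hap ham.le hβp hβm hlp.le hlm.le] at hrotate
  rw [integral_eq_two_mul_re_of_conj (tsKernel_vertical_neg hlp hlm)
    (integrable_tsKernel_vertical hx.le hap ham hβp hβm hlp hlm), hrotate, mul_neg, neg_mul]

end VerticalIntegral

section FourierTransform

variable {α β l αp βp lp αm βm lm : ℝ} {μ : Measure ℝ}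

theorem tsA_pos (hα : 0 < α) (hβ : β ∈ Ioo 0 1) : 0 < tsA α β := by
  have hGamma : 0 < -β * Real.Gamma (-β) := by
    rw [← Gamma_one_sub hβ.1.ne']
    exact Real.Gamma_pos_of_pos (by linarith [hβ.2])
  rw [tsA]
  nlinarith [hβ.1]

theorem _root_.IsTSPlus.charFun (h : IsTSPlus α β l μ) (hβ : β ∈ Ioo 0 1) (hl : 0 < l) (u : ℝ) :
    charFun μ u = Complex.exp
      (-(tsA α β : ℂ) * ((l - Complex.I * u) ^ (β : ℂ) - (l : ℂ) ^ (β : ℂ))) := by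
  rw [h.charFun_eq, integral_exp_I_mul_sub_one_mul_levyDensity hβ hl]

theorem charFun_map_neg (μ : Measure ℝ) (u : ℝ) :
    charFun (μ.map fun x => -x) u = charFun μ (-u) := by
  simpa using charFun_map_mul (μ := μ) (-1) u

theorem _root_.IsTS.isProbabilityMeasure (h : IsTS αp βp lp αm βm lm μ) :
    IsProbabilityMeasure μ := by
  obtain ⟨μp, μm, hp, ⟨ρ, hρ, rfl⟩, rfl⟩ := h
  have := hp.isProb
  have := hρ.isProb
  have : IsProbabilityMeasure (ρ.map fun x => -x) :=
    Measure.isProbabilityMeasure_map (by fun_prop)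
  infer_instance

theorem _root_.IsTS.exp_mul_charFun (h : IsTS αp βp lp αm βm lm μ) (hβp : βp ∈ Ioo 0 1)
    (hlp : 0 < lp) (hβm : βm ∈ Ioo 0 1) (hlm : 0 < lm) (x u : ℝ) :
    Complex.exp (-(Complex.I * u * x)) * charFun μ u =
      Real.exp (tsGamma αp βp lp αm βm lm - lp * x) *
        tsKernel (tsA αp βp) βp (tsA αm βm) βm (lp + lm : ℝ) x (lp + Complex.I * (-u : ℝ)) := by
  obtain ⟨μp, μm, hp, ⟨ρ, hρ, rfl⟩, rfl⟩ := h
  have := hp.isProb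
  have := hρ.isProb
  have : IsProbabilityMeasure (ρ.map fun x => -x) :=
    Measure.isProbabilityMeasure_map (by fun_prop)
  rw [charFun_conv, charFun_map_neg, hp.charFun hβp hlp, hρ.charFun hβm hlm, tsKernel,
    Complex.ofReal_exp, ← Complex.exp_add, ← Complex.exp_add, ← Complex.exp_add, tsGamma]
  congr 1
  push_cast [Complex.ofReal_cpow hlp.le, Complex.ofReal_cpow hlm.le]
  ring_nf

theorem _root_.IsTS.integrable_charFun (h : IsTS αp βp lp αm βm lm μ) (hαp : 0 < αp)
    (hβp : βp ∈ Ioo 0 1) (hlp : 0 < lp) (hαm : 0 < αm) (hβm : βm ∈ Ioo 0 1) (hlm : 0 < lm) :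
    Integrable (charFun μ) := by
  refine ((integrable_tsKernel_vertical le_rfl (tsA_pos hαp hβp).le (tsA_pos hαm hβm) hβp hβm
    hlp hlm).comp_neg.const_mul
      (Real.exp (tsGamma αp βp lp αm βm lm - lp * 0) : ℂ)).congr (Eventually.of_forall fun u => ?_)
  exact (h.exp_mul_charFun hβp hlp hβm hlm 0 u).symm.trans (by simp)

theorem _root_.IsTS.fourierDensity_eq (h : IsTS αp βp lp αm βm lm μ) (hαp : 0 < αp)
    (hβp : βp ∈ Ioo 0 1) (hlp : 0 < lp) (hαm : 0 < αm) (hβm : βm ∈ Ioo 0 1) (hlm : 0 < lm)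
    {x : ℝ} (hx : 0 < x) :
    fourierDensity μ x = ((Real.exp (tsGamma αp βp lp αm βm lm - lp * x) *
      -((∫ s in Ioi (0 : ℝ),
        (tsKernel (tsA αp βp) βp (tsA αm βm) βm (lp + lm : ℝ) x (-s : ℝ)).im) / Real.pi) : ℝ) :
          ℂ) := by
  simp only [fourierDensity, h.exp_mul_charFun hβp hlp hβm hlm]
  rw [integral_const_mul, integral_neg_eq_self fun u : ℝ => tsKernel (tsA αp βp) βp (tsA αm βm) βm
    (lp + lm : ℝ) x (lp + Complex.I * u), integral_tsKernel_vertical hx (tsA_pos hαp hβp).le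
      (tsA_pos hαm hβm) hβp hβm hlp hlm]
  have hpi : (Real.pi : ℂ) ≠ 0 := by exact_mod_cast Real.pi_ne_zero
  push_cast
  field_simp

end FourierTransform

/-! ### Expansion of the inversion integral -/

theorem hasSum_mul_of_summable_norm {ι κ R : Type*} [NormedRing R] [CompleteSpace R] {f : ι → R}
    {g : κ → R} {s t : R} (hf : HasSum f s) (hg : HasSum g t) (hf' : Summable fun i => ‖f i‖)
    (hg' : Summable fun j => ‖g j‖) : HasSum (fun p : ι × κ => f p.1 * g p.2) (s * t) :=
  hf.mul hg (summable_mul_of_summable_norm hf' hg')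

theorem hasSum_exp_mul_exp {𝔸 : Type*} [NormedDivisionRing 𝔸] [NormedAlgebra ℚ 𝔸]
    [CompleteSpace 𝔸] (p q : 𝔸) :
    HasSum (fun n : ℕ × ℕ => p ^ n.1 / n.1.factorial * (q ^ n.2 / n.2.factorial))
      (NormedSpace.exp p * NormedSpace.exp q) :=
  hasSum_mul_of_summable_norm (ι := ℕ) (κ := ℕ) (f := fun n => p ^ n / n.factorial)
    (g := fun n => q ^ n / n.factorial)
    (NormedSpace.expSeries_div_hasSum_exp p) (NormedSpace.expSeries_div_hasSum_exp q)
    (NormedSpace.norm_expSeries_div_summable p) (NormedSpace.norm_expSeries_div_summable q)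

section LaplaceExpansion

variable {A B βp βm L x s : ℝ}

theorem hasSum_pow_div_factorial_mul_rpow (A B βp βm x : ℝ) (hs : 0 ≤ s) (hLs : 0 ≤ L + s) :
    HasSum (fun n : ℕ × ℕ => A ^ n.1 / n.1.factorial * (B ^ n.2 / n.2.factorial) *
        (Real.exp (-(x * s)) * s ^ (βp * n.1) * (L + s) ^ (βm * n.2)))
      (Real.exp (-(x * s)) * (Real.exp (A * s ^ βp) * Real.exp (B * (L + s) ^ βm))) := by
  have h := (hasSum_exp_mul_exp (A * s ^ βp) (B * (L + s) ^ βm)).mul_left (Real.exp (-(x * s)))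
  rw [← Real.exp_eq_exp_ℝ] at h
  refine h.congr_fun fun n => ?_
  rw [Real.rpow_mul_natCast hs, Real.rpow_mul_natCast hLs, mul_pow, mul_pow]
  ring

theorem integrableOn_exp_mul_exp_rpow_mul_exp_rpow (hA : 0 ≤ A) (hB : 0 ≤ B)
    (hβp : βp ∈ Ioo 0 1) (hβm : βm ∈ Ioo 0 1) (hL : 0 ≤ L) (hx : 0 < x) :
    IntegrableOn (fun s : ℝ => Real.exp (-(x * s)) *
      (Real.exp (A * s ^ βp) * Real.exp (B * (L + s) ^ βm))) (Ioi 0) := by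
  obtain ⟨C, hC⟩ := exists_mul_rpow_le_mul_add hβp hA (show 0 < x / 4 by positivity)
  obtain ⟨D, hD⟩ := exists_mul_rpow_le_mul_add hβm hB (show 0 < x / 4 by positivity)
  refine Integrable.mono' ((exp_neg_integrableOn_Ioi 0 (half_pos hx)).const_mul
    (Real.exp (C + D + x / 4 * L))) (by fun_prop)
    (ae_restrict_of_forall_mem measurableSet_Ioi fun s (hs : 0 < s) => ?_)
  rw [Real.norm_of_nonneg (by positivity), ← Real.exp_add, ← Real.exp_add, ← Real.exp_add,
    Real.exp_le_exp]
  linarith [hC s hs.le, hD (L + s) (by positivity)]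

theorem hasSum_mul_laplaceInt {k : ℕ × ℕ → ℝ} {f : ℝ → ℝ} (hA : 0 ≤ A) (hB : 0 ≤ B)
    (hβp : βp ∈ Ioo 0 1) (hβm : βm ∈ Ioo 0 1) (hL : 0 ≤ L) (hx : 0 < x)
    (hk : ∀ n, |k n| ≤ A ^ n.1 / n.1.factorial * (B ^ n.2 / n.2.factorial))
    (hf : ∀ s, 0 < s → HasSum (fun n : ℕ × ℕ =>
      k n * (Real.exp (-(x * s)) * s ^ (βp * n.1) * (L + s) ^ (βm * n.2))) (f s)) :
    HasSum (fun n : ℕ × ℕ => k n * laplaceInt (βp * n.1) (βm * n.2) L x)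
      (∫ s in Ioi 0, f s) := by
  have hmajorant {s : ℝ} (hs : 0 < s) :=
    hasSum_pow_div_factorial_mul_rpow A B βp βm x hs.le (add_nonneg hL hs.le)
  simp_rw [laplaceInt, ← integral_const_mul]
  refine hasSum_integral_of_dominated_convergence
    (fun n s => A ^ n.1 / n.1.factorial * (B ^ n.2 / n.2.factorial) *
      (Real.exp (-(x * s)) * s ^ (βp * n.1) * (L + s) ^ (βm * n.2)))
    (fun n => by fun_prop)
    (fun n => ae_restrict_of_forall_mem measurableSet_Ioi fun s (hs : 0 < s) => ?_)
    (ae_restrict_of_forall_mem measurableSet_Ioi fun s hs => (hmajorant hs).summable)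
    ?_ (ae_restrict_of_forall_mem measurableSet_Ioi hf)
  · rw [norm_mul, Real.norm_eq_abs, Real.norm_of_nonneg (by positivity)]
    exact mul_le_mul_of_nonneg_right (hk n) (by positivity)
  · exact (integrableOn_exp_mul_exp_rpow_mul_exp_rpow hA hB hβp hβm hL hx).congr_fun
      (fun s hs => (hmajorant hs).tsum_eq.symm) measurableSet_Ioi

theorem summable_pow_div_factorial_mul_laplaceInt (hA : 0 ≤ A) (hB : 0 ≤ B)
    (hβp : βp ∈ Ioo 0 1) (hβm : βm ∈ Ioo 0 1) (hL : 0 ≤ L) (hx : 0 < x) :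
    Summable fun n : ℕ × ℕ => A ^ n.1 / n.1.factorial * (B ^ n.2 / n.2.factorial) *
      laplaceInt (βp * n.1) (βm * n.2) L x :=
  (hasSum_mul_laplaceInt hA hB hβp hβm hL hx (fun n => (abs_of_nonneg (by positivity)).le)
    fun _ hs => hasSum_pow_div_factorial_mul_rpow A B βp βm x hs.le (by positivity)).summable

theorem hasSum_im_tsKernel_neg (ap βp am βm x : ℝ) (hL : 0 ≤ L) (hs : 0 ≤ s) :
    HasSum (fun n : ℕ × ℕ => (-ap) ^ n.1 / n.1.factorial * ((-am) ^ n.2 / n.2.factorial) *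
        Real.sin (Real.pi * (βp * n.1)) *
        (Real.exp (-(x * s)) * s ^ (βp * n.1) * (L + s) ^ (βm * n.2)))
      (tsKernel ap βp am βm L x (-s : ℝ)).im := by
  have h := (Complex.hasSum_im (hasSum_exp_mul_exp
    (-(ap * s ^ βp : ℝ) * Complex.exp (βp * Real.pi * Complex.I))
    ((-(am * (L + s) ^ βm) : ℝ) : ℂ))).mul_left (Real.exp (-(x * s)))
  rw [← Complex.exp_eq_exp_ℂ, ← Complex.ofReal_exp, Complex.im_mul_ofReal, mul_comm (Complex.im _),
    ← mul_assoc, ← im_tsKernel_neg hL hs] at h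
  refine h.congr_fun fun n => ?_
  have hterm : (-(ap * s ^ βp : ℝ) * Complex.exp (βp * Real.pi * Complex.I)) ^ n.1 /
      (n.1.factorial : ℂ) * (((-(am * (L + s) ^ βm) : ℝ) : ℂ) ^ n.2 / (n.2.factorial : ℂ)) =
      (((-(ap * s ^ βp)) ^ n.1 / n.1.factorial *
        ((-(am * (L + s) ^ βm)) ^ n.2 / n.2.factorial) : ℝ) : ℂ) *
        Complex.exp ((Real.pi * (βp * n.1) : ℝ) * Complex.I) := by
    rw [mul_pow, ← Complex.exp_nat_mul]
    push_cast
    rw [show (n.1 : ℂ) * (βp * Real.pi * Complex.I) = Real.pi * (βp * n.1) * Complex.I by ring]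
    ring
  rw [hterm, Complex.im_ofReal_mul, Complex.exp_ofReal_mul_I_im, Real.rpow_mul_natCast hs,
    Real.rpow_mul_natCast (add_nonneg hL hs), neg_mul_eq_neg_mul ap, neg_mul_eq_neg_mul am,
    mul_pow, mul_pow]
  ring

theorem hasSum_integral_im_tsKernel (ap am : ℝ) (hβp : βp ∈ Ioo 0 1) (hβm : βm ∈ Ioo 0 1)
    (hL : 0 ≤ L) (hx : 0 < x) :
    HasSum (fun n : ℕ × ℕ => (-ap) ^ n.1 / n.1.factorial * ((-am) ^ n.2 / n.2.factorial) *
        Real.sin (Real.pi * (βp * n.1)) * laplaceInt (βp * n.1) (βm * n.2) L x)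
      (∫ s in Ioi (0 : ℝ), (tsKernel ap βp am βm L x (-s : ℝ)).im) := by
  refine hasSum_mul_laplaceInt (abs_nonneg ap) (abs_nonneg am) hβp hβm hL hx (fun n => ?_)
    fun s hs => hasSum_im_tsKernel_neg ap βp am βm x hL hs.le
  simp only [abs_mul, abs_div, abs_pow, abs_neg, Nat.abs_cast]
  exact mul_le_of_le_one_right (by positivity) (Real.abs_sin_le_one _)

end LaplaceExpansion

theorem inv_Gamma_mul_Gamma_neg (b : ℝ) :
    (Real.Gamma (1 + b) * Real.Gamma (-b))⁻¹ = -(Real.sin (Real.pi * b) / Real.pi) := by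
  rw [← sub_neg_eq_add 1 b, mul_comm, Real.Gamma_mul_Gamma_one_sub, inv_div, mul_neg,
    Real.sin_neg, neg_div]

section GammaQuot

variable {z c : ℝ}

theorem gammaQuot_of_ne_zero (hz : Real.Gamma z ≠ 0) (n : ℕ) :
    gammaQuot z n = Real.Gamma (z + n) / Real.Gamma z := by
  rcases eq_or_ne n 0 with rfl | hn
  · rw [gammaQuot, if_pos rfl, Nat.cast_zero, add_zero, div_self hz]
  · rw [gammaQuot, if_neg hn]

theorem gammaQuot_zero_succ (n : ℕ) : gammaQuot 0 (n + 1) = 0 := by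
  rw [gammaQuot, if_neg n.succ_ne_zero, Real.Gamma_zero, div_zero]

theorem gammaQuot_succ (hz : z = 0 ∨ NotInt z) (n : ℕ) :
    gammaQuot z (n + 1) = (z + n) * gammaQuot z n := by
  rcases hz with rfl | hz
  · rcases n with _ | n
    · rw [gammaQuot_zero_succ, Nat.cast_zero, add_zero, zero_mul]
    · rw [gammaQuot_zero_succ, gammaQuot_zero_succ, mul_zero]
  · have hΓ : Real.Gamma z ≠ 0 := Real.Gamma_ne_zero fun m => mod_cast hz (-m)
    rw [gammaQuot_of_ne_zero hΓ, gammaQuot_of_ne_zero hΓ, Nat.cast_succ, ← add_assoc,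
      Real.Gamma_add_one (mod_cast hz.add_intCast_ne_zero n), mul_div_assoc]

theorem neg_one_pow_div_factorial_mul_gammaQuot_neg (hc : c = 0 ∨ NotInt c) (n : ℕ) :
    (-1) ^ n / n.factorial * gammaQuot (-c) n = Ring.choose c n := by
  induction n with
  | zero => simp [gammaQuot]
  | succ n ih =>
    have hchoose := succ_mul_choose_succ c n
    rw [gammaQuot_succ (hc.imp neg_eq_zero.2 NotInt.neg), Nat.factorial_succ, pow_succ]
    rw [← ih] at hchoose
    refine mul_left_cancel₀ n.cast_add_one_ne_zero (Eq.trans ?_ hchoose.symm)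
    push_cast
    field_simp
    ring

end GammaQuot

section Terms

variable {β αp βp lp αm βm lm x : ℝ}

/-- The factor `(-a₊)^{n₂} (-a₋)^{n₃} / (n₂! n₃! Γ(1 + β₊ n₂) Γ(-β₊ n₂))` common to the terms with
indices `(n₂, n₃)`. -/
noncomputable def tsWeight (αp βp αm βm : ℝ) (n : ℕ × ℕ) : ℝ :=
  (-tsA αp βp) ^ n.1 / n.1.factorial * ((-tsA αm βm) ^ n.2 / n.2.factorial) *
    (Real.Gamma (1 + βp * n.1) * Real.Gamma (-(βp * n.1)))⁻¹

/-- The sum over `n₁` of the terms with indices `(n₂, n₃) = n`; see `hasSum_tsTerm`. -/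
noncomputable def tsInner (αp βp lp αm βm lm x : ℝ) (n : ℕ × ℕ) : ℝ :=
  tsWeight αp βp αm βm n * laplaceInt (βp * n.1) (βm * n.2) (lp + lm) x

theorem tsWeight_zero_left (αp βp αm βm : ℝ) (n : ℕ) : tsWeight αp βp αm βm (0, n) = 0 := by
  simp [tsWeight]

theorem tsTerm_eq (hl : 0 < lp + lm) (hx : 0 < x) {n₃ : ℕ} (hc : βm * n₃ = 0 ∨ NotInt (βm * n₃))
    (n₁ n₂ : ℕ) :
    tsTerm αp βp lp αm βm lm x n₁ n₂ n₃ = tsWeight αp βp αm βm (n₂, n₃) *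
      (x ^ (-(1 + βp * n₂ + βm * n₃)) *
          (tricomiRegCoeff (βp * n₂) (βm * n₃) n₁ * (x * (lp + lm)) ^ n₁) +
        (lp + lm) ^ (1 + βp * n₂ + βm * n₃) *
          (tricomiSingCoeff (βp * n₂) (βm * n₃) n₁ * (x * (lp + lm)) ^ n₁)) := by
  rw [tsTerm, tsD1, tsD2, tsWeight, tricomiRegCoeff, tricomiSingCoeff,
    ← neg_one_pow_div_factorial_mul_gammaQuot_neg hc, neg_pow (tsA αp βp), neg_pow (tsA αm βm)]
  generalize βp * (n₂ : ℝ) = b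
  generalize βm * (n₃ : ℝ) = c
  have hxpow : x ^ (-1 + (n₁ : ℝ) - b - c) = x ^ (-(1 + b + c)) * x ^ n₁ := by
    rw [← Real.rpow_add_natCast hx.ne']
    ring_nf
  have hlpow : (lp + lm) ^ (1 + (n₁ : ℝ) + b + c) = (lp + lm) ^ (1 + b + c) * (lp + lm) ^ n₁ := by
    rw [← Real.rpow_add_natCast hl.ne']
    ring_nf
  rw [hxpow, hlpow, show 1 - (n₁ : ℝ) + b + c = 1 + (b + c) - n₁ by ring,
    show -1 - (n₁ : ℝ) - b - c = -1 - n₁ - (b + c) by ring]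
  simp only [div_eq_mul_inv, mul_inv, mul_pow, pow_add]
  ring

theorem notInt_mul_natCast (hβ : Irrational β) {n : ℕ} (hn : n ≠ 0) : NotInt (β * n) :=
  (hβ.mul_natCast hn).ne_int

theorem notInt_mul_natCast_add (hβp : Irrational βp)
    (hβ : ∀ m n : ℕ, 1 ≤ m → 1 ≤ n → ∀ k : ℤ, (m : ℝ) * βp + n * βm ≠ k) {m : ℕ} (hm : m ≠ 0)
    (n : ℕ) : NotInt (βp * m + βm * n) := by
  rcases eq_or_ne n 0 with rfl | hn
  · simpa using notInt_mul_natCast hβp hm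
  · intro k hk
    exact hβ m n (Nat.one_le_iff_ne_zero.2 hm) (Nat.one_le_iff_ne_zero.2 hn) k (by linarith)

theorem hasSum_tsTerm (hβp : 0 ≤ βp) (hβp' : Irrational βp) (hβm : 0 ≤ βm) (hβm' : Irrational βm)
    (hβ : ∀ m n : ℕ, 1 ≤ m → 1 ≤ n → ∀ k : ℤ, (m : ℝ) * βp + n * βm ≠ k)
    (hl : 0 < lp + lm) (hx : 0 < x) (n₂ n₃ : ℕ) :
    HasSum (fun n₁ => tsTerm αp βp lp αm βm lm x n₁ n₂ n₃)
      (tsInner αp βp lp αm βm lm x (n₂, n₃)) := by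
  have hc : βm * n₃ = 0 ∨ NotInt (βm * n₃) := by
    rcases eq_or_ne n₃ 0 with rfl | hn₃
    · simp
    · exact .inr (notInt_mul_natCast hβm' hn₃)
  simp_rw [tsTerm_eq hl hx hc, tsInner]
  rcases eq_or_ne n₂ 0 with rfl | hn₂
  · simp only [tsWeight_zero_left, zero_mul, hasSum_zero]
  · have hb : 0 ≤ βp * n₂ := by positivity
    have hc0 : 0 ≤ βm * n₃ := by positivity
    exact (hasSum_laplaceInt (by linarith) (notInt_mul_natCast_add hβp' hβ hn₂ n₃) (by linarith)
      hl hx).mul_left _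

theorem hasSum_tsInner (αp αm : ℝ) (hβp : βp ∈ Ioo 0 1) (hβm : βm ∈ Ioo 0 1) (hl : 0 ≤ lp + lm)
    (hx : 0 < x) :
    HasSum (tsInner αp βp lp αm βm lm x) (-((∫ s in Ioi (0 : ℝ),
      (tsKernel (tsA αp βp) βp (tsA αm βm) βm (lp + lm) x (-s : ℝ)).im) / Real.pi)) := by
  rw [← div_neg, div_eq_mul_inv]
  refine ((hasSum_integral_im_tsKernel _ _ hβp hβm hl hx).mul_right _).congr_fun fun n => ?_
  rw [tsInner, tsWeight, inv_Gamma_mul_Gamma_neg]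
  ring

end Terms

/-! ### Absolute convergence of the triple series -/

section GammaBounds

variable {b c y σ δ : ℝ}

theorem two_mul_le_abs_sin_pi_mul (h : ∀ k : ℤ, δ ≤ |y - k|) :
    2 * δ ≤ |Real.sin (Real.pi * y)| := by
  have habs : |Real.pi * (y - round y)| = Real.pi * |y - round y| := by
    rw [abs_mul, abs_of_pos Real.pi_pos]
  have hround : |Real.pi * (y - round y)| ≤ Real.pi / 2 := by
    rw [habs]
    nlinarith [Real.pi_pos, abs_sub_round y]
  calc 2 * δ ≤ 2 * |y - round y| := by gcongr; exact h _
    _ = 2 / Real.pi * |Real.pi * (y - round y)| := by rw [habs]; field_simp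
    _ ≤ |Real.sin (Real.pi * (y - round y))| := Real.mul_abs_le_abs_sin hround
    _ = |Real.sin (Real.pi * y)| := by
        rw [mul_sub, mul_comm Real.pi (round y : ℝ), Real.sin_sub_int_mul_pi, abs_mul, abs_zpow,
          abs_neg, abs_one, one_zpow, one_mul]

theorem abs_Gamma_neg_le (hy : 0 < 1 + y) (hδ : 0 < δ) (h : ∀ k : ℤ, δ ≤ |y - k|) :
    |Real.Gamma (-y)| ≤ Real.pi * δ⁻¹ * (Real.Gamma (1 + y))⁻¹ := by
  have hΓ := Real.Gamma_pos_of_pos hy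
  have hreflection := congrArg abs (Real.Gamma_mul_Gamma_one_sub (-y))
  rw [sub_neg_eq_add, mul_neg, Real.sin_neg, div_neg, abs_neg, abs_mul, abs_div, abs_of_pos hΓ,
    abs_of_pos Real.pi_pos] at hreflection
  have hsin := two_mul_le_abs_sin_pi_mul h
  rw [← div_eq_mul_inv, le_div_iff₀ hΓ, hreflection, div_eq_mul_inv]
  gcongr
  linarith

theorem abs_inv_Gamma_mul_Gamma_neg_le (b : ℝ) :
    |(Real.Gamma (1 + b) * Real.Gamma (-b))⁻¹| ≤ Real.pi⁻¹ := by
  rw [inv_Gamma_mul_Gamma_neg, abs_neg, abs_div, abs_of_pos Real.pi_pos, div_eq_mul_inv]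
  exact mul_le_of_le_one_left (by positivity) (Real.abs_sin_le_one _)

theorem abs_inv_Gamma_neg_le (hc : -1 < c) :
    |(Real.Gamma (-c))⁻¹| ≤ Real.pi⁻¹ * Real.Gamma (1 + c) := by
  have hΓ : 0 < Real.Gamma (1 + c) := Real.Gamma_pos_of_pos (by linarith)
  have h := abs_inv_Gamma_mul_Gamma_neg_le c
  rwa [mul_inv, abs_mul, abs_of_pos (inv_pos.2 hΓ), inv_mul_le_iff₀ hΓ, mul_comm] at h

theorem Gamma_mul_Gamma_le {u v : ℝ} (hu : 1 ≤ u) (hv : 1 ≤ v) :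
    Real.Gamma u * Real.Gamma v ≤ Real.Gamma (u + v) := by
  have hbeta := integral_rpow_mul_one_add_rpow (b := u - 1) (c := -(u + v)) (by linarith)
    (by linarith)
  have hone := integral_rpow_mul_one_add_rpow (b := 0) (c := -2) (by norm_num) (by norm_num)
  have hle : ∫ t in Ioi (0 : ℝ), t ^ (u - 1) * (1 + t) ^ (-(u + v)) ≤
      ∫ t in Ioi (0 : ℝ), t ^ (0 : ℝ) * (1 + t) ^ (-2 : ℝ) := by
    refine setIntegral_mono_on
      (integrableOn_rpow_mul_one_add_rpow (by linarith) (by linarith))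
      (integrableOn_rpow_mul_one_add_rpow (by norm_num) (by norm_num)) measurableSet_Ioi
      fun t (ht : 0 < t) => ?_
    calc t ^ (u - 1) * (1 + t) ^ (-(u + v)) ≤ (1 + t) ^ (u - 1) * (1 + t) ^ (-(u + v)) := by
          gcongr
          linarith
      _ = (1 + t) ^ (-1 - v) := by rw [← Real.rpow_add (by linarith)]; ring_nf
      _ ≤ (1 + t) ^ (-2 : ℝ) := Real.rpow_le_rpow_of_exponent_le (by linarith) (by linarith)
      _ = t ^ (0 : ℝ) * (1 + t) ^ (-2 : ℝ) := by rw [Real.rpow_zero, one_mul]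
  rw [hbeta, hone] at hle
  norm_num at hle
  rwa [show -1 - (u - 1) - (-v + -u) = v by ring,
    div_le_one (Real.Gamma_pos_of_pos (by linarith))] at hle

theorem factorial_mul_Gamma_le {n : ℕ} (hn : n ≤ σ) :
    n.factorial * Real.Gamma (1 + σ - n) ≤ Real.Gamma (1 + σ) := by
  induction n generalizing σ with
  | zero => simp
  | succ n ih =>
    push_cast at hn
    have hσ : 0 < σ := n.cast_add_one_pos.trans_le hn
    have hΓ := ih (σ := σ - 1) (by linarith)
    rw [add_sub_cancel] at hΓ
    calc ((n + 1).factorial : ℝ) * Real.Gamma (1 + σ - (n + 1 : ℕ))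
        = (n + 1) * (n.factorial * Real.Gamma (σ - n)) := by
          rw [Nat.factorial_succ]
          push_cast
          ring_nf
      _ ≤ σ * Real.Gamma σ := mul_le_mul hn hΓ (mul_nonneg (Nat.cast_nonneg _)
          (Real.Gamma_pos_of_pos (by linarith)).le) hσ.le
      _ = Real.Gamma (1 + σ) := by rw [add_comm, Real.Gamma_add_one hσ.ne']

theorem factorial_le_pow_mul_Gamma_mul_Gamma {n : ℕ} (hσ : 0 ≤ σ) (hn : σ < n) :
    n.factorial ≤ 3 ^ (n + 1) * (Real.Gamma (1 + σ) * Real.Gamma (n - σ)) := by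
  have hint : IntegrableOn (fun t : ℝ => t ^ σ * (1 + t) ^ (-(n + 1 : ℝ))) (Ioi 0) :=
    integrableOn_rpow_mul_one_add_rpow (by linarith) (by linarith)
  have hsub : Ioc (1 : ℝ) 2 ⊆ Ioi 0 := fun t ht => one_pos.trans ht.1
  have hbeta : ∫ t in Ioi (0 : ℝ), t ^ σ * (1 + t) ^ (-(n + 1 : ℝ)) =
      Real.Gamma (1 + σ) * Real.Gamma (n - σ) / n.factorial := by
    rw [integral_rpow_mul_one_add_rpow (by linarith) (by linarith), ← Real.Gamma_nat_eq_factorial]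
    ring_nf
  have hle : ((3 : ℝ) ^ (n + 1))⁻¹ ≤ Real.Gamma (1 + σ) * Real.Gamma (n - σ) / n.factorial := by
    calc ((3 : ℝ) ^ (n + 1))⁻¹ = ∫ _ in Ioc (1 : ℝ) 2, ((3 : ℝ) ^ (n + 1))⁻¹ := by norm_num
      _ ≤ ∫ t in Ioc (1 : ℝ) 2, t ^ σ * (1 + t) ^ (-(n + 1 : ℝ)) := by
          refine setIntegral_mono_on (by simp) (hint.mono_set hsub) measurableSet_Ioc fun t ht => ?_
          have ht0 : 0 < 1 + t := by linarith [ht.1]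
          rw [Real.rpow_neg ht0.le, ← Nat.cast_succ, Real.rpow_natCast]
          calc ((3 : ℝ) ^ (n + 1))⁻¹ ≤ ((1 + t) ^ (n + 1))⁻¹ := by gcongr; linarith [ht.2]
            _ ≤ t ^ σ * ((1 + t) ^ (n + 1))⁻¹ :=
              le_mul_of_one_le_left (by positivity) (Real.one_le_rpow ht.1.le hσ)
      _ ≤ ∫ t in Ioi (0 : ℝ), t ^ σ * (1 + t) ^ (-(n + 1 : ℝ)) := by
          refine setIntegral_mono_set hint (ae_restrict_of_forall_mem measurableSet_Ioi
            fun t (ht : 0 < t) => ?_) hsub.eventuallyLE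
          positivity
      _ = _ := hbeta
  rwa [le_div_iff₀ (by positivity), inv_mul_le_iff₀ (by positivity)] at hle

theorem factorial_mul_abs_Gamma_le (hσ : 0 ≤ σ) (hδ : 0 < δ) (h : ∀ k : ℤ, δ ≤ |σ - k|) (n : ℕ) :
    n.factorial * |Real.Gamma (1 + σ - n)| ≤ Real.pi * δ⁻¹ * 3 ^ (n + 1) * Real.Gamma (1 + σ) := by
  have hΓσ : 0 < Real.Gamma (1 + σ) := Real.Gamma_pos_of_pos (by linarith)
  rcases le_or_gt (n : ℝ) σ with hn | hn
  · have hδ1 : δ ≤ 1 := by linarith [h (round σ), abs_sub_round σ]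
    have hconst : 1 ≤ Real.pi * δ⁻¹ * 3 ^ (n + 1) :=
      one_le_mul_of_one_le_of_one_le (one_le_mul_of_one_le_of_one_le
        (by linarith [Real.pi_gt_three]) ((one_le_inv₀ hδ).2 hδ1)) (one_le_pow₀ (by norm_num))
    rw [abs_of_pos (Real.Gamma_pos_of_pos (by linarith))]
    exact (factorial_mul_Gamma_le hn).trans (le_mul_of_one_le_left hΓσ.le hconst)
  · have : 0 < Real.Gamma (n - σ) := Real.Gamma_pos_of_pos (by linarith)
    have hreflection := abs_Gamma_neg_le (y := n - 1 - σ) (by linarith) hδ fun k => by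
      have hk := h (n - 1 - k)
      push_cast at hk
      rwa [abs_sub_comm, show (n : ℝ) - 1 - k - σ = n - 1 - σ - k by ring] at hk
    rw [show -((n : ℝ) - 1 - σ) = 1 + σ - n by ring,
      show 1 + ((n : ℝ) - 1 - σ) = n - σ by ring] at hreflection
    calc n.factorial * |Real.Gamma (1 + σ - n)|
        ≤ 3 ^ (n + 1) * (Real.Gamma (1 + σ) * Real.Gamma (n - σ)) *
            (Real.pi * δ⁻¹ * (Real.Gamma (n - σ))⁻¹) := by
          gcongr
          exact factorial_le_pow_mul_Gamma_mul_Gamma hσ hn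
      _ = Real.pi * δ⁻¹ * 3 ^ (n + 1) * Real.Gamma (1 + σ) := by field_simp

theorem abs_choose_le {M : ℕ} (hc : 0 ≤ c) (hcM : c ≤ M) (n : ℕ) :
    |Ring.choose c n| ≤ 2 ^ (M + n) := by
  have hle : |Ring.choose c n| ≤ ((M + n).choose n : ℝ) := by
    induction n with
    | zero => simp
    | succ n ih =>
      have hcn : |c - n| ≤ M + (n + 1) := abs_le.2 ⟨by linarith, by linarith⟩
      have hsucc : ((M + n + 1).choose (n + 1) : ℝ) * (n + 1) = (M + (n + 1)) * (M + n).choose n :=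
        mod_cast (Nat.add_one_mul_choose_eq (M + n) n).symm
      refine le_of_mul_le_mul_left ?_ (n.cast_add_one_pos (α := ℝ))
      calc (n + 1 : ℝ) * |Ring.choose c (n + 1)| = |c - n| * |Ring.choose c n| := by
            rw [← abs_mul, ← succ_mul_choose_succ, abs_mul,
              abs_of_pos (n.cast_add_one_pos (α := ℝ))]
        _ ≤ (M + (n + 1)) * (M + n).choose n := by gcongr
        _ = (n + 1) * ((M + (n + 1)).choose (n + 1)) := by rw [← hsucc, mul_comm, add_assoc]
  exact hle.trans (mod_cast Nat.choose_le_two_pow _ _)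

theorem abs_tricomiRegCoeff_le {M : ℕ} (hb : 0 ≤ b) (hc : 0 ≤ c) (hcM : c ≤ M) (hδ : 0 < δ)
    (hδ1 : δ ≤ 1) (h : c = 0 ∨ ∀ k : ℤ, δ ≤ |b + c - k|) (n : ℕ) :
    |tricomiRegCoeff b c n| ≤
      3 * Real.pi * δ⁻¹ * 2 ^ M * 6 ^ n / n.factorial * Real.Gamma (1 + (b + c)) := by
  have hΓ : 0 < Real.Gamma (1 + (b + c)) := Real.Gamma_pos_of_pos (by linarith)
  have hchoose := abs_choose_le hc hcM n
  rw [tricomiRegCoeff, abs_mul]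
  rcases h with rfl | h
  · rcases n with _ | n
    · have hconst : 1 ≤ 3 * Real.pi * δ⁻¹ * 2 ^ M :=
        one_le_mul_of_one_le_of_one_le (one_le_mul_of_one_le_of_one_le
          (by linarith [Real.pi_gt_three]) ((one_le_inv₀ hδ).2 hδ1)) (one_le_pow₀ one_le_two)
      rw [add_zero] at hΓ ⊢
      simpa [abs_of_pos hΓ] using le_mul_of_one_le_left hΓ.le hconst
    · rw [Ring.choose_zero_succ, abs_zero, zero_mul]
      positivity
  · calc |Ring.choose c n| * |Real.Gamma (1 + (b + c) - n)|
        ≤ 2 ^ (M + n) *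
            (Real.pi * δ⁻¹ * 3 ^ (n + 1) * Real.Gamma (1 + (b + c)) / n.factorial) := by
          gcongr
          rw [le_div_iff₀' (by positivity)]
          exact factorial_mul_abs_Gamma_le (by linarith) hδ h n
      _ = _ := by
          rw [show (6 : ℝ) = 2 * 3 by norm_num, mul_pow, pow_add, pow_succ]
          ring

theorem abs_tricomiSingCoeff_le (hb : 0 ≤ b) (hc : 0 ≤ c) (hδ : 0 < δ)
    (h : c = 0 ∨ ∀ k : ℤ, δ ≤ |b + c - k|) (n : ℕ) :
    |tricomiSingCoeff b c n| ≤ δ⁻¹ / n.factorial := by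
  rcases h with rfl | h
  · rw [tricomiSingCoeff, neg_zero, Real.Gamma_zero, inv_zero, mul_zero, abs_zero]
    positivity
  have hΓb : 0 < Real.Gamma (1 + n + b) := Real.Gamma_pos_of_pos (by positivity)
  have : 0 < Real.Gamma (1 + c) := Real.Gamma_pos_of_pos (by positivity)
  have hΓ : 0 < Real.Gamma (1 + (1 + n + (b + c))) := Real.Gamma_pos_of_pos (by positivity)
  have hreflection := abs_Gamma_neg_le (y := 1 + n + (b + c)) (by positivity) hδ fun k => by
    have hk := h (k - 1 - n)
    push_cast at hk
    rwa [show b + c - ((k : ℝ) - 1 - n) = 1 + n + (b + c) - k by ring] at hk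
  have hbeta : Real.Gamma (1 + n + b) * Real.Gamma (1 + c) ≤
      Real.Gamma (1 + (1 + n + (b + c))) := by
    convert Gamma_mul_Gamma_le (u := 1 + n + b) (v := 1 + c) _ _ using 2 <;>
      linarith [n.cast_nonneg (α := ℝ)]
  rw [tricomiSingCoeff, show -1 - (n : ℝ) - (b + c) = -(1 + n + (b + c)) by ring, abs_mul, abs_div,
    abs_mul, abs_mul, abs_pow, abs_neg, abs_one, one_pow, one_mul, Nat.abs_cast, abs_of_pos hΓb]
  calc |Real.Gamma (-(1 + n + (b + c)))| * Real.Gamma (1 + n + b) / n.factorial *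
        |(Real.Gamma (-c))⁻¹|
      ≤ Real.pi * δ⁻¹ * (Real.Gamma (1 + (1 + n + (b + c))))⁻¹ * Real.Gamma (1 + n + b) /
          n.factorial * (Real.pi⁻¹ * Real.Gamma (1 + c)) := by
        gcongr
        exact abs_inv_Gamma_neg_le (by linarith)
    _ = δ⁻¹ / n.factorial * (Real.Gamma (1 + n + b) * Real.Gamma (1 + c) /
          Real.Gamma (1 + (1 + n + (b + c)))) := by
        field_simp [Real.pi_ne_zero]
    _ ≤ δ⁻¹ / n.factorial := mul_le_of_le_one_right (by positivity) ((div_le_one hΓ).2 hbeta)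

end GammaBounds

section TripleSum

variable {b c αp βp lp αm βm lm L x : ℝ}

theorem _root_.NoSmallDivisors.swap (h : NoSmallDivisors βp βm) : NoSmallDivisors βm βp := by
  obtain ⟨c, K, hc, h⟩ := h
  refine ⟨c, K, hc, fun m n hm hn k => ?_⟩
  rw [add_comm (m : ℝ), add_comm (m * βm)]
  exact h n m hn hm k

theorem _root_.NoSmallDivisors.exists_inv_pow_le (h : NoSmallDivisors βp βm) :
    ∃ E : ℝ, 1 ≤ E ∧ ∀ m n : ℕ, 1 ≤ m → 1 ≤ n → ∀ k : ℤ,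
      (E ^ (m + n))⁻¹ ≤ |βp * m + βm * n - k| := by
  obtain ⟨c, K, hc, h⟩ := h
  refine ⟨max 1 c⁻¹ * Real.exp |K|, one_le_mul_of_one_le_of_one_le (le_max_left _ _)
    (Real.one_le_exp (abs_nonneg K)), fun m n hm hn k => ?_⟩
  have hpow : (max 1 c⁻¹ ^ (m + n))⁻¹ ≤ c := inv_le_of_inv_le₀ hc <|
    (le_max_right 1 c⁻¹).trans (le_self_pow₀ (le_max_left _ _) (by omega))
  have hK : K * (m + n) ≤ |K| * (m + n) := by gcongr; exact le_abs_self K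
  calc ((max 1 c⁻¹ * Real.exp |K|) ^ (m + n))⁻¹
      = (max 1 c⁻¹ ^ (m + n))⁻¹ * Real.exp (-(|K| * (m + n))) := by
        rw [mul_pow, mul_inv, ← Real.exp_nat_mul, ← Real.exp_neg, mul_comm |K|, Nat.cast_add]
    _ ≤ c * Real.exp (-K * (m + n)) := by gcongr; linarith
    _ ≤ |βp * m + βm * n - k| := by simpa only [mul_comm] using h m n hm hn k

theorem rpow_mul_Gamma_le_laplaceInt (hb : 0 ≤ b) (hc : 0 ≤ c) (hL : 0 < L) (hx : 0 < x) :
    x ^ (-(1 + b + c)) * Real.Gamma (1 + (b + c)) ≤ laplaceInt b c L x := by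
  have hΓ : x ^ (-(1 + b + c)) * Real.Gamma (1 + (b + c)) =
      ∫ s in Ioi (0 : ℝ), Real.exp (-(x * s)) * s ^ (b + c) := by
    have h := Real.integral_rpow_mul_exp_neg_mul_Ioi (a := 1 + (b + c)) (by linarith) hx
    rw [one_div, Real.inv_rpow hx.le, ← Real.rpow_neg hx.le, add_sub_cancel_left,
      ← add_assoc] at h
    rw [← add_assoc, ← h]
    simp only [mul_comm]
  rw [hΓ, laplaceInt]
  refine setIntegral_mono_on (integrableOn_exp_mul_rpow (by linarith) hx)
    (integrableOn_exp_mul_rpow_mul_add_rpow (by linarith) c hL hx) measurableSet_Ioi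
    fun s (hs : 0 < s) => ?_
  rw [Real.rpow_add hs, ← mul_assoc]
  gcongr
  linarith

theorem abs_tsWeight_le (αp βp αm βm : ℝ) (n : ℕ × ℕ) :
    |tsWeight αp βp αm βm n| ≤
      |tsA αp βp| ^ n.1 / n.1.factorial * (|tsA αm βm| ^ n.2 / n.2.factorial) := by
  have hΓ : |(Real.Gamma (1 + βp * n.1) * Real.Gamma (-(βp * n.1)))⁻¹| ≤ 1 :=
    (abs_inv_Gamma_mul_Gamma_neg_le _).trans
      (inv_le_one_of_one_le₀ (by linarith [Real.pi_gt_three]))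
  rw [tsWeight, abs_mul, abs_mul, abs_div, abs_div, abs_pow, abs_pow, abs_neg, abs_neg,
    Nat.abs_cast, Nat.abs_cast]
  exact mul_le_of_le_one_right (by positivity) hΓ

theorem abs_tricomi_terms_le {δ : ℝ} {M : ℕ} (hb : 0 ≤ b) (hc : 0 ≤ c) (hcM : c ≤ M) (hδ : 0 < δ)
    (hδ1 : δ ≤ 1) (h : c = 0 ∨ ∀ k : ℤ, δ ≤ |b + c - k|) (hL : 0 < L) (hx : 0 < x) (n : ℕ) :
    |x ^ (-(1 + b + c)) * (tricomiRegCoeff b c n * (x * L) ^ n) +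
        L ^ (1 + b + c) * (tricomiSingCoeff b c n * (x * L) ^ n)| ≤
      (6 * (x * L)) ^ n / n.factorial * (3 * Real.pi * δ⁻¹ * 2 ^ M * laplaceInt b c L x) +
        (x * L) ^ n / n.factorial * (δ⁻¹ * L ^ (1 + b + c)) := by
  have hxpow : 0 < x ^ (-(1 + b + c)) := by positivity
  have hLpow : 0 < L ^ (1 + b + c) := by positivity
  have hpow : 0 < (x * L) ^ n := by positivity
  refine (abs_add_le _ _).trans (add_le_add ?_ ?_)
  · rw [abs_mul, abs_mul, abs_of_pos hxpow, abs_of_pos hpow]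
    calc x ^ (-(1 + b + c)) * (|tricomiRegCoeff b c n| * (x * L) ^ n)
        ≤ x ^ (-(1 + b + c)) * (3 * Real.pi * δ⁻¹ * 2 ^ M * 6 ^ n / n.factorial *
            Real.Gamma (1 + (b + c)) * (x * L) ^ n) := by
          gcongr
          exact abs_tricomiRegCoeff_le hb hc hcM hδ hδ1 h n
      _ = (6 * (x * L)) ^ n / n.factorial * (3 * Real.pi * δ⁻¹ * 2 ^ M *
            (x ^ (-(1 + b + c)) * Real.Gamma (1 + (b + c)))) := by
          rw [mul_pow 6]
          ring
      _ ≤ _ := by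
          gcongr
          exact rpow_mul_Gamma_le_laplaceInt hb hc hL hx
  · rw [abs_mul, abs_mul, abs_of_pos hLpow, abs_of_pos hpow]
    calc L ^ (1 + b + c) * (|tricomiSingCoeff b c n| * (x * L) ^ n)
        ≤ L ^ (1 + b + c) * (δ⁻¹ / n.factorial * (x * L) ^ n) := by
          gcongr
          exact abs_tricomiSingCoeff_le hb hc hδ h n
      _ = (x * L) ^ n / n.factorial * (δ⁻¹ * L ^ (1 + b + c)) := by ring

theorem abs_tsTerm_le (hβp : 0 ≤ βp) (hβm : βm ∈ Ioo 0 1) (hβm' : Irrational βm)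
    (hl : 0 < lp + lm) (hx : 0 < x) {E : ℝ} (hE : 1 ≤ E)
    (hdiv : ∀ m n : ℕ, 1 ≤ m → 1 ≤ n → ∀ k : ℤ, (E ^ (m + n))⁻¹ ≤ |βp * m + βm * n - k|)
    (n₁ n₂ n₃ : ℕ) :
    |tsTerm αp βp lp αm βm lm x n₁ n₂ n₃| ≤
      (6 * (x * (lp + lm))) ^ n₁ / n₁.factorial * (3 * Real.pi *
          ((|tsA αp βp| * E) ^ n₂ / n₂.factorial * ((|tsA αm βm| * E * 2) ^ n₃ / n₃.factorial) *
            laplaceInt (βp * n₂) (βm * n₃) (lp + lm) x)) +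
        (x * (lp + lm)) ^ n₁ / n₁.factorial * ((lp + lm) *
          ((|tsA αp βp| * E * (lp + lm) ^ βp) ^ n₂ / n₂.factorial *
            ((|tsA αm βm| * E * (lp + lm) ^ βm) ^ n₃ / n₃.factorial))) := by
  have hb : 0 ≤ βp * n₂ := by positivity
  have hc : 0 ≤ βm * n₃ := mul_nonneg hβm.1.le n₃.cast_nonneg
  have hcM : βm * n₃ ≤ n₃ := mul_le_of_le_one_left n₃.cast_nonneg hβm.2.le
  have hJ : 0 ≤ laplaceInt (βp * n₂) (βm * n₃) (lp + lm) x :=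
    (mul_nonneg (by positivity) (Real.Gamma_pos_of_pos (by linarith)).le).trans
      (rpow_mul_Gamma_le_laplaceInt hb hc hl hx)
  have hn₃ := Nat.eq_zero_or_pos n₃
  have hint : βm * n₃ = 0 ∨ NotInt (βm * n₃) :=
    hn₃.imp (by simp [·]) fun hn₃ => notInt_mul_natCast hβm' hn₃.ne'
  rcases Nat.eq_zero_or_pos n₂ with rfl | hn₂
  · rw [tsTerm_eq hl hx hint, tsWeight_zero_left, zero_mul, abs_zero]
    positivity
  have hdist : βm * n₃ = 0 ∨ ∀ k : ℤ, (E ^ (n₂ + n₃))⁻¹ ≤ |βp * n₂ + βm * n₃ - k| :=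
    hn₃.imp (by simp [·]) (hdiv n₂ n₃ hn₂)
  have hterms := abs_tricomi_terms_le hb hc hcM (by positivity)
    (inv_le_one_of_one_le₀ (one_le_pow₀ hE)) hdist hl hx n₁
  rw [tsTerm_eq hl hx hint, abs_mul]
  refine (mul_le_mul (abs_tsWeight_le αp βp αm βm (n₂, n₃)) hterms (abs_nonneg _)
    (by positivity)).trans_eq ?_
  rw [inv_inv, add_assoc 1, Real.rpow_add hl, Real.rpow_add hl, Real.rpow_one,
    Real.rpow_mul_natCast hl.le, Real.rpow_mul_natCast hl.le]
  simp only [mul_pow, pow_add]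
  ring

theorem summable_tsTerm (αp αm : ℝ) (hdiv : NoSmallDivisors βp βm) (hβp : βp ∈ Ioo 0 1)
    (hβm : βm ∈ Ioo 0 1) (hβm' : Irrational βm) (hl : 0 < lp + lm) (hx : 0 < x) :
    Summable fun n : ℕ × ℕ × ℕ => tsTerm αp βp lp αm βm lm x n.1 n.2.1 n.2.2 := by
  obtain ⟨E, hE, hdiv⟩ := hdiv.exists_inv_pow_le
  have hreg := (summable_pow_div_factorial_mul_laplaceInt (A := |tsA αp βp| * E)
    (B := |tsA αm βm| * E * 2) (by positivity) (by positivity) hβp hβm hl.le hx).mul_left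
    (3 * Real.pi)
  have hsing := (hasSum_exp_mul_exp (|tsA αp βp| * E * (lp + lm) ^ βp)
    (|tsA αm βm| * E * (lp + lm) ^ βm)).summable.mul_left (lp + lm)
  exact .of_norm_bounded ((summable_mul_of_summable_norm
      (Real.summable_pow_div_factorial (6 * (x * (lp + lm)))).norm hreg.norm).add
    (summable_mul_of_summable_norm (Real.summable_pow_div_factorial (x * (lp + lm))).norm
      hsing.norm)) fun n => abs_tsTerm_le hβp.1.le hβm hβm' hl hx hE hdiv n.1 n.2.1 n.2.2

theorem _root_.HasIteratedSum.hasTripleSum {t : ℕ → ℕ → ℕ → ℝ} {T : ℝ} (h : HasIteratedSum t T)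
    (hs : Summable fun n : ℕ × ℕ × ℕ => t n.1 n.2.1 n.2.2) : HasTripleSum t T := by
  obtain ⟨S, hinner, houter⟩ := h
  have hfiber := ((Equiv.prodComm (ℕ × ℕ) ℕ).hasSum_iff.2 hs.hasSum).prod_fiberwise fun n =>
    hinner n.1 n.2
  rw [HasTripleSum, houter.unique hfiber]
  exact hs.hasSum

end TripleSum

section Density

variable {αp βp lp αm βm lm x y : ℝ} {μ : Measure ℝ}

theorem _root_.IsTS.exists_swap (h : IsTS αp βp lp αm βm lm μ) :
    ∃ ν : Measure ℝ, IsTS αm βm lm αp βp lp ν ∧ ∀ u, charFun ν u = charFun μ (-u) := by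
  obtain ⟨μp, _, hp, ⟨ρ, hρ, rfl⟩, rfl⟩ := h
  have := hp.isProb
  have := hρ.isProb
  have : IsProbabilityMeasure (ρ.map fun x => -x) :=
    Measure.isProbabilityMeasure_map (by fun_prop)
  have : IsProbabilityMeasure (μp.map fun x => -x) :=
    Measure.isProbabilityMeasure_map (by fun_prop)
  refine ⟨ρ.conv (μp.map fun x => -x), ⟨ρ, _, hρ, ⟨μp, hp, rfl⟩, rfl⟩, fun u => ?_⟩
  rw [charFun_conv, charFun_conv, charFun_map_neg, charFun_map_neg, neg_neg, mul_comm]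

theorem fourierDensity_neg_of_charFun_neg {ν : Measure ℝ}
    (h : ∀ u, charFun ν u = charFun μ (-u)) (x : ℝ) :
    fourierDensity ν (-x) = fourierDensity μ x := by
  rw [fourierDensity, fourierDensity, ← integral_neg_eq_self]
  simp [h]

theorem _root_.IsTS.exists_series_of_fourierDensity_eq (h : IsTS αp βp lp αm βm lm μ)
    (hαp : 0 < αp) (hβp : βp ∈ Ioo 0 1) (hβp' : Irrational βp) (hlp : 0 < lp) (hαm : 0 < αm)
    (hβm : βm ∈ Ioo 0 1) (hβm' : Irrational βm) (hlm : 0 < lm)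
    (hβ : ∀ m n : ℕ, 1 ≤ m → 1 ≤ n → ∀ k : ℤ, (m : ℝ) * βp + n * βm ≠ k) (hx : 0 < x)
    (hy : y = fourierDensity μ x) :
    ∃ T : ℝ, HasIteratedSum (tsTerm αp βp lp αm βm lm x) T ∧
      (NoSmallDivisors βp βm → HasTripleSum (tsTerm αp βp lp αm βm lm x) T) ∧
      y = Real.exp (tsGamma αp βp lp αm βm lm - lp * x) * T := by
  have hl : 0 < lp + lm := by positivity
  have hsum : HasIteratedSum (tsTerm αp βp lp αm βm lm x) _ :=
    ⟨_, hasSum_tsTerm hβp.1.le hβp' hβm.1.le hβm' hβ hl hx, hasSum_tsInner αp αm hβp hβm hl.le hx⟩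
  rw [h.fourierDensity_eq hαp hβp hlp hαm hβm hlm hx] at hy
  exact ⟨_, hsum, fun hdiv => hsum.hasTripleSum (summable_tsTerm αp αm hdiv hβp hβm hβm' hl hx),
    Complex.ofReal_injective hy⟩

end Density

end TemperedStable

theorem mainTheorem1 (αp βp lp αm βm lm : ℝ)
    (hαp : 0 < αp) (hlp : 0 < lp) (hβp : βp ∈ Set.Ioo (0 : ℝ) 1) (hβp' : Irrational βp)
    (hαm : 0 < αm) (hlm : 0 < lm) (hβm : βm ∈ Set.Ioo (0 : ℝ) 1) (hβm' : Irrational βm)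
    (hβ : ∀ m n : ℕ, 1 ≤ m → 1 ≤ n → ∀ k : ℤ, (m : ℝ) * βp + n * βm ≠ k)
    (μ : MeasureTheory.Measure ℝ) (hμ : IsTS αp βp lp αm βm lm μ) :
    ∃ f : ℝ → ℝ, IsContinuousDensity μ f ∧
      (∀ x : ℝ, 0 < x → ∃ T : ℝ,
        HasIteratedSum (tsTerm αp βp lp αm βm lm x) T ∧
        (NoSmallDivisors βp βm → HasTripleSum (tsTerm αp βp lp αm βm lm x) T) ∧
        f x = Real.exp (tsGamma αp βp lp αm βm lm - lp * x) * T) ∧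
      (∀ x : ℝ, x < 0 → ∃ T : ℝ,
        HasIteratedSum (tsTerm αm βm lm αp βp lp (-x)) T ∧
        (NoSmallDivisors βp βm → HasTripleSum (tsTerm αm βm lm αp βp lp (-x)) T) ∧
        f x = Real.exp (tsGamma αm βm lm αp βp lp - lm * (-x)) * T) := by
  have := hμ.isProbabilityMeasure
  obtain ⟨f, hf, hfx⟩ := TemperedStable.exists_isContinuousDensity μ
    (hμ.integrable_charFun hαp hβp hlp hαm hβm hlm)
  refine ⟨f, hf, fun x hx => ?_, fun x hx => ?_⟩
  · exact hμ.exists_series_of_fourierDensity_eq hαp hβp hβp' hlp hαm hβm hβm' hlm hβ hx (hfx x)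
  · obtain ⟨ν, hν, hcharFun⟩ := hμ.exists_swap
    have hβ' : ∀ m n : ℕ, 1 ≤ m → 1 ≤ n → ∀ k : ℤ, (m : ℝ) * βm + n * βp ≠ k :=
      fun m n hm hn k => add_comm (n * βp) (m * βm) ▸ hβ n m hn hm k
    have hfν : f x = TemperedStable.fourierDensity ν (-x) := by
      rw [TemperedStable.fourierDensity_neg_of_charFun_neg hcharFun, hfx]
    obtain ⟨T, hiter, htriple, hfT⟩ := hν.exists_series_of_fourierDensity_eq hαm hβm hβm' hlm hαp
      hβp hβp' hlp hβ' (neg_pos.2 hx) hfν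
    exact ⟨T, hiter, fun hdiv => htriple hdiv.swap, hfT⟩
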